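/- Let $\Omega=\mathbb{R}\times\mathbb{T}$ with $\mathbb{T}=\mathbb{R}/\mathbb{Z}$, and let $\mathrm{BUC}(\Omega)$ be the space of bounded uniformly continuous vector fields on $\Omega$ with the uniform norm. Let $u=(u_1,u_2)\in C^0([0,\infty),\mathrm{BUC}(\Omega))$ be a global solution of the Navier-Stokes equations $$\partial_t u+(u\cdot\nabla)u=\Delta u-\nabla p,\qquad \operatorname{div}u=0\qquad\text{in }\Omega,$$ which is smooth, with bounded vorticity $\omega=\partial_1u_2-\partial_2u_1$, for every $t>0$ (the equations holding pointwise there), whose initial velocity $u_0=u(\cdot,0)$ is divergence-free in the sense of distributions, and where the pressure is $p=-u_1^2-2\,\partial_2K*(\omega u_1)$, with $K(x_1,x_2)=\frac1{4\pi}\log\bigl(2\cosh(2\pi x_1)-2\cos(2\pi x_2)\bigr)$ and with convolution over $\Omega$. Assume that $\int_{\mathbb{T}}u_1(x_1,x_2,t)\,dx_2=0$ for all $x_1\in\mathbb{R}$ and $t\ge0$, that the initial vorticity $\omega_0=\partial_1(u_0)_2-\partial_2(u_0)_1$ (in the sense of distributions) belongs to $L^\infty(\Omega)$, and that $$\kappa:=\frac{\|\omega_0\|_{L^\infty(\Omega)}}{4\pi^2}<1.$$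 Let $m(x_1,t)=\int_{\mathbb{T}}u_2(x_1,x_2,t)\,dx_2$, $\widehat u=u-(0,m)^\top$ and $\widehat e(x_1,t)=\frac12\int_{\mathbb{T}}|\widehat u(x_1,x_2,t)|^2\,dx_2$. Then for every $\epsilon>0$ there is a constant $C_9>0$, depending only on $\epsilon$ (not on $u$, $\omega_0$ or $\kappa$), such that for all $t\ge0$ $$\sup_{a\in\mathbb{R}}\int_{a-1}^{a+1}\widehat e(x_1,t)\,dx_1\;\le\;\frac{C_9\,\kappa^2}{1-\kappa}\,e^{-\gamma t/2},\qquad \gamma=8\pi^2(1-\epsilon)(1-\kappa).$$ -/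

import Mathlib

open scoped ContDiff
open MeasureTheory Set

noncomputable section

namespace StripNS

/-! Functions on the cylinder `ℝ × 𝕋`, `𝕋 = ℝ/ℤ`, are functions on `ℝ × ℝ` that are
`1`-periodic in the second variable. -/

/-- Partial derivative in the horizontal variable `x₁`. -/
def d₁ (f : ℝ × ℝ → ℝ) (x : ℝ × ℝ) : ℝ := deriv (fun s => f (s, x.2)) x.1

/-- Partial derivative in the vertical variable `x₂`. -/
def d₂ (f : ℝ × ℝ → ℝ) (x : ℝ × ℝ) : ℝ := deriv (fun s => f (x.1, s)) x.2

/-- The Laplace operator on scalar functions. -/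
def lap (f : ℝ × ℝ → ℝ) (x : ℝ × ℝ) : ℝ := d₁ (d₁ f) x + d₂ (d₂ f) x

/-- The horizontal component of a vector field. -/
def comp₁ (v : ℝ × ℝ → ℝ × ℝ) (x : ℝ × ℝ) : ℝ := (v x).1

/-- The vertical component of a vector field. -/
def comp₂ (v : ℝ × ℝ → ℝ × ℝ) (x : ℝ × ℝ) : ℝ := (v x).2

/-- The vorticity `∂₁ v₂ - ∂₂ v₁` of a differentiable vector field. -/
def vort (v : ℝ × ℝ → ℝ × ℝ) (x : ℝ × ℝ) : ℝ := d₁ (comp₂ v) x - d₂ (comp₁ v) x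

/-- The space `BUC(Ω)`: bounded and uniformly continuous vector fields on the cylinder. -/
structure IsBUC (v : ℝ × ℝ → ℝ × ℝ) : Prop where
  periodic : ∀ x₁ x₂ : ℝ, v (x₁, x₂ + 1) = v (x₁, x₂)
  bounded : ∃ B : ℝ, ∀ x, ‖v x‖ ≤ B
  uniformContinuous : UniformContinuous v

/-- `div v = 0` in the sense of distributions. -/
def WeakDivFree (v : ℝ × ℝ → ℝ × ℝ) : Prop :=
  ∀ φ : ℝ × ℝ → ℝ, ContDiff ℝ ∞ φ → HasCompactSupport φ →
    ∫ x, ((v x).1 * d₁ φ x + (v x).2 * d₂ φ x) = 0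

/-- `w = ∂₁ v₂ - ∂₂ v₁` in the sense of distributions. -/
def IsWeakVort (v : ℝ × ℝ → ℝ × ℝ) (w : ℝ × ℝ → ℝ) : Prop :=
  ∀ φ : ℝ × ℝ → ℝ, ContDiff ℝ ∞ φ → HasCompactSupport φ →
    ∫ x, w x * φ x = ∫ x, ((v x).1 * d₂ φ x - (v x).2 * d₁ φ x)

/-- The fundamental solution of the Laplace operator on the cylinder. -/
def K (x : ℝ × ℝ) : ℝ :=
  1 / (4 * Real.pi) *
    Real.log (2 * Real.cosh (2 * Real.pi * x.1) - 2 * Real.cos (2 * Real.pi * x.2))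

/-- A fundamental domain of the cylinder. -/
def cell : Set (ℝ × ℝ) := univ ×ˢ Ioc (0 : ℝ) 1

/-- The pressure `p = -v₁² - 2 ∂₂K * (ω v₁)` of a velocity field `v` with bounded vorticity
`ω`; it is the bounded solution of `-Δp = div ((v · ∇) v)`. -/
def pressure (v : ℝ × ℝ → ℝ × ℝ) (x : ℝ × ℝ) : ℝ :=
  -(v x).1 ^ 2 - 2 * ∫ y in cell, d₂ K (x - y) * (vort v y * (v y).1)

/-- Global solutions `u ∈ C⁰([0,∞), BUC(Ω))` of the Navier-Stokes equations
`∂ₜu + (u · ∇)u = Δu - ∇p`, `div u = 0` on the cylinder, with `p` as above.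
The velocity is smooth for `t > 0`, where the equations hold pointwise, and its vorticity is
bounded at every `t > 0`, as is required for `p` to be defined. -/
structure IsNSSolution (u : ℝ → ℝ × ℝ → ℝ × ℝ) : Prop where
  buc : ∀ t, 0 ≤ t → IsBUC (u t)
  continuous_buc : ∀ t, 0 ≤ t → TendstoUniformly u (u t) (nhdsWithin t (Ici 0))
  smooth : ContDiffOn ℝ ∞ (fun z : ℝ × (ℝ × ℝ) => u z.1 z.2) (Ioi (0 : ℝ) ×ˢ univ)
  vort_bounded : ∀ t, 0 < t → ∃ B : ℝ, ∀ x, |vort (u t) x| ≤ B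
  pressure_differentiable : ∀ t, 0 < t → Differentiable ℝ (pressure (u t))
  divFree_zero : WeakDivFree (u 0)
  divFree : ∀ t, 0 < t → ∀ x, d₁ (comp₁ (u t)) x + d₂ (comp₂ (u t)) x = 0
  momentum₁ : ∀ t, 0 < t → ∀ x,
    deriv (fun s => (u s x).1) t
      + ((u t x).1 * d₁ (comp₁ (u t)) x + (u t x).2 * d₂ (comp₁ (u t)) x)
      = lap (comp₁ (u t)) x - d₁ (pressure (u t)) x
  momentum₂ : ∀ t, 0 < t → ∀ x,
    deriv (fun s => (u s x).2) t
      + ((u t x).1 * d₁ (comp₂ (u t)) x + (u t x).2 * d₂ (comp₂ (u t)) x)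
      = lap (comp₂ (u t)) x - d₂ (pressure (u t)) x

/-- The vertical average `⟨f⟩(x₁) = ∫_𝕋 f(x₁, x₂) dx₂`. -/
def vavg (f : ℝ × ℝ → ℝ) (x₁ : ℝ) : ℝ := ∫ x₂ in (0 : ℝ)..1, f (x₁, x₂)

/-- The oscillating part `v̂ = v - (0, m)`, `m = ⟨v₂⟩`, of a velocity field with
`⟨v₁⟩ = 0`. -/
def osc (v : ℝ × ℝ → ℝ × ℝ) (x : ℝ × ℝ) : ℝ × ℝ := v x - (0, vavg (comp₂ v) x.1)

/-- The energy density `ê(x₁) = ½ ∫_𝕋 |v̂(x₁, x₂)|² dx₂` of the oscillating part, with the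
Euclidean norm. -/
def oscEnergy (v : ℝ × ℝ → ℝ × ℝ) (x₁ : ℝ) : ℝ :=
  1 / 2 * ∫ x₂ in (0 : ℝ)..1, ((osc v (x₁, x₂)).1 ^ 2 + (osc v (x₁, x₂)).2 ^ 2)

/-- `κ = ‖w‖_{L^∞} / (4π²)`. -/
def kappa (w : ℝ × ℝ → ℝ) : ℝ := (eLpNorm w ⊤ volume).toReal / (4 * Real.pi ^ 2)

end StripNS

end

noncomputable section

namespace StripNS

open Filter Topology

/-! The theorem is a localized energy estimate for `û = u - (0,m)`, resting on a maximum principle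
for the vorticity.

Write `M = ‖ω₀‖_∞ = 4π²κ`. In two dimensions the vorticity is transported and diffused without
stretching, so `|ω| ≤ M` at all positive times (`abs_vort_le`). The delicate point is `t → 0`, where
`u` is only uniformly continuous. Duhamel's formula with a localized heat kernel
(`abs_le_of_heat_equation`) gives first `|ω| ≤ C t^(-1/2)`, then boundedness near `t = 0`, then `|ω|
≤ M + O(√t)`; the parabolic maximum principle does the rest.

Since `u₁` and `û₂` have zero vertical mean and their Laplacians are derivatives of the vorticity or
its oscillation, an elliptic estimate gives `|u₁|, |û₂| ≤ 136 M` (`abs_osc_le`).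

Test the equation of `û` with `ψ û`, where `ψ` is a horizontal cut-off of scale `ℓ` around `a`, and
let `E_a` be the weighted energy. Wirtinger's inequality in `x₂` makes the dissipation at least `8π²
E_a`. The mean flow contributes `-∫ ψ ⟨ω⟩ u₁ û₂`, since `∂₁m = ⟨ω⟩`, and this is at most `M E_a`.
All remaining terms carry a derivative of `ψ`. The nonlocal pressure is handled by a Young
inequality, as `∂₂K` is integrable on the cylinder. For `ℓ` large these terms are at most `S = sup_b
E_b`, whence `E_a' ≤ -(8π² - M) E_a + S` (`exists_hasDerivAt_locEnergy_le`).

Put `ν = 4π² - M = 4π²(1-κ) > 0`. The damping `8π² - M` exceeds `ν` by `4π²`, which is enough to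
absorb `S`: the supremum of `e^{νt} E_a` over times and centres is at most its initial bound plus
half of itself, hence at most twice that bound (`locEnergy_decay`). The initial bound is quadratic
in `M`, which produces `κ²`. The rate `ν` is better than the rate `γ/2` required, and no factor
`1/(1-κ)` is lost. -/

/-- `f` is smooth on the space-time domain `I × ℝ²`. -/
def SmoothOn (I : Set ℝ) (f : ℝ → ℝ × ℝ → ℝ) : Prop :=
  ContDiffOn ℝ ∞ (fun z : ℝ × (ℝ × ℝ) => f z.1 z.2) (I ×ˢ univ)

/-- Time derivative. -/
def dt (f : ℝ → ℝ × ℝ → ℝ) (t : ℝ) (x : ℝ × ℝ) : ℝ := deriv (fun s => f s x) t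

/-! ### Calculus of the partial derivatives on the plane. -/

section Space

variable {f g : ℝ × ℝ → ℝ} {x : ℝ × ℝ}

theorem hasDerivAt_d₁ (hf : DifferentiableAt ℝ f x) :
    HasDerivAt (fun s => f (s, x.2)) (fderiv ℝ f x (1, 0)) x.1 := by
  have h := hf.hasFDerivAt.comp_hasDerivAt_of_eq x.1
    ((hasDerivAt_id x.1).prodMk (hasDerivAt_const x.1 x.2)) (by simp)
  simpa [Function.comp_def] using h

theorem hasDerivAt_d₂ (hf : DifferentiableAt ℝ f x) :
    HasDerivAt (fun s => f (x.1, s)) (fderiv ℝ f x (0, 1)) x.2 := by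
  have h := hf.hasFDerivAt.comp_hasDerivAt_of_eq x.2
    ((hasDerivAt_const x.2 x.1).prodMk (hasDerivAt_id x.2)) (by simp)
  simpa [Function.comp_def] using h

theorem d₁_eq (hf : DifferentiableAt ℝ f x) : d₁ f x = fderiv ℝ f x (1, 0) :=
  (hasDerivAt_d₁ hf).deriv

theorem d₂_eq (hf : DifferentiableAt ℝ f x) : d₂ f x = fderiv ℝ f x (0, 1) :=
  (hasDerivAt_d₂ hf).deriv

theorem d₁_funeq (hf : Differentiable ℝ f) : d₁ f = fun x => fderiv ℝ f x (1, 0) :=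
  funext fun x => d₁_eq (hf x)

theorem d₂_funeq (hf : Differentiable ℝ f) : d₂ f = fun x => fderiv ℝ f x (0, 1) :=
  funext fun x => d₂_eq (hf x)

theorem d₁_add (hf : DifferentiableAt ℝ f x) (hg : DifferentiableAt ℝ g x) :
    d₁ (fun y => f y + g y) x = d₁ f x + d₁ g x := by
  rw [d₁_eq hf, d₁_eq hg]; exact ((hasDerivAt_d₁ hf).add (hasDerivAt_d₁ hg)).deriv

theorem d₂_add (hf : DifferentiableAt ℝ f x) (hg : DifferentiableAt ℝ g x) :
    d₂ (fun y => f y + g y) x = d₂ f x + d₂ g x := by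
  rw [d₂_eq hf, d₂_eq hg]; exact ((hasDerivAt_d₂ hf).add (hasDerivAt_d₂ hg)).deriv

theorem d₁_sub (hf : DifferentiableAt ℝ f x) (hg : DifferentiableAt ℝ g x) :
    d₁ (fun y => f y - g y) x = d₁ f x - d₁ g x := by
  rw [d₁_eq hf, d₁_eq hg]; exact ((hasDerivAt_d₁ hf).sub (hasDerivAt_d₁ hg)).deriv

theorem d₂_sub (hf : DifferentiableAt ℝ f x) (hg : DifferentiableAt ℝ g x) :
    d₂ (fun y => f y - g y) x = d₂ f x - d₂ g x := by
  rw [d₂_eq hf, d₂_eq hg]; exact ((hasDerivAt_d₂ hf).sub (hasDerivAt_d₂ hg)).deriv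

theorem d₁_mul (hf : DifferentiableAt ℝ f x) (hg : DifferentiableAt ℝ g x) :
    d₁ (fun y => f y * g y) x = d₁ f x * g x + f x * d₁ g x := by
  rw [d₁_eq hf, d₁_eq hg]; exact ((hasDerivAt_d₁ hf).mul (hasDerivAt_d₁ hg)).deriv

theorem d₂_mul (hf : DifferentiableAt ℝ f x) (hg : DifferentiableAt ℝ g x) :
    d₂ (fun y => f y * g y) x = d₂ f x * g x + f x * d₂ g x := by
  rw [d₂_eq hf, d₂_eq hg]; exact ((hasDerivAt_d₂ hf).mul (hasDerivAt_d₂ hg)).deriv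

theorem d₁_neg : d₁ (fun y => -f y) x = -d₁ f x := by
  simp [d₁, deriv.fun_neg]

theorem d₂_neg : d₂ (fun y => -f y) x = -d₂ f x := by
  simp [d₂, deriv.fun_neg]

theorem contDiff_d₁ (hf : ContDiff ℝ ∞ f) : ContDiff ℝ ∞ (d₁ f) := by
  rw [d₁_funeq (hf.differentiable (by simp))]
  exact (hf.fderiv_right (m := ∞) (by simp)).clm_apply contDiff_const

theorem contDiff_d₂ (hf : ContDiff ℝ ∞ f) : ContDiff ℝ ∞ (d₂ f) := by
  rw [d₂_funeq (hf.differentiable (by simp))]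
  exact (hf.fderiv_right (m := ∞) (by simp)).clm_apply contDiff_const

theorem smooth_differentiable (hf : ContDiff ℝ ∞ f) : Differentiable ℝ f :=
  hf.differentiable (by simp)

theorem fderiv_fderiv_comm {E : Type*} [NormedAddCommGroup E] [NormedSpace ℝ E] {F : E → ℝ}
    {z : E} (hF : ContDiffAt ℝ 2 F z) (v w : E) :
    fderiv ℝ (fun z => fderiv ℝ F z v) z w = fderiv ℝ (fun z => fderiv ℝ F z w) z v := by
  have hd : DifferentiableAt ℝ (fderiv ℝ F) z :=
    (hF.fderiv_right (m := 1) (by norm_num [one_add_one_eq_two])).differentiableAt (by simp)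
  have hs : IsSymmSndFDerivAt ℝ F z := hF.isSymmSndFDerivAt (by simp)
  rw [fderiv_clm_apply hd (differentiableAt_const v), fderiv_clm_apply hd (differentiableAt_const w)]
  simpa using hs w v

theorem d₁_d₂_comm (hf : ContDiff ℝ 2 f) : d₁ (d₂ f) x = d₂ (d₁ f) x := by
  have hd : Differentiable ℝ f := hf.differentiable (by simp)
  have h1 : Differentiable ℝ (fderiv ℝ f) :=
    (hf.fderiv_right (m := 1) (by norm_num [one_add_one_eq_two])).differentiable (by simp)
  rw [d₁_funeq hd, d₂_funeq hd, d₁_eq, d₂_eq, fderiv_fderiv_comm hf.contDiffAt]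
  · exact (h1 x).clm_apply (differentiableAt_const _)
  · exact (h1 x).clm_apply (differentiableAt_const _)

theorem HasCompactSupport.d₁ (hf : HasCompactSupport f) : HasCompactSupport (d₁ f) := by
  refine hf.mono' fun x hx => ?_
  by_contra h
  refine hx ?_
  have h0 : f =ᶠ[𝓝 x] 0 := notMem_tsupport_iff_eventuallyEq.mp h
  have : (fun s => f (s, x.2)) =ᶠ[𝓝 x.1] fun _ => 0 :=
    (Continuous.tendsto' (by fun_prop : Continuous fun s : ℝ => (s, x.2)) x.1 x rfl).eventually h0
  simp [StripNS.d₁, this.deriv_eq]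

theorem HasCompactSupport.d₂ (hf : HasCompactSupport f) : HasCompactSupport (d₂ f) := by
  refine hf.mono' fun x hx => ?_
  by_contra h
  refine hx ?_
  have h0 : f =ᶠ[𝓝 x] 0 := notMem_tsupport_iff_eventuallyEq.mp h
  have : (fun s => f (x.1, s)) =ᶠ[𝓝 x.2] fun _ => 0 :=
    (Continuous.tendsto' (by fun_prop : Continuous fun s : ℝ => (x.1, s)) x.2 x rfl).eventually h0
  simp [StripNS.d₂, this.deriv_eq]

/-- Integration by parts against the constant function `1`. -/
theorem integral_fderiv_eq_zero (hf : ContDiff ℝ ∞ f) (hc : HasCompactSupport f) (v : ℝ × ℝ) :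
    ∫ x, fderiv ℝ f x v = 0 := by
  have h1 : Continuous fun x => fderiv ℝ f x v :=
    (hf.continuous_fderiv (by simp)).clm_apply continuous_const
  have h := integral_mul_fderiv_eq_neg_fderiv_mul_of_integrable (𝕜 := ℝ) (μ := volume)
    (f := fun _ : ℝ × ℝ => (1 : ℝ)) (g := f) (v := v) (by simp)
    (by simpa using h1.integrable_of_hasCompactSupport (hc.fderiv_apply (𝕜 := ℝ) v))
    (by simpa using hf.continuous.integrable_of_hasCompactSupport hc)
    (by intros; fun_prop) (fun x _ => smooth_differentiable hf x)
  simpa using h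

theorem integral_d₁_eq_zero (hf : ContDiff ℝ ∞ f) (hc : HasCompactSupport f) :
    ∫ x, d₁ f x = 0 := by
  rw [d₁_funeq (smooth_differentiable hf)]; exact integral_fderiv_eq_zero hf hc _

theorem integral_d₂_eq_zero (hf : ContDiff ℝ ∞ f) (hc : HasCompactSupport f) :
    ∫ x, d₂ f x = 0 := by
  rw [d₂_funeq (smooth_differentiable hf)]; exact integral_fderiv_eq_zero hf hc _

end Space

/-! ### Functions smooth in space-time, and differentiation under the integral. -/

namespace SmoothOn

variable {I : Set ℝ} {f g : ℝ → ℝ × ℝ → ℝ} {t : ℝ} {x : ℝ × ℝ}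

theorem mono {J : Set ℝ} (hf : SmoothOn I f) (h : J ⊆ I) : SmoothOn J f :=
  ContDiffOn.mono hf (prod_mono h subset_rfl)

theorem add (hf : SmoothOn I f) (hg : SmoothOn I g) : SmoothOn I (fun t x => f t x + g t x) :=
  ContDiffOn.add hf hg

theorem sub (hf : SmoothOn I f) (hg : SmoothOn I g) : SmoothOn I (fun t x => f t x - g t x) :=
  ContDiffOn.sub hf hg

theorem mul (hf : SmoothOn I f) (hg : SmoothOn I g) : SmoothOn I (fun t x => f t x * g t x) :=
  ContDiffOn.mul hf hg

theorem neg (hf : SmoothOn I f) : SmoothOn I (fun t x => -f t x) :=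
  ContDiffOn.neg hf

theorem of_space {h : ℝ × ℝ → ℝ} (hh : ContDiff ℝ ∞ h) : SmoothOn I (fun _ x => h x) :=
  (hh.comp contDiff_snd).contDiffOn

theorem contDiffAt (hI : IsOpen I) (hf : SmoothOn I f) (ht : t ∈ I) :
    ContDiffAt ℝ ∞ (fun z : ℝ × (ℝ × ℝ) => f z.1 z.2) (t, x) :=
  ContDiffOn.contDiffAt hf ((hI.prod isOpen_univ).mem_nhds ⟨ht, mem_univ _⟩)

theorem slice (hI : IsOpen I) (hf : SmoothOn I f) (ht : t ∈ I) : ContDiff ℝ ∞ (f t) := by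
  rw [contDiff_iff_contDiffAt]
  intro x
  exact (contDiffAt hI hf ht (x := x)).comp x (contDiffAt_const.prodMk contDiffAt_id)

theorem differentiable (hI : IsOpen I) (hf : SmoothOn I f) (ht : t ∈ I) : Differentiable ℝ (f t) :=
  smooth_differentiable (slice hI hf ht)

theorem hasFDerivAt (hI : IsOpen I) (hf : SmoothOn I f) (ht : t ∈ I) :
    HasFDerivAt (fun z : ℝ × (ℝ × ℝ) => f z.1 z.2)
      (fderiv ℝ (fun z : ℝ × (ℝ × ℝ) => f z.1 z.2) (t, x)) (t, x) :=
  ((contDiffAt hI hf ht).differentiableAt (by simp)).hasFDerivAt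

theorem hasDerivAt_dt_aux (hI : IsOpen I) (hf : SmoothOn I f) (ht : t ∈ I) :
    HasDerivAt (fun s => f s x)
      (fderiv ℝ (fun z : ℝ × (ℝ × ℝ) => f z.1 z.2) (t, x) (1, 0)) t := by
  simpa [Function.comp_def] using (hasFDerivAt hI hf ht (x := x)).comp_hasDerivAt t
    ((hasDerivAt_id t).prodMk (hasDerivAt_const t x))

theorem dt_eq (hI : IsOpen I) (hf : SmoothOn I f) (ht : t ∈ I) :
    dt f t x = fderiv ℝ (fun z : ℝ × (ℝ × ℝ) => f z.1 z.2) (t, x) (1, 0) :=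
  (hasDerivAt_dt_aux hI hf ht).deriv

theorem hasDerivAt_dt (hI : IsOpen I) (hf : SmoothOn I f) (ht : t ∈ I) :
    HasDerivAt (fun s => f s x) (dt f t x) t := by
  rw [dt_eq hI hf ht]; exact hasDerivAt_dt_aux hI hf ht

theorem fderiv_slice (hI : IsOpen I) (hf : SmoothOn I f) (ht : t ∈ I) (v : ℝ × ℝ) :
    fderiv ℝ (f t) x v = fderiv ℝ (fun z : ℝ × (ℝ × ℝ) => f z.1 z.2) (t, x) (0, v) := by
  have := (hasFDerivAt hI hf ht (x := x)).comp x ((hasFDerivAt_const t x).prodMk (hasFDerivAt_id x))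
  have h2 : HasFDerivAt (f t) _ x := this
  rw [h2.fderiv]; simp

theorem d₁_eq_fderiv (hI : IsOpen I) (hf : SmoothOn I f) (ht : t ∈ I) :
    d₁ (f t) x = fderiv ℝ (fun z : ℝ × (ℝ × ℝ) => f z.1 z.2) (t, x) (0, (1, 0)) := by
  rw [d₁_eq (differentiable hI hf ht x), fderiv_slice hI hf ht]

theorem d₂_eq_fderiv (hI : IsOpen I) (hf : SmoothOn I f) (ht : t ∈ I) :
    d₂ (f t) x = fderiv ℝ (fun z : ℝ × (ℝ × ℝ) => f z.1 z.2) (t, x) (0, (0, 1)) := by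
  rw [d₂_eq (differentiable hI hf ht x), fderiv_slice hI hf ht]

theorem contDiffOn_fderiv (hI : IsOpen I) (hf : SmoothOn I f) (v : ℝ × (ℝ × ℝ)) :
    ContDiffOn ℝ ∞ (fun z => fderiv ℝ (fun z : ℝ × (ℝ × ℝ) => f z.1 z.2) z v) (I ×ˢ univ) :=
  (ContDiffOn.fderiv_of_isOpen hf (hI.prod isOpen_univ) (by simp)).clm_apply contDiffOn_const

theorem dt (hI : IsOpen I) (hf : SmoothOn I f) : SmoothOn I (dt f) :=
  (contDiffOn_fderiv hI hf (1, 0)).congr fun _ hz => dt_eq hI hf hz.1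

theorem d₁ (hI : IsOpen I) (hf : SmoothOn I f) : SmoothOn I (fun t => d₁ (f t)) :=
  (contDiffOn_fderiv hI hf (0, (1, 0))).congr fun _ hz => d₁_eq_fderiv hI hf hz.1

theorem d₂ (hI : IsOpen I) (hf : SmoothOn I f) : SmoothOn I (fun t => d₂ (f t)) :=
  (contDiffOn_fderiv hI hf (0, (0, 1))).congr fun _ hz => d₂_eq_fderiv hI hf hz.1

theorem congr (hf : SmoothOn I f) (h : ∀ t ∈ I, ∀ x, g t x = f t x) : SmoothOn I g :=
  ContDiffOn.congr hf fun z hz => h z.1 hz.1 z.2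

/-- Both sides are mixed second derivatives of one space-time function, so symmetry of the second
derivative applies. The identification with `fderiv` holds only on the open set `I ×ˢ univ`, hence
the eventual equalities. -/
theorem dt_d₁_comm (hI : IsOpen I) (hf : SmoothOn I f) (ht : t ∈ I) :
    StripNS.dt (fun t => StripNS.d₁ (f t)) t x = StripNS.d₁ (StripNS.dt f t) x := by
  have hc : ContDiffAt ℝ 2 (fun z : ℝ × (ℝ × ℝ) => f z.1 z.2) (t, x) :=
    (contDiffAt hI hf ht).of_le (WithTop.coe_le_coe.2 le_top)
  have hn : I ×ˢ univ ∈ 𝓝 (t, x) := (hI.prod isOpen_univ).mem_nhds ⟨ht, mem_univ _⟩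
  rw [dt_eq hI (d₁ hI hf) ht, d₁_eq_fderiv hI (dt hI hf) ht]
  have e1 : (fun z : ℝ × (ℝ × ℝ) => StripNS.d₁ (f z.1) z.2) =ᶠ[𝓝 (t, x)]
      fun z => fderiv ℝ (fun z : ℝ × (ℝ × ℝ) => f z.1 z.2) z (0, (1, 0)) := by
    filter_upwards [hn] with z hz using d₁_eq_fderiv hI hf hz.1
  have e2 : (fun z : ℝ × (ℝ × ℝ) => StripNS.dt f z.1 z.2) =ᶠ[𝓝 (t, x)]
      fun z => fderiv ℝ (fun z : ℝ × (ℝ × ℝ) => f z.1 z.2) z (1, 0) := by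
    filter_upwards [hn] with z hz using dt_eq hI hf hz.1
  rw [e1.fderiv_eq, e2.fderiv_eq, fderiv_fderiv_comm hc]

theorem dt_d₂_comm (hI : IsOpen I) (hf : SmoothOn I f) (ht : t ∈ I) :
    StripNS.dt (fun t => StripNS.d₂ (f t)) t x = StripNS.d₂ (StripNS.dt f t) x := by
  have hc : ContDiffAt ℝ 2 (fun z : ℝ × (ℝ × ℝ) => f z.1 z.2) (t, x) :=
    (contDiffAt hI hf ht).of_le (WithTop.coe_le_coe.2 le_top)
  have hn : I ×ˢ univ ∈ 𝓝 (t, x) := (hI.prod isOpen_univ).mem_nhds ⟨ht, mem_univ _⟩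
  rw [dt_eq hI (d₂ hI hf) ht, d₂_eq_fderiv hI (dt hI hf) ht]
  have e1 : (fun z : ℝ × (ℝ × ℝ) => StripNS.d₂ (f z.1) z.2) =ᶠ[𝓝 (t, x)]
      fun z => fderiv ℝ (fun z : ℝ × (ℝ × ℝ) => f z.1 z.2) z (0, (0, 1)) := by
    filter_upwards [hn] with z hz using d₂_eq_fderiv hI hf hz.1
  have e2 : (fun z : ℝ × (ℝ × ℝ) => StripNS.dt f z.1 z.2) =ᶠ[𝓝 (t, x)]
      fun z => fderiv ℝ (fun z : ℝ × (ℝ × ℝ) => f z.1 z.2) z (1, 0) := by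
    filter_upwards [hn] with z hz using dt_eq hI hf hz.1
  rw [e1.fderiv_eq, e2.fderiv_eq, fderiv_fderiv_comm hc]

theorem dt_mul (hI : IsOpen I) (hf : SmoothOn I f) (hg : SmoothOn I g) (ht : t ∈ I) :
    StripNS.dt (fun t x => f t x * g t x) t x =
      StripNS.dt f t x * g t x + f t x * StripNS.dt g t x :=
  ((hasDerivAt_dt hI hf ht).mul (hasDerivAt_dt hI hg ht)).deriv

theorem continuousOn (hf : SmoothOn I f) :
    ContinuousOn (fun z : ℝ × (ℝ × ℝ) => f z.1 z.2) (I ×ˢ univ) := ContDiffOn.continuousOn hf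

end SmoothOn

/-- The domination is by a constant: `F'` is bounded on the product of `K` with a compact time
interval around `t`. -/
theorem hasDerivAt_setIntegral_of_isCompact {X : Type*} [TopologicalSpace X] [T2Space X]
    [SecondCountableTopology X] [MeasurableSpace X] [BorelSpace X]
    {μ : Measure X} [IsFiniteMeasureOnCompacts μ] {K : Set X} (hK : IsCompact K)
    {I : Set ℝ} (hI : IsOpen I) {F F' : ℝ → X → ℝ}
    (hF : ContinuousOn (fun z : ℝ × X => F z.1 z.2) (I ×ˢ K))
    (hF' : ContinuousOn (fun z : ℝ × X => F' z.1 z.2) (I ×ˢ K))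
    (hd : ∀ t ∈ I, ∀ x ∈ K, HasDerivAt (fun s => F s x) (F' t x) t) {t : ℝ} (ht : t ∈ I) :
    HasDerivAt (fun t => ∫ x in K, F t x ∂μ) (∫ x in K, F' t x ∂μ) t := by
  obtain ⟨r, hr, hrI⟩ := Metric.isOpen_iff.mp hI t ht
  have hsub : Metric.closedBall t (r / 2) ⊆ I :=
    (Metric.closedBall_subset_ball (by linarith)).trans hrI
  have hcomp : IsCompact (Metric.closedBall t (r / 2) ×ˢ K) :=
    (isCompact_closedBall t (r / 2)).prod hK
  obtain ⟨C, hC⟩ := hcomp.exists_bound_of_continuousOn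
    (hF'.mono (prod_mono hsub subset_rfl))
  have hslice : ∀ {H : ℝ → X → ℝ}, ContinuousOn (fun z : ℝ × X => H z.1 z.2) (I ×ˢ K) →
      ∀ s ∈ I, ContinuousOn (H s) K := fun h s hs =>
    h.comp (f := fun x => (s, x)) (by fun_prop) fun x hx => ⟨hs, hx⟩
  have hm : MeasurableSet K := hK.isClosed.measurableSet
  have : IsFiniteMeasure (μ.restrict K) := ⟨by simpa using hK.measure_lt_top⟩
  refine (hasDerivAt_integral_of_dominated_loc_of_deriv_le (bound := fun _ => C)
    (s := Metric.ball t (r / 2)) (Metric.ball_mem_nhds t (by linarith)) ?_ ?_ ?_ ?_ ?_ ?_).2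
  · filter_upwards [hI.mem_nhds ht] with s hs
    exact (hslice hF s hs).aestronglyMeasurable_of_isCompact hK hm
  · exact (hslice hF t ht).integrableOn_compact hK
  · exact (hslice hF' t ht).aestronglyMeasurable_of_isCompact hK hm
  · filter_upwards [ae_restrict_mem hm] with x hx s hs
    exact hC (s, x) ⟨Metric.ball_subset_closedBall hs, hx⟩
  · exact integrable_const C
  · filter_upwards [ae_restrict_mem hm] with x hx s hs
    exact hd s (hsub (Metric.ball_subset_closedBall hs)) x hx

theorem SmoothOn.hasDerivAt_setIntegral {I : Set ℝ} (hI : IsOpen I) {f : ℝ → ℝ × ℝ → ℝ}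
    (hf : SmoothOn I f) {K : Set (ℝ × ℝ)} (hK : IsCompact K) {t : ℝ} (ht : t ∈ I) :
    HasDerivAt (fun t => ∫ x in K, f t x) (∫ x in K, StripNS.dt f t x) t :=
  hasDerivAt_setIntegral_of_isCompact hK hI
    (hf.continuousOn.mono (prod_mono subset_rfl (subset_univ _)))
    ((SmoothOn.dt hI hf).continuousOn.mono (prod_mono subset_rfl (subset_univ _)))
    (fun _ hs _ _ => SmoothOn.hasDerivAt_dt hI hf hs) ht

/-! ### The heat kernel in one dimension. -/

/-- The one-dimensional heat kernel. -/
def heat (σ z : ℝ) : ℝ := (√(4 * Real.pi * σ))⁻¹ * Real.exp (-z ^ 2 / (4 * σ))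

section Heat

variable {σ z : ℝ}

theorem heat_pos (hσ : 0 < σ) : 0 < heat σ z := by
  unfold heat; have := Real.pi_pos; positivity

theorem heat_eq (z : ℝ) : heat σ z = (√(4 * Real.pi * σ))⁻¹ * Real.exp (-(1 / (4 * σ)) * z ^ 2) := by
  unfold heat; congr 2; ring

theorem integrable_heat (hσ : 0 < σ) : Integrable (heat σ) := by
  have : heat σ = fun z => (√(4 * Real.pi * σ))⁻¹ * Real.exp (-(1 / (4 * σ)) * z ^ 2) :=
    funext heat_eq
  rw [this]
  exact (integrable_exp_neg_mul_sq (by positivity)).const_mul _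

theorem integral_heat (hσ : 0 < σ) : ∫ z, heat σ z = 1 := by
  simp_rw [heat_eq]
  rw [integral_const_mul, integral_gaussian]
  have : Real.pi / (1 / (4 * σ)) = 4 * Real.pi * σ := by field_simp
  rw [this]
  have := Real.pi_pos
  exact inv_mul_cancel₀ (by positivity)

theorem hasDerivAt_heat (σ z : ℝ) : HasDerivAt (heat σ) (-(z / (2 * σ)) * heat σ z) z := by
  unfold heat
  have h : HasDerivAt (fun z : ℝ => -z ^ 2 / (4 * σ)) (-(2 * z) / (4 * σ)) z := by
    simpa using ((hasDerivAt_pow 2 z).neg).div_const (4 * σ)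
  refine (h.exp.const_mul _).congr_deriv ?_
  by_cases h0 : σ = 0
  · simp [h0]
  · field_simp; ring

theorem hasDerivAt_heat_deriv (hσ : 0 < σ) (z : ℝ) :
    HasDerivAt (fun z => -(z / (2 * σ)) * heat σ z)
      ((z ^ 2 / (4 * σ ^ 2) - 1 / (2 * σ)) * heat σ z) z := by
  refine ((((hasDerivAt_id z).div_const (2 * σ)).neg).mul (hasDerivAt_heat σ z)).congr_deriv ?_
  simp only [id, Pi.neg_apply]
  field_simp; ring

theorem hasDerivAt_heat_time (hσ : 0 < σ) (z : ℝ) :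
    HasDerivAt (fun σ => heat σ z) ((z ^ 2 / (4 * σ ^ 2) - 1 / (2 * σ)) * heat σ z) σ := by
  unfold heat
  have hp := Real.pi_pos
  have h1 : HasDerivAt (fun σ : ℝ => 4 * Real.pi * σ) (4 * Real.pi) σ := by
    simpa using (hasDerivAt_id σ).const_mul (4 * Real.pi)
  have hs : 0 < √(4 * Real.pi * σ) := by positivity
  have h2 := (h1.sqrt (by positivity)).inv hs.ne'
  have h3 : HasDerivAt (fun σ : ℝ => -z ^ 2 / (4 * σ)) (z ^ 2 / (4 * σ ^ 2)) σ := by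
    have := (hasDerivAt_const σ (-z ^ 2)).fun_div ((hasDerivAt_id σ).const_mul 4) (by positivity)
    refine this.congr_deriv ?_
    simp only [id]; field_simp; ring
  refine (h2.fun_mul h3.exp).congr_deriv ?_
  have hsq : √(4 * Real.pi * σ) ^ 2 = 4 * Real.pi * σ := Real.sq_sqrt (by positivity)
  have : -(4 * Real.pi / (2 * √(4 * Real.pi * σ))) / √(4 * Real.pi * σ) ^ 2 =
      -(1 / (2 * σ)) * (√(4 * Real.pi * σ))⁻¹ := by
    rw [hsq]; field_simp
  simp only [Pi.inv_apply] at *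
  rw [this]; ring

/-- Part of the Gaussian absorbs the factor `z`, at the price of doubling the time. What remains is
the singularity `σ^(-1/2)`, integrable in time, on which every use of Duhamel's formula relies. -/
theorem abs_heat_deriv_le (hσ : 0 < σ) (z : ℝ) :
    |z / (2 * σ) * heat σ z| ≤ (√σ)⁻¹ * heat (2 * σ) z := by
  have hp := Real.pi_pos
  have hs : 0 < √σ := by positivity
  have hsq : √σ ^ 2 = σ := Real.sq_sqrt hσ.le
  have e1 : √(4 * Real.pi * (2 * σ)) = √2 * √(4 * Real.pi * σ) := by
    rw [← Real.sqrt_mul (by norm_num)]; congr 1; ring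
  have hS : 0 < √(4 * Real.pi * σ) := by positivity
  have h2 : 0 < √(2 : ℝ) := by positivity
  have h22 : √(2 : ℝ) ^ 2 = 2 := Real.sq_sqrt (by norm_num)
  rw [abs_mul, abs_of_pos (heat_pos hσ)]
  have key : |z / (2 * σ)| * √2 * √σ ≤ Real.exp (z ^ 2 / (8 * σ)) := by
    have h3 := Real.add_one_le_exp (z ^ 2 / (8 * σ))
    refine le_trans ?_ h3
    -- In the scaled variable the claim is `w√2/2 ≤ 1 + w²/8`, that is `(w - 2√2)² ≥ 0`.
    set w := |z| / √σ with hw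
    have hz : |z| = w * √σ := by rw [hw]; field_simp
    have hz2 : z ^ 2 = w ^ 2 * σ := by rw [← sq_abs, hz, mul_pow, hsq]
    rw [abs_div, abs_of_pos (by positivity : 0 < 2 * σ), hz, hz2]
    have : w * √σ / (2 * σ) * √2 * √σ = w * √2 / 2 := by
      have : w * √σ / (2 * σ) * √2 * √σ = w * √2 * √σ ^ 2 / (2 * σ) := by ring
      rw [this, hsq]; field_simp
    rw [this]
    have : w ^ 2 * σ / (8 * σ) = w ^ 2 / 8 := by field_simp
    rw [this]
    nlinarith [sq_nonneg (w - 2 * √2)]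
  unfold heat
  rw [e1]
  have e2 : Real.exp (-z ^ 2 / (4 * (2 * σ))) =
      Real.exp (z ^ 2 / (8 * σ)) * Real.exp (-z ^ 2 / (4 * σ)) := by
    rw [← Real.exp_add]; congr 1; field_simp; ring
  rw [e2]
  have hE := Real.exp_pos (-z ^ 2 / (4 * σ))
  calc |z / (2 * σ)| * ((√(4 * Real.pi * σ))⁻¹ * Real.exp (-z ^ 2 / (4 * σ)))
      = (|z / (2 * σ)| * √2 * √σ) * ((√2)⁻¹ * (√σ)⁻¹ * (√(4 * Real.pi * σ))⁻¹ *
          Real.exp (-z ^ 2 / (4 * σ))) := by field_simp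
    _ ≤ Real.exp (z ^ 2 / (8 * σ)) * ((√2)⁻¹ * (√σ)⁻¹ * (√(4 * Real.pi * σ))⁻¹ *
          Real.exp (-z ^ 2 / (4 * σ))) := by gcongr
    _ = _ := by rw [mul_inv]; ring

theorem contDiffOn_heat : ContDiffOn ℝ ∞ (fun p : ℝ × ℝ => heat p.1 p.2) (Ioi 0 ×ˢ univ) := by
  intro p hp
  have h : 0 < p.1 := hp.1
  have hpi := Real.pi_pos
  apply ContDiffAt.contDiffWithinAt
  unfold heat
  have h1 : 4 * Real.pi * p.1 ≠ 0 := by positivity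
  have h2 : 4 * p.1 ≠ 0 := by positivity
  have h3 : √(4 * Real.pi * p.1) ≠ 0 := by positivity
  have h4 : ContDiffAt ℝ ∞ (fun p : ℝ × ℝ => -p.2 ^ 2 / (4 * p.1)) p :=
    ContDiffAt.div (by fun_prop) (by fun_prop) h2
  have h5 : ContDiffAt ℝ ∞ (fun p : ℝ × ℝ => 4 * Real.pi * p.1) p := by fun_prop
  exact ((h5.sqrt h1).inv h3).mul h4.exp

theorem continuous_heat (σ : ℝ) : Continuous (heat σ) := by unfold heat; fun_prop

end Heat

/-! ### The backward heat kernel in the plane. -/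

/-- The two-dimensional heat kernel. -/
def heat₂ (σ : ℝ) (z : ℝ × ℝ) : ℝ := heat σ z.1 * heat σ z.2

/-- A majorant of the gradient of the heat kernel, of total mass `2`. -/
def heatGrad (σ : ℝ) (z : ℝ × ℝ) : ℝ :=
  heat (2 * σ) z.1 * heat σ z.2 + heat σ z.1 * heat (2 * σ) z.2

/-- The backward heat kernel with pole at `(t, x)`. -/
def kernel (t : ℝ) (x : ℝ × ℝ) (τ : ℝ) (y : ℝ × ℝ) : ℝ := heat₂ (t - τ) (x - y)

section Kernel

variable {σ t τ : ℝ} {x y : ℝ × ℝ}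

theorem heat₂_pos (hσ : 0 < σ) (z : ℝ × ℝ) : 0 < heat₂ σ z := mul_pos (heat_pos hσ) (heat_pos hσ)

theorem heatGrad_pos (hσ : 0 < σ) (z : ℝ × ℝ) : 0 < heatGrad σ z :=
  add_pos (mul_pos (heat_pos (by linarith)) (heat_pos hσ))
    (mul_pos (heat_pos hσ) (heat_pos (by linarith)))

theorem integrable_heat_mul {σ' : ℝ} (hσ : 0 < σ) (hσ' : 0 < σ') :
    Integrable (fun z : ℝ × ℝ => heat σ z.1 * heat σ' z.2) :=
  (integrable_heat hσ).mul_prod (integrable_heat hσ')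

theorem integral_heat_mul {σ' : ℝ} (hσ : 0 < σ) (hσ' : 0 < σ') :
    ∫ z : ℝ × ℝ, heat σ z.1 * heat σ' z.2 = 1 := by
  have := integral_prod_mul (μ := (volume : Measure ℝ)) (ν := (volume : Measure ℝ)) (heat σ) (heat σ')
  rw [integral_heat hσ, integral_heat hσ', one_mul] at this
  exact this

theorem integrable_heat₂ (hσ : 0 < σ) : Integrable (heat₂ σ) := integrable_heat_mul hσ hσ

theorem integral_heat₂ (hσ : 0 < σ) : ∫ z, heat₂ σ z = 1 := integral_heat_mul hσ hσ

theorem integrable_heatGrad (hσ : 0 < σ) : Integrable (heatGrad σ) :=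
  (integrable_heat_mul (by linarith) hσ).add (integrable_heat_mul hσ (by linarith))

theorem integral_heatGrad (hσ : 0 < σ) : ∫ z, heatGrad σ z = 2 := by
  unfold heatGrad
  rw [integral_add (integrable_heat_mul (by linarith) hσ) (integrable_heat_mul hσ (by linarith)),
    integral_heat_mul (by linarith) hσ, integral_heat_mul hσ (by linarith)]
  norm_num

theorem integrable_kernel (h : τ < t) (x : ℝ × ℝ) : Integrable (kernel t x τ) :=
  (integrable_heat₂ (sub_pos.2 h)).comp_sub_left x

theorem integral_kernel (h : τ < t) (x : ℝ × ℝ) : ∫ y, kernel t x τ y = 1 := by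
  unfold kernel
  rw [integral_sub_left_eq_self (heat₂ (t - τ)) volume x, integral_heat₂ (sub_pos.2 h)]

theorem kernel_pos (h : τ < t) (x y : ℝ × ℝ) : 0 < kernel t x τ y := heat₂_pos (sub_pos.2 h) _

theorem smoothOn_kernel (t : ℝ) (x : ℝ × ℝ) : SmoothOn (Iio t) (kernel t x) := by
  have h1 : ContDiffOn ℝ ∞ (fun z : ℝ × (ℝ × ℝ) => heat (t - z.1) (x.1 - z.2.1))
      (Iio t ×ˢ univ) :=
    contDiffOn_heat.comp (f := fun z : ℝ × (ℝ × ℝ) => (t - z.1, x.1 - z.2.1)) (by fun_prop)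
      fun _ hz => ⟨mem_Ioi.2 (sub_pos.2 (mem_Iio.1 hz.1)), mem_univ _⟩
  have h2 : ContDiffOn ℝ ∞ (fun z : ℝ × (ℝ × ℝ) => heat (t - z.1) (x.2 - z.2.2))
      (Iio t ×ˢ univ) :=
    contDiffOn_heat.comp (f := fun z : ℝ × (ℝ × ℝ) => (t - z.1, x.2 - z.2.2)) (by fun_prop)
      fun _ hz => ⟨mem_Ioi.2 (sub_pos.2 (mem_Iio.1 hz.1)), mem_univ _⟩
  exact h1.mul h2

theorem d₁_kernel (t : ℝ) (x : ℝ × ℝ) (τ : ℝ) (y : ℝ × ℝ) : d₁ (kernel t x τ) y =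
    (x.1 - y.1) / (2 * (t - τ)) * heat (t - τ) (x.1 - y.1) * heat (t - τ) (x.2 - y.2) := by
  have h := (hasDerivAt_heat (t - τ) (x.1 - y.1)).comp y.1 ((hasDerivAt_id y.1).const_sub x.1)
  refine ((h.mul_const (heat (t - τ) (x.2 - y.2))).congr_deriv ?_).deriv
  ring

theorem d₂_kernel (t : ℝ) (x : ℝ × ℝ) (τ : ℝ) (y : ℝ × ℝ) : d₂ (kernel t x τ) y =
    heat (t - τ) (x.1 - y.1) * ((x.2 - y.2) / (2 * (t - τ)) * heat (t - τ) (x.2 - y.2)) := by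
  have h := (hasDerivAt_heat (t - τ) (x.2 - y.2)).comp y.2 ((hasDerivAt_id y.2).const_sub x.2)
  refine ((h.const_mul (heat (t - τ) (x.1 - y.1))).congr_deriv ?_).deriv
  ring

/-- The sign is that of the backward equation: paired with a forward solution, the two Laplacians
cancel after integration by parts. -/
theorem dt_kernel (h : τ < t) : dt (kernel t x) τ y = -lap (kernel t x τ) y := by
  have hσ : 0 < t - τ := sub_pos.2 h
  have e1 : d₁ (d₁ (kernel t x τ)) y =
      ((x.1 - y.1) ^ 2 / (4 * (t - τ) ^ 2) - 1 / (2 * (t - τ))) * heat (t - τ) (x.1 - y.1) *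
        heat (t - τ) (x.2 - y.2) := by
    have h := (hasDerivAt_heat_deriv hσ (x.1 - y.1)).comp y.1 ((hasDerivAt_id y.1).const_sub x.1)
    have h' := ((h.mul_const (heat (t - τ) (x.2 - y.2))).neg)
    have : d₁ (kernel t x τ) = fun y => (x.1 - y.1) / (2 * (t - τ)) * heat (t - τ) (x.1 - y.1) *
      heat (t - τ) (x.2 - y.2) := funext (d₁_kernel t x τ)
    rw [this]
    refine HasDerivAt.deriv (h'.congr_deriv ?_ |>.congr_of_eventuallyEq ?_)
    · ring
    · exact Eventually.of_forall fun s => by simp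
  have e2 : d₂ (d₂ (kernel t x τ)) y =
      ((x.2 - y.2) ^ 2 / (4 * (t - τ) ^ 2) - 1 / (2 * (t - τ))) * heat (t - τ) (x.2 - y.2) *
        heat (t - τ) (x.1 - y.1) := by
    have h := (hasDerivAt_heat_deriv hσ (x.2 - y.2)).comp y.2 ((hasDerivAt_id y.2).const_sub x.2)
    have h' := ((h.mul_const (heat (t - τ) (x.1 - y.1))).neg)
    have : d₂ (kernel t x τ) = fun y => heat (t - τ) (x.1 - y.1) *
      ((x.2 - y.2) / (2 * (t - τ)) * heat (t - τ) (x.2 - y.2)) := funext (d₂_kernel t x τ)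
    rw [this]
    refine HasDerivAt.deriv (h'.congr_deriv ?_ |>.congr_of_eventuallyEq ?_)
    · ring
    · exact Eventually.of_forall fun s => by simp; ring
  have e3 : HasDerivAt (fun s => kernel t x s y) _ τ :=
    ((hasDerivAt_heat_time hσ (x.1 - y.1)).comp τ ((hasDerivAt_id τ).const_sub t)).mul
      ((hasDerivAt_heat_time hσ (x.2 - y.2)).comp τ ((hasDerivAt_id τ).const_sub t))
  unfold dt lap
  rw [e1, e2, e3.deriv]
  simp only [Function.comp_apply, Prod.snd_sub]
  ring

theorem abs_d_kernel_le (h : τ < t) (x y : ℝ × ℝ) :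
    |d₁ (kernel t x τ) y| + |d₂ (kernel t x τ) y| ≤ (√(t - τ))⁻¹ * heatGrad (t - τ) (x - y) := by
  have hσ : 0 < t - τ := sub_pos.2 h
  have h1 := abs_heat_deriv_le hσ (x.1 - y.1)
  have h2 := abs_heat_deriv_le hσ (x.2 - y.2)
  have p1 := heat_pos (z := x.1 - y.1) hσ
  have p2 := heat_pos (z := x.2 - y.2) hσ
  rw [d₁_kernel, d₂_kernel, abs_mul _ (heat _ (x.2 - y.2)), abs_mul (heat _ (x.1 - y.1)),
    abs_of_pos p1, abs_of_pos p2]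
  simp only [heatGrad, Prod.fst_sub, Prod.snd_sub]
  calc _ ≤ (√(t - τ))⁻¹ * heat (2 * (t - τ)) (x.1 - y.1) * heat (t - τ) (x.2 - y.2) +
        heat (t - τ) (x.1 - y.1) * ((√(t - τ))⁻¹ * heat (2 * (t - τ)) (x.2 - y.2)) := by gcongr
    _ = _ := by ring

/-- The substitution `y = x - √(t-τ) z` turns the kernel into the fixed density `heat₂ 1`. Dominated
convergence then applies, with the uniform bound coming from continuity and the compact support of
`h`. -/
theorem tendsto_integral_kernel {I : Set ℝ} (hI : IsOpen I) {h : ℝ → ℝ × ℝ → ℝ}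
    (hh : ContinuousOn (fun z : ℝ × (ℝ × ℝ) => h z.1 z.2) (I ×ˢ univ)) {K : Set (ℝ × ℝ)}
    (hK : IsCompact K) (hsupp : ∀ s, ∀ y ∉ K, h s y = 0) (ht : t ∈ I) (x : ℝ × ℝ) :
    Tendsto (fun τ => ∫ y, kernel t x τ y * h τ y) (𝓝[<] t) (𝓝 (h t x)) := by
  have hscale : ∀ τ < t, ∫ y, kernel t x τ y * h τ y =
      ∫ z, heat₂ 1 z * h τ (x - √(t - τ) • z) := by
    intro τ hτ
    have hσ : 0 < t - τ := sub_pos.2 hτ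
    have hs : 0 < √(t - τ) := Real.sqrt_pos.2 hσ
    have hsq : √(t - τ) ^ 2 = t - τ := Real.sq_sqrt hσ.le
    have e1 : ∫ y, kernel t x τ y * h τ y = ∫ z, heat₂ (t - τ) z * h τ (x - z) := by
      rw [← integral_sub_left_eq_self (fun z => heat₂ (t - τ) z * h τ (x - z)) volume x]
      simp [kernel]
    have e2 := Measure.integral_comp_smul (volume : Measure (ℝ × ℝ))
      (fun z => heat₂ (t - τ) z * h τ (x - z)) (√(t - τ))
    have e3 : ∀ z : ℝ × ℝ, heat₂ (t - τ) (√(t - τ) • z) = (t - τ)⁻¹ * heat₂ 1 z := by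
      intro z
      simp only [heat₂, heat, Prod.smul_fst, Prod.smul_snd, smul_eq_mul, mul_pow, hsq]
      have a1 : ∀ w : ℝ, -((t - τ) * w ^ 2) / (4 * (t - τ)) = -w ^ 2 / (4 * 1) := by
        intro w; field_simp
      have a2 : √(4 * Real.pi * (t - τ)) = √(4 * Real.pi * 1) * √(t - τ) := by
        rw [← Real.sqrt_mul (by have := Real.pi_pos; positivity), mul_one]
      rw [a1, a1, a2, mul_inv]
      have : (t - τ)⁻¹ = (√(t - τ))⁻¹ * (√(t - τ))⁻¹ := by
        rw [← mul_inv, ← sq, hsq]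
      rw [this]; ring
    rw [e1]
    simp only [e3, Module.finrank_prod, Module.finrank_self, one_add_one_eq_two, hsq,
      abs_of_pos (inv_pos.2 hσ), smul_eq_mul, mul_assoc, integral_const_mul] at e2
    exact (mul_left_cancel₀ (inv_pos.2 hσ).ne' e2).symm
  obtain ⟨r, hr, hrI⟩ := Metric.isOpen_iff.mp hI t ht
  have hsub : Metric.closedBall t (r / 2) ⊆ I :=
    (Metric.closedBall_subset_ball (by linarith)).trans hrI
  obtain ⟨C, hC⟩ := ((isCompact_closedBall t (r / 2)).prod hK).exists_bound_of_continuousOn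
    (hh.mono (prod_mono hsub (subset_univ _)))
  have hev : ∀ᶠ τ in 𝓝[<] t, τ ∈ Metric.closedBall t (r / 2) :=
    nhdsWithin_le_nhds (Metric.closedBall_mem_nhds t (by linarith))
  have hlim : Tendsto (fun τ => ∫ z, heat₂ 1 z * h τ (x - √(t - τ) • z)) (𝓝[<] t)
      (𝓝 (∫ z, heat₂ 1 z * h t x)) := by
    refine tendsto_integral_filter_of_dominated_convergence (fun z => heat₂ 1 z * |C|) ?_ ?_ ?_ ?_
    · filter_upwards [hev] with τ hτ
      have hc : Continuous (h τ) := by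
        rw [← continuousOn_univ]
        exact hh.comp (f := fun y => (τ, y)) (by fun_prop) fun y _ => ⟨hsub hτ, mem_univ _⟩
      have hc2 : Continuous (heat₂ 1) :=
        ((continuous_heat 1).comp continuous_fst).mul ((continuous_heat 1).comp continuous_snd)
      exact (hc2.mul (hc.comp (by fun_prop))).aestronglyMeasurable
    · filter_upwards [hev] with τ hτ
      refine Eventually.of_forall fun z => ?_
      rw [norm_mul, Real.norm_of_nonneg (heat₂_pos one_pos z).le]
      refine mul_le_mul_of_nonneg_left ?_ (heat₂_pos one_pos z).le
      by_cases hy : x - √(t - τ) • z ∈ K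
      · exact (hC (τ, _) ⟨hτ, hy⟩).trans (le_abs_self C)
      · rw [hsupp τ _ hy, norm_zero]; exact abs_nonneg C
    · exact (integrable_heat₂ one_pos).mul_const _
    · refine Eventually.of_forall fun z => Tendsto.const_mul _ ?_
      have hc : ContinuousAt (fun z : ℝ × (ℝ × ℝ) => h z.1 z.2) (t, x) :=
        hh.continuousAt ((hI.prod isOpen_univ).mem_nhds ⟨ht, mem_univ _⟩)
      have hin : Tendsto (fun τ => (τ, x - √(t - τ) • z)) (𝓝[<] t) (𝓝 (t, x)) := by
        refine Tendsto.mono_left ?_ nhdsWithin_le_nhds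
        refine Continuous.tendsto' (by fun_prop) _ _ (by simp)
      exact Tendsto.comp (f := fun τ => (τ, x - √(t - τ) • z)) hc hin
  rw [integral_mul_const, integral_heat₂ one_pos, one_mul] at hlim
  refine hlim.congr' ?_
  filter_upwards [self_mem_nhdsWithin] with τ hτ using (hscale τ hτ).symm

end Kernel

/-! ### Cut-off functions and their scaling. -/

/-- A smooth even bump function on the line, equal to `1` on `[-1, 1]` and supported in
`[-2, 2]`. -/
def bump : ContDiffBump (0 : ℝ) := ⟨1, 2, one_pos, one_lt_two⟩

theorem bump_contDiff : ContDiff ℝ ∞ bump := bump.contDiff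

theorem bump_nonneg (x : ℝ) : 0 ≤ bump x := bump.nonneg

theorem bump_le_one (x : ℝ) : bump x ≤ 1 := bump.le_one

theorem bump_eq_one {x : ℝ} (h : |x| ≤ 1) : bump x = 1 :=
  bump.one_of_mem_closedBall (by simpa [bump] using h)

theorem bump_eq_zero {x : ℝ} (h : 2 ≤ |x|) : bump x = 0 :=
  bump.zero_of_le_dist (by simpa [bump] using h)

theorem exists_bump_bound : ∃ c : ℝ, 1 ≤ c ∧ (∀ x, |deriv bump x| ≤ c) ∧
    ∀ x, |deriv (deriv bump) x| ≤ c := by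
  have h1 : ContDiff ℝ ∞ (deriv bump) := (contDiff_infty_iff_deriv.1 bump_contDiff).2
  have h2 : ContDiff ℝ ∞ (deriv (deriv bump)) := (contDiff_infty_iff_deriv.1 h1).2
  obtain ⟨a, ha⟩ := (bump.hasCompactSupport.deriv).exists_bound_of_continuous h1.continuous
  obtain ⟨b, hb⟩ := (bump.hasCompactSupport.deriv.deriv).exists_bound_of_continuous h2.continuous
  refine ⟨max 1 (max a b), le_max_left _ _, fun x => ?_, fun x => ?_⟩
  · exact (ha x).trans ((le_max_left _ _).trans (le_max_right _ _))
  · exact (hb x).trans ((le_max_right _ _).trans (le_max_right _ _))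

/-- A bound for the first two derivatives of `bump`. -/
def bumpC : ℝ := exists_bump_bound.choose

theorem one_le_bumpC : 1 ≤ bumpC := exists_bump_bound.choose_spec.1

theorem abs_deriv_bump_le (x : ℝ) : |deriv bump x| ≤ bumpC := exists_bump_bound.choose_spec.2.1 x

theorem abs_deriv_deriv_bump_le (x : ℝ) : |deriv (deriv bump) x| ≤ bumpC :=
  exists_bump_bound.choose_spec.2.2 x

/-- The bump function centered at `a`, at scale `ρ`. -/
def bumpAt (ρ a s : ℝ) : ℝ := bump ((s - a) / ρ)

section BumpAt

variable {ρ : ℝ} {a s : ℝ}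

theorem contDiff_bumpAt (ρ a : ℝ) : ContDiff ℝ ∞ (bumpAt ρ a) := by
  unfold bumpAt
  exact bump_contDiff.comp (by fun_prop : ContDiff ℝ ∞ fun s : ℝ => (s - a) / ρ)

theorem bumpAt_nonneg : 0 ≤ bumpAt ρ a s := bump_nonneg _

theorem bumpAt_le_one : bumpAt ρ a s ≤ 1 := bump_le_one _

theorem bumpAt_self : bumpAt ρ a a = 1 := bump_eq_one (by simp)

theorem bumpAt_eq_one (hρ : 0 < ρ) (h : |s - a| ≤ ρ) : bumpAt ρ a s = 1 :=
  bump_eq_one (by rw [abs_div, abs_of_pos hρ]; exact (div_le_one hρ).2 h)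

theorem bumpAt_eq_zero (hρ : 0 < ρ) (h : 2 * ρ ≤ |s - a|) : bumpAt ρ a s = 0 :=
  bump_eq_zero (by rw [abs_div, abs_of_pos hρ]; exact (le_div_iff₀ hρ).2 h)

theorem deriv_bumpAt : deriv (bumpAt ρ a) = fun s => deriv bump ((s - a) / ρ) / ρ := by
  funext s
  have h1 : HasDerivAt (fun s : ℝ => (s - a) / ρ) (1 / ρ) s :=
    ((hasDerivAt_id s).sub_const a).div_const ρ
  have h2 := ((bump_contDiff.differentiable (by simp)) ((s - a) / ρ)).hasDerivAt.comp s h1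
  exact (h2.congr_deriv (by ring)).deriv

theorem deriv_deriv_bumpAt :
    deriv (deriv (bumpAt ρ a)) = fun s => deriv (deriv bump) ((s - a) / ρ) / ρ ^ 2 := by
  rw [deriv_bumpAt]
  funext s
  have h1 : HasDerivAt (fun s : ℝ => (s - a) / ρ) (1 / ρ) s :=
    ((hasDerivAt_id s).sub_const a).div_const ρ
  have h0 : ContDiff ℝ ∞ (deriv bump) := (contDiff_infty_iff_deriv.1 bump_contDiff).2
  have h2 := (((h0.differentiable (by simp)) ((s - a) / ρ)).hasDerivAt.comp s h1).div_const ρ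
  exact (h2.congr_deriv (by ring)).deriv

theorem abs_deriv_bumpAt_le (hρ : 0 < ρ) : |deriv (bumpAt ρ a) s| ≤ bumpC / ρ := by
  rw [deriv_bumpAt, abs_div, abs_of_pos hρ]
  gcongr
  exact abs_deriv_bump_le _

theorem abs_deriv_deriv_bumpAt_le (hρ : 0 < ρ) :
    |deriv (deriv (bumpAt ρ a)) s| ≤ bumpC / ρ ^ 2 := by
  rw [deriv_deriv_bumpAt, abs_div, abs_of_pos (by positivity : 0 < ρ ^ 2)]
  gcongr
  exact abs_deriv_deriv_bump_le _

end BumpAt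

/-- A smooth cut-off function on the plane, centered at `x`, at scale `ρ`. -/
def cut (ρ : ℝ) (x y : ℝ × ℝ) : ℝ := bumpAt ρ x.1 y.1 * bumpAt ρ x.2 y.2

section Cut

variable {ρ : ℝ} {x y : ℝ × ℝ}

theorem contDiff_cut (ρ : ℝ) (x : ℝ × ℝ) : ContDiff ℝ ∞ (cut ρ x) :=
  ((contDiff_bumpAt ρ x.1).comp contDiff_fst).mul ((contDiff_bumpAt ρ x.2).comp contDiff_snd)

theorem cut_nonneg : 0 ≤ cut ρ x y := mul_nonneg bumpAt_nonneg bumpAt_nonneg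

theorem cut_le_one : cut ρ x y ≤ 1 := mul_le_one₀ bumpAt_le_one bumpAt_nonneg bumpAt_le_one

theorem cut_self : cut ρ x x = 1 := by simp [cut, bumpAt_self]

theorem tsupport_cut_subset (hρ : 0 < ρ) :
    tsupport (cut ρ x) ⊆ Icc (x.1 - 2 * ρ) (x.1 + 2 * ρ) ×ˢ Icc (x.2 - 2 * ρ) (x.2 + 2 * ρ) := by
  refine closure_minimal (fun y hy => ?_) (isClosed_Icc.prod isClosed_Icc)
  have h1 : |y.1 - x.1| < 2 * ρ := by
    by_contra! h; exact hy (by simp [cut, bumpAt_eq_zero hρ h])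
  have h2 : |y.2 - x.2| < 2 * ρ := by
    by_contra! h; exact hy (by simp [cut, bumpAt_eq_zero hρ h])
  rw [abs_lt] at h1 h2
  exact ⟨⟨by linarith, by linarith⟩, ⟨by linarith, by linarith⟩⟩

theorem hasCompactSupport_cut (hρ : 0 < ρ) : HasCompactSupport (cut ρ x) :=
  (isCompact_Icc.prod isCompact_Icc).of_isClosed_subset (isClosed_tsupport _)
    (tsupport_cut_subset hρ)

theorem d₁_cut : d₁ (cut ρ x) = fun y => deriv (bumpAt ρ x.1) y.1 * bumpAt ρ x.2 y.2 := by
  funext y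
  exact ((((contDiff_bumpAt ρ x.1).differentiable (by simp)) y.1).hasDerivAt.mul_const
    (bumpAt ρ x.2 y.2)).deriv

theorem d₂_cut : d₂ (cut ρ x) = fun y => bumpAt ρ x.1 y.1 * deriv (bumpAt ρ x.2) y.2 := by
  funext y
  exact ((((contDiff_bumpAt ρ x.2).differentiable (by simp)) y.2).hasDerivAt.const_mul
    (bumpAt ρ x.1 y.1)).deriv

theorem lap_cut : lap (cut ρ x) = fun y => deriv (deriv (bumpAt ρ x.1)) y.1 * bumpAt ρ x.2 y.2 +
    bumpAt ρ x.1 y.1 * deriv (deriv (bumpAt ρ x.2)) y.2 := by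
  funext y
  have h : ∀ a, Differentiable ℝ (deriv (bumpAt ρ a)) := fun a =>
    (contDiff_infty_iff_deriv.1 (contDiff_bumpAt ρ a)).2.differentiable (by simp)
  unfold lap
  rw [d₁_cut, d₂_cut]
  congr 1
  · exact ((h x.1 y.1).hasDerivAt.mul_const (bumpAt ρ x.2 y.2)).deriv
  · exact ((h x.2 y.2).hasDerivAt.const_mul (bumpAt ρ x.1 y.1)).deriv

theorem abs_d₁_cut_le (hρ : 0 < ρ) : |d₁ (cut ρ x) y| ≤ bumpC / ρ := by
  rw [d₁_cut, abs_mul, abs_of_nonneg (bumpAt_nonneg (ρ := ρ) (a := x.2))]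
  exact (mul_le_of_le_one_right (abs_nonneg _) bumpAt_le_one).trans (abs_deriv_bumpAt_le hρ)

theorem abs_d₂_cut_le (hρ : 0 < ρ) : |d₂ (cut ρ x) y| ≤ bumpC / ρ := by
  rw [d₂_cut, abs_mul, abs_of_nonneg (bumpAt_nonneg (ρ := ρ) (a := x.1))]
  exact (mul_le_of_le_one_left (abs_nonneg _) bumpAt_le_one).trans (abs_deriv_bumpAt_le hρ)

theorem abs_lap_cut_le (hρ : 0 < ρ) : |lap (cut ρ x) y| ≤ 2 * bumpC / ρ ^ 2 := by
  rw [lap_cut]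
  refine (abs_add_le _ _).trans ?_
  rw [abs_mul, abs_mul, abs_of_nonneg (bumpAt_nonneg (ρ := ρ) (a := x.1)),
    abs_of_nonneg (bumpAt_nonneg (ρ := ρ) (a := x.2))]
  have h1 := (mul_le_of_le_one_right (abs_nonneg (deriv (deriv (bumpAt ρ x.1)) y.1))
    (bumpAt_le_one (ρ := ρ) (a := x.2) (s := y.2))).trans (abs_deriv_deriv_bumpAt_le hρ)
  have h2 := (mul_le_of_le_one_left (abs_nonneg (deriv (deriv (bumpAt ρ x.2)) y.2))
    (bumpAt_le_one (ρ := ρ) (a := x.1) (s := y.1))).trans (abs_deriv_deriv_bumpAt_le hρ)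
  calc _ ≤ bumpC / ρ ^ 2 + bumpC / ρ ^ 2 := add_le_add h1 h2
    _ = _ := by ring

end Cut

/-! ### The localized heat kernel. -/

/-- The localized backward heat kernel with pole at `(t, x)`. -/
def locKernel (ρ t : ℝ) (x : ℝ × ℝ) (τ : ℝ) (y : ℝ × ℝ) : ℝ := kernel t x τ y * cut ρ x y

section LocKernel

variable {ρ t τ : ℝ} {x y : ℝ × ℝ}

theorem smoothOn_locKernel (ρ t : ℝ) (x : ℝ × ℝ) : SmoothOn (Iio t) (locKernel ρ t x) :=
  (smoothOn_kernel t x).mul (SmoothOn.of_space (contDiff_cut ρ x))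

theorem contDiff_locKernel (h : τ < t) (x : ℝ × ℝ) : ContDiff ℝ ∞ (locKernel ρ t x τ) :=
  (smoothOn_locKernel ρ t x).slice isOpen_Iio h

theorem hasCompactSupport_locKernel (hρ : 0 < ρ) : HasCompactSupport (locKernel ρ t x τ) :=
  (hasCompactSupport_cut hρ).mul_left

theorem abs_locKernel_le (h : τ < t) : |locKernel ρ t x τ y| ≤ kernel t x τ y := by
  unfold locKernel
  rw [abs_mul, abs_of_pos (kernel_pos h x y), abs_of_nonneg cut_nonneg]
  exact mul_le_of_le_one_right (kernel_pos h x y).le cut_le_one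

/-- A derivative falling on the kernel costs `(t-τ)^(-1/2)`; one falling on the cut-off costs only
`bumpC / ρ`. -/
theorem abs_d_locKernel_le (hρ : 0 < ρ) (h : τ < t) :
    |d₁ (locKernel ρ t x τ) y| + |d₂ (locKernel ρ t x τ) y| ≤
      (√(t - τ))⁻¹ * heatGrad (t - τ) (x - y) + 2 * bumpC / ρ * kernel t x τ y := by
  have hk := (smoothOn_kernel t x).differentiable isOpen_Iio h y
  have hc := smooth_differentiable (contDiff_cut ρ x) y
  have e1 : d₁ (locKernel ρ t x τ) y = _ := d₁_mul hk hc
  have e2 : d₂ (locKernel ρ t x τ) y = _ := d₂_mul hk hc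
  rw [e1, e2]
  have k0 := kernel_pos h x y
  have hb := abs_d_kernel_le h x y
  have c1 := abs_d₁_cut_le (x := x) (y := y) hρ
  have c2 := abs_d₂_cut_le (x := x) (y := y) hρ
  have a1 : |d₁ (kernel t x τ) y * cut ρ x y + kernel t x τ y * d₁ (cut ρ x) y| ≤
      |d₁ (kernel t x τ) y| + kernel t x τ y * (bumpC / ρ) := by
    refine (abs_add_le _ _).trans ?_
    rw [abs_mul, abs_mul, abs_of_pos k0, abs_of_nonneg cut_nonneg]
    gcongr
    exact mul_le_of_le_one_right (abs_nonneg _) cut_le_one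
  have a2 : |d₂ (kernel t x τ) y * cut ρ x y + kernel t x τ y * d₂ (cut ρ x) y| ≤
      |d₂ (kernel t x τ) y| + kernel t x τ y * (bumpC / ρ) := by
    refine (abs_add_le _ _).trans ?_
    rw [abs_mul, abs_mul, abs_of_pos k0, abs_of_nonneg cut_nonneg]
    gcongr
    exact mul_le_of_le_one_right (abs_nonneg _) cut_le_one
  calc _ ≤ (|d₁ (kernel t x τ) y| + |d₂ (kernel t x τ) y|) +
        2 * (kernel t x τ y * (bumpC / ρ)) := by linarith
    _ ≤ (√(t - τ))⁻¹ * heatGrad (t - τ) (x - y) + 2 * (kernel t x τ y * (bumpC / ρ)) := by gcongr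
    _ = _ := by ring

/-- The coefficients are the masses of `heatGrad`, which is `2`, and of `kernel`, which is `1`. -/
theorem abs_integral_le_of_le_heat {F : ℝ × ℝ → ℝ} {A B : ℝ} (h : τ < t)
    (hF : ∀ y, |F y| ≤ A * heatGrad (t - τ) (x - y) + B * kernel t x τ y) :
    |∫ y, F y| ≤ 2 * A + B := by
  have i1 : Integrable fun y => heatGrad (t - τ) (x - y) :=
    (integrable_heatGrad (sub_pos.2 h)).comp_sub_left x
  have i2 := integrable_kernel h x
  have := norm_integral_le_of_norm_le (f := F)
    (g := fun y => A * heatGrad (t - τ) (x - y) + B * kernel t x τ y)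
    ((i1.const_mul A).add (i2.const_mul B)) (Eventually.of_forall hF)
  refine this.trans_eq ?_
  rw [integral_add (i1.const_mul A) (i2.const_mul B), integral_const_mul, integral_const_mul,
    integral_kernel h, integral_sub_left_eq_self (heatGrad (t - τ)) volume x,
    integral_heatGrad (sub_pos.2 h)]
  ring

theorem abs_integral_mul_d_locKernel_le {g₁ g₂ : ℝ × ℝ → ℝ} {b : ℝ} (hρ : 0 < ρ) (h : τ < t)
    (hg₁ : ∀ y, |g₁ y| ≤ b) (hg₂ : ∀ y, |g₂ y| ≤ b) :
    |∫ y, (g₁ y * d₁ (locKernel ρ t x τ) y + g₂ y * d₂ (locKernel ρ t x τ) y)| ≤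
      b * (2 * (√(t - τ))⁻¹ + 2 * bumpC / ρ) := by
  have hb : 0 ≤ b := (abs_nonneg _).trans (hg₁ 0)
  refine (abs_integral_le_of_le_heat (x := x) (A := b * (√(t - τ))⁻¹)
    (B := b * (2 * bumpC / ρ)) h fun y => ?_).trans_eq (by ring)
  calc _ ≤ |g₁ y| * |d₁ (locKernel ρ t x τ) y| + |g₂ y| * |d₂ (locKernel ρ t x τ) y| := by
        refine (abs_add_le _ _).trans ?_
        rw [abs_mul, abs_mul]
    _ ≤ b * |d₁ (locKernel ρ t x τ) y| + b * |d₂ (locKernel ρ t x τ) y| := by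
        gcongr
        · exact hg₁ y
        · exact hg₂ y
    _ = b * (|d₁ (locKernel ρ t x τ) y| + |d₂ (locKernel ρ t x τ) y|) := by ring
    _ ≤ b * ((√(t - τ))⁻¹ * heatGrad (t - τ) (x - y) + 2 * bumpC / ρ * kernel t x τ y) :=
        mul_le_mul_of_nonneg_left (abs_d_locKernel_le hρ h) hb
    _ = _ := by ring

end LocKernel

/-! ### Duhamel's formula with a localized kernel. -/

section Representation

variable {f F₁ F₂ : ℝ → ℝ × ℝ → ℝ} {ρ t : ℝ} {x : ℝ × ℝ}

/-- As the kernel solves the backward heat equation, Green's identity leaves only the terms in which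
a derivative hits the cut-off, and the flux paired with the gradient of the localized kernel. -/
theorem hasDerivAt_integral_locKernel (hf : SmoothOn (Ioi 0) f) (hF₁ : SmoothOn (Ioi 0) F₁)
    (hF₂ : SmoothOn (Ioi 0) F₂)
    (heq : ∀ s, 0 < s → ∀ y, dt f s y = lap (f s) y - d₁ (F₁ s) y - d₂ (F₂ s) y)
    (hρ : 0 < ρ) {τ : ℝ} (hτ : 0 < τ) (hτt : τ < t) :
    HasDerivAt (fun τ => ∫ y, locKernel ρ t x τ y * f τ y)
      (∫ y, (f τ y * (2 * (d₁ (kernel t x τ) y * d₁ (cut ρ x) y +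
          d₂ (kernel t x τ) y * d₂ (cut ρ x) y) + kernel t x τ y * lap (cut ρ x) y) +
        (F₁ τ y * d₁ (locKernel ρ t x τ) y + F₂ τ y * d₂ (locKernel ρ t x τ) y))) τ := by
  have hI : IsOpen (Ioo 0 t) := isOpen_Ioo
  have hmem : τ ∈ Ioo 0 t := ⟨hτ, hτt⟩
  have sK : SmoothOn (Ioo 0 t) (kernel t x) := (smoothOn_kernel t x).mono fun _ h => h.2
  have sΦ : SmoothOn (Ioo 0 t) (locKernel ρ t x) := (smoothOn_locKernel ρ t x).mono fun _ h => h.2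
  have sf : SmoothOn (Ioo 0 t) f := hf.mono fun _ h => h.1
  have s1 : SmoothOn (Ioo 0 t) F₁ := hF₁.mono fun _ h => h.1
  have s2 : SmoothOn (Ioo 0 t) F₂ := hF₂.mono fun _ h => h.1
  have hcpt := hasCompactSupport_cut (x := x) hρ
  have hz : ∀ s, ∀ y ∉ tsupport (cut ρ x), locKernel ρ t x s y * f s y = 0 := fun s y hy => by
    simp [locKernel, image_eq_zero_of_notMem_tsupport hy]
  have hder := (sΦ.mul sf).hasDerivAt_setIntegral hI hcpt hmem
  have e0 : (fun s => ∫ y in tsupport (cut ρ x), locKernel ρ t x s y * f s y) =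
      fun s => ∫ y, locKernel ρ t x s y * f s y :=
    funext fun s => setIntegral_eq_integral_of_forall_compl_eq_zero fun y hy => hz s y hy
  rw [e0] at hder
  refine hder.congr_deriv ?_
  rw [setIntegral_eq_integral_of_forall_compl_eq_zero]
  swap
  · intro y hy
    unfold dt
    have : (fun s => locKernel ρ t x s y * f s y) = fun _ => 0 := funext fun s => hz s y hy
    rw [this]; simp
  have dΦ := sΦ.slice hI hmem
  have df := sf.slice hI hmem
  have dF1 := s1.slice hI hmem
  have dF2 := s2.slice hI hmem
  have dK := sK.slice hI hmem
  have dC := contDiff_cut ρ x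
  have cΦ : HasCompactSupport (locKernel ρ t x τ) := hasCompactSupport_locKernel hρ
  -- With `Φ` the localized kernel, `(X, Y) = Φ∇f - f∇Φ - ΦF`; its divergence integrates to zero.
  set X : ℝ × ℝ → ℝ := fun y => locKernel ρ t x τ y * d₁ (f τ) y - f τ y * d₁ (locKernel ρ t x τ) y
    - locKernel ρ t x τ y * F₁ τ y with hX
  set Y : ℝ × ℝ → ℝ := fun y => locKernel ρ t x τ y * d₂ (f τ) y - f τ y * d₂ (locKernel ρ t x τ) y
    - locKernel ρ t x τ y * F₂ τ y with hY
  have sX : ContDiff ℝ ∞ X :=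
    ((dΦ.mul (contDiff_d₁ df)).sub (df.mul (contDiff_d₁ dΦ))).sub (dΦ.mul dF1)
  have sY : ContDiff ℝ ∞ Y :=
    ((dΦ.mul (contDiff_d₂ df)).sub (df.mul (contDiff_d₂ dΦ))).sub (dΦ.mul dF2)
  have cX : HasCompactSupport X := by
    rw [hX]
    exact ((cΦ.mul_right).sub (HasCompactSupport.d₁ cΦ).mul_left).sub cΦ.mul_right
  have cY : HasCompactSupport Y := by
    rw [hY]
    exact ((cΦ.mul_right).sub (HasCompactSupport.d₂ cΦ).mul_left).sub cΦ.mul_right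
  have iX := integral_d₁_eq_zero sX cX
  have iY := integral_d₂_eq_zero sY cY
  have jX : Integrable (d₁ X) :=
    (contDiff_d₁ sX).continuous.integrable_of_hasCompactSupport (HasCompactSupport.d₁ cX)
  have jY : Integrable (d₂ Y) :=
    (contDiff_d₂ sY).continuous.integrable_of_hasCompactSupport (HasCompactSupport.d₂ cY)
  set R : ℝ × ℝ → ℝ := fun y => (f τ y * (2 * (d₁ (kernel t x τ) y * d₁ (cut ρ x) y +
          d₂ (kernel t x τ) y * d₂ (cut ρ x) y) + kernel t x τ y * lap (cut ρ x) y) +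
        (F₁ τ y * d₁ (locKernel ρ t x τ) y + F₂ τ y * d₂ (locKernel ρ t x τ) y)) with hR
  have key : ∀ y, dt (fun s y => locKernel ρ t x s y * f s y) τ y = R y + (d₁ X y + d₂ Y y) := by
    intro y
    have D {h : ℝ × ℝ → ℝ} (hh : ContDiff ℝ ∞ h) : DifferentiableAt ℝ h y :=
      smooth_differentiable hh y
    have dd1 := contDiff_d₁ df
    have dd2 := contDiff_d₂ df
    have dp1 := contDiff_d₁ dΦ
    have dp2 := contDiff_d₂ dΦ
    have dk1 := contDiff_d₁ dK
    have dk2 := contDiff_d₂ dK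
    have dc1 := contDiff_d₁ dC
    have dc2 := contDiff_d₂ dC
    have eX : d₁ X y = (d₁ (locKernel ρ t x τ) y * d₁ (f τ) y +
        locKernel ρ t x τ y * d₁ (d₁ (f τ)) y) - (d₁ (f τ) y * d₁ (locKernel ρ t x τ) y +
        f τ y * d₁ (d₁ (locKernel ρ t x τ)) y) - (d₁ (locKernel ρ t x τ) y * F₁ τ y +
        locKernel ρ t x τ y * d₁ (F₁ τ) y) := by
      rw [hX, d₁_sub (D ((dΦ.mul dd1).sub (df.mul dp1))) (D (dΦ.mul dF1)),
        d₁_sub (D (dΦ.mul dd1)) (D (df.mul dp1)), d₁_mul (D dΦ) (D dd1), d₁_mul (D df) (D dp1),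
        d₁_mul (D dΦ) (D dF1)]
    have eY : d₂ Y y = (d₂ (locKernel ρ t x τ) y * d₂ (f τ) y +
        locKernel ρ t x τ y * d₂ (d₂ (f τ)) y) - (d₂ (f τ) y * d₂ (locKernel ρ t x τ) y +
        f τ y * d₂ (d₂ (locKernel ρ t x τ)) y) - (d₂ (locKernel ρ t x τ) y * F₂ τ y +
        locKernel ρ t x τ y * d₂ (F₂ τ) y) := by
      rw [hY, d₂_sub (D ((dΦ.mul dd2).sub (df.mul dp2))) (D (dΦ.mul dF2)),
        d₂_sub (D (dΦ.mul dd2)) (D (df.mul dp2)), d₂_mul (D dΦ) (D dd2), d₂_mul (D df) (D dp2),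
        d₂_mul (D dΦ) (D dF2)]
    have f1 : d₁ (locKernel ρ t x τ) = fun y => d₁ (kernel t x τ) y * cut ρ x y +
        kernel t x τ y * d₁ (cut ρ x) y :=
      funext fun y => d₁_mul (smooth_differentiable dK y) (smooth_differentiable dC y)
    have f2 : d₂ (locKernel ρ t x τ) = fun y => d₂ (kernel t x τ) y * cut ρ x y +
        kernel t x τ y * d₂ (cut ρ x) y :=
      funext fun y => d₂_mul (smooth_differentiable dK y) (smooth_differentiable dC y)
    have g1 : d₁ (d₁ (locKernel ρ t x τ)) y = (d₁ (d₁ (kernel t x τ)) y * cut ρ x y +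
        d₁ (kernel t x τ) y * d₁ (cut ρ x) y) + (d₁ (kernel t x τ) y * d₁ (cut ρ x) y +
        kernel t x τ y * d₁ (d₁ (cut ρ x)) y) := by
      rw [f1, d₁_add (D (dk1.mul dC)) (D (dK.mul dc1)), d₁_mul (D dk1) (D dC),
        d₁_mul (D dK) (D dc1)]
    have g2 : d₂ (d₂ (locKernel ρ t x τ)) y = (d₂ (d₂ (kernel t x τ)) y * cut ρ x y +
        d₂ (kernel t x τ) y * d₂ (cut ρ x) y) + (d₂ (kernel t x τ) y * d₂ (cut ρ x) y +
        kernel t x τ y * d₂ (d₂ (cut ρ x)) y) := by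
      rw [f2, d₂_add (D (dk2.mul dC)) (D (dK.mul dc2)), d₂_mul (D dk2) (D dC),
        d₂_mul (D dK) (D dc2)]
    have hdt : dt (locKernel ρ t x) τ y = -lap (kernel t x τ) y * cut ρ x y := by
      rw [← dt_kernel hτt]
      exact ((SmoothOn.hasDerivAt_dt hI sK hmem).mul_const _).deriv
    rw [SmoothOn.dt_mul hI sΦ sf hmem, heq τ hτ, hdt, eX, eY, g1, g2, hR]
    simp only [lap, f1, f2, locKernel]
    ring
  have iR : Integrable R := by
    have hcont : Continuous R := by
      rw [hR]
      have := dK.continuous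
      have := (contDiff_d₁ dK).continuous
      have := (contDiff_d₂ dK).continuous
      have := (contDiff_d₁ dC).continuous
      have := (contDiff_d₂ dC).continuous
      have := (contDiff_d₁ dΦ).continuous
      have := (contDiff_d₂ dΦ).continuous
      have := (contDiff_d₁ (contDiff_d₁ dC)).continuous
      have := (contDiff_d₂ (contDiff_d₂ dC)).continuous
      have := df.continuous
      have := dF1.continuous
      have := dF2.continuous
      unfold lap
      fun_prop
    refine hcont.integrable_of_hasCompactSupport ?_
    have c1 := HasCompactSupport.d₁ hcpt
    have c2 := HasCompactSupport.d₂ hcpt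
    exact ((((c1.mul_left).add (c2.mul_left)).mul_left.add
      ((HasCompactSupport.d₁ c1).add (HasCompactSupport.d₂ c2)).mul_left).mul_left).add
      ((HasCompactSupport.d₁ cΦ).mul_left.add (HasCompactSupport.d₂ cΦ).mul_left)
  simp_rw [key]
  have jXY : Integrable fun y => d₁ X y + d₂ Y y := jX.add jY
  rw [integral_add iR jXY]
  have : ∫ y, (d₁ X y + d₂ Y y) = 0 := by rw [integral_add jX jY, iX, iY, add_zero]
  rw [this, add_zero]

/-- Duhamel's principle, as an inequality: a solution of `∂ₜf = Δf - div F` is controlled at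
`(t, x)` by its localized heat evolution from time `s` and by local bounds for `f` and `F`. -/
theorem abs_le_of_heat_equation (hf : SmoothOn (Ioi 0) f) (hF₁ : SmoothOn (Ioi 0) F₁)
    (hF₂ : SmoothOn (Ioi 0) F₂)
    (heq : ∀ s, 0 < s → ∀ y, dt f s y = lap (f s) y - d₁ (F₁ s) y - d₂ (F₂ s) y)
    (hρ : 0 < ρ) {s : ℝ} (hs : 0 < s) (hst : s < t) {a b β β' : ℝ → ℝ}
    (hβc : ContinuousOn β (Icc s t)) (hβ : ∀ τ ∈ Ioo s t, HasDerivAt β (β' τ) τ)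
    (ha : ∀ τ ∈ Ioo s t, ∀ y ∈ tsupport (cut ρ x), |f τ y| ≤ a τ)
    (hb₁ : ∀ τ ∈ Ioo s t, ∀ y ∈ tsupport (cut ρ x), |F₁ τ y| ≤ b τ)
    (hb₂ : ∀ τ ∈ Ioo s t, ∀ y ∈ tsupport (cut ρ x), |F₂ τ y| ≤ b τ)
    (hab : ∀ τ ∈ Ioo s t, a τ * (4 * bumpC / ρ * (√(t - τ))⁻¹ + 2 * bumpC / ρ ^ 2) +
      b τ * (2 * (√(t - τ))⁻¹ + 2 * bumpC / ρ) ≤ β' τ) :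
    |f t x| ≤ |∫ y, locKernel ρ t x s y * f s y| + β t - β s := by
  set J : ℝ → ℝ := fun τ => ∫ y, locKernel ρ t x τ y * f τ y with hJ
  set J' : ℝ → ℝ := fun τ => ∫ y, (f τ y * (2 * (d₁ (kernel t x τ) y * d₁ (cut ρ x) y +
          d₂ (kernel t x τ) y * d₂ (cut ρ x) y) + kernel t x τ y * lap (cut ρ x) y) +
        (F₁ τ y * d₁ (locKernel ρ t x τ) y + F₂ τ y * d₂ (locKernel ρ t x τ) y)) with hJ'
  have hJd : ∀ τ ∈ Ico s t, HasDerivAt J (J' τ) τ := fun τ hτ =>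
    hasDerivAt_integral_locKernel hf hF₁ hF₂ heq hρ (hs.trans_le hτ.1) hτ.2
  have hC := one_le_bumpC
  have hsupp : ∀ τ, ∀ y ∉ tsupport (cut ρ x), d₁ (locKernel ρ t x τ) y = 0 ∧
      d₂ (locKernel ρ t x τ) y = 0 ∧ d₁ (cut ρ x) y = 0 ∧ d₂ (cut ρ x) y = 0 ∧
      lap (cut ρ x) y = 0 := by
    intro τ y hy
    have h0 : cut ρ x =ᶠ[𝓝 y] fun _ => 0 := notMem_tsupport_iff_eventuallyEq.mp hy
    have h0' : locKernel ρ t x τ =ᶠ[𝓝 y] fun _ => 0 := by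
      filter_upwards [h0] with z hz; simp [locKernel, hz]
    have A : ∀ {h : ℝ × ℝ → ℝ}, h =ᶠ[𝓝 y] (fun _ => 0) →
        d₁ h =ᶠ[𝓝 y] (fun _ => 0) ∧ d₂ h =ᶠ[𝓝 y] fun _ => 0 := by
      intro h hh
      constructor
      · filter_upwards [hh.eventually_nhds] with z hz
        have : (fun s => h (s, z.2)) =ᶠ[𝓝 z.1] fun _ => 0 :=
          (Continuous.tendsto' (by fun_prop : Continuous fun s : ℝ => (s, z.2)) z.1 z rfl).eventually hz
        simp [d₁, this.deriv_eq]
      · filter_upwards [hh.eventually_nhds] with z hz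
        have : (fun s => h (z.1, s)) =ᶠ[𝓝 z.2] fun _ => 0 :=
          (Continuous.tendsto' (by fun_prop : Continuous fun s : ℝ => (z.1, s)) z.2 z rfl).eventually hz
        simp [d₂, this.deriv_eq]
    refine ⟨(A h0').1.eq_of_nhds, (A h0').2.eq_of_nhds, (A h0).1.eq_of_nhds,
      (A h0).2.eq_of_nhds, ?_⟩
    simp [lap, (A (A h0).1).1.eq_of_nhds, (A (A h0).2).2.eq_of_nhds]
  -- The bounds `a` and `b` are known only on the support of the cut-off; off the support every term
  -- of the integrand vanishes.
  have hJb : ∀ τ ∈ Ioo s t, |J' τ| ≤ β' τ := by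
    intro τ hτ
    have ha0 : 0 ≤ a τ := (abs_nonneg _).trans (ha τ hτ x (subset_tsupport _ (by
      simp [Function.mem_support, cut_self])))
    have hb0 : 0 ≤ b τ := (abs_nonneg _).trans (hb₁ τ hτ x (subset_tsupport _ (by
      simp [Function.mem_support, cut_self])))
    have hσ : 0 < t - τ := sub_pos.2 hτ.2
    refine (abs_integral_le_of_le_heat (x := x)
      (A := a τ * (2 * (bumpC / ρ) * (√(t - τ))⁻¹) + b τ * (√(t - τ))⁻¹)
      (B := a τ * (2 * bumpC / ρ ^ 2) + b τ * (2 * bumpC / ρ)) hτ.2 fun y => ?_).trans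
      (le_trans (le_of_eq (by ring)) (hab τ hτ))
    have hG := heatGrad_pos hσ (x - y)
    have hk := kernel_pos hτ.2 x y
    by_cases hy : y ∈ tsupport (cut ρ x)
    · have p0 := ha τ hτ y hy
      have p1 := hb₁ τ hτ y hy
      have p2 := hb₂ τ hτ y hy
      have q1 := abs_d_kernel_le hτ.2 x y
      have q2 := abs_d_locKernel_le (x := x) (y := y) hρ hτ.2
      have r1 := abs_d₁_cut_le (x := x) (y := y) hρ
      have r2 := abs_d₂_cut_le (x := x) (y := y) hρ
      have r3 := abs_lap_cut_le (x := x) (y := y) hρ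
      have m1 : |2 * (d₁ (kernel t x τ) y * d₁ (cut ρ x) y +
          d₂ (kernel t x τ) y * d₂ (cut ρ x) y) + kernel t x τ y * lap (cut ρ x) y| ≤
          2 * (bumpC / ρ) * ((√(t - τ))⁻¹ * heatGrad (t - τ) (x - y)) +
            2 * bumpC / ρ ^ 2 * kernel t x τ y := by
        calc _ ≤ 2 * (|d₁ (kernel t x τ) y| * |d₁ (cut ρ x) y| +
              |d₂ (kernel t x τ) y| * |d₂ (cut ρ x) y|) +
              kernel t x τ y * |lap (cut ρ x) y| := by
              refine (abs_add_le _ _).trans ?_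
              rw [abs_mul, abs_mul, abs_two, abs_of_pos hk]
              gcongr
              refine (abs_add_le _ _).trans ?_
              rw [abs_mul, abs_mul]
          _ ≤ 2 * (|d₁ (kernel t x τ) y| * (bumpC / ρ) + |d₂ (kernel t x τ) y| * (bumpC / ρ)) +
              kernel t x τ y * (2 * bumpC / ρ ^ 2) := by gcongr
          _ = 2 * (bumpC / ρ) * (|d₁ (kernel t x τ) y| + |d₂ (kernel t x τ) y|) +
              2 * bumpC / ρ ^ 2 * kernel t x τ y := by ring
          _ ≤ _ := by gcongr
      have m2 : |F₁ τ y * d₁ (locKernel ρ t x τ) y + F₂ τ y * d₂ (locKernel ρ t x τ) y| ≤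
          b τ * ((√(t - τ))⁻¹ * heatGrad (t - τ) (x - y) + 2 * bumpC / ρ * kernel t x τ y) := by
        calc _ ≤ |F₁ τ y| * |d₁ (locKernel ρ t x τ) y| +
              |F₂ τ y| * |d₂ (locKernel ρ t x τ) y| := by
              refine (abs_add_le _ _).trans ?_
              rw [abs_mul, abs_mul]
          _ ≤ b τ * |d₁ (locKernel ρ t x τ) y| + b τ * |d₂ (locKernel ρ t x τ) y| := by gcongr
          _ = b τ * (|d₁ (locKernel ρ t x τ) y| + |d₂ (locKernel ρ t x τ) y|) := by ring
          _ ≤ _ := by gcongr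
      calc _ ≤ a τ * (2 * (bumpC / ρ) * ((√(t - τ))⁻¹ * heatGrad (t - τ) (x - y)) +
            2 * bumpC / ρ ^ 2 * kernel t x τ y) +
            b τ * ((√(t - τ))⁻¹ * heatGrad (t - τ) (x - y) + 2 * bumpC / ρ * kernel t x τ y) := by
            refine (abs_add_le _ _).trans ?_
            rw [abs_mul]
            gcongr
        _ = _ := by ring
    · obtain ⟨z1, z2, z3, z4, z5⟩ := hsupp τ y hy
      simp only [z1, z2, z3, z4, z5, mul_zero, add_zero, abs_zero]
      positivity
  -- In the applications `β'` blows up at `t`, so the comparison is made on `[s, τ]` with `τ < t`,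
  -- and `τ → t` is taken at the end using only continuity of `β`.
  have hstep : ∀ τ ∈ Ioo s t, |J τ| ≤ |J s| + β τ - β s := by
    intro τ hτ
    have hsub : Icc s τ ⊆ Icc s t := Icc_subset_Icc_right hτ.2.le
    have hJc : ContinuousOn J (Icc s τ) := fun r hr =>
      (hJd r ⟨hr.1, hr.2.trans_lt hτ.2⟩).continuousAt.continuousWithinAt
    -- The choices `e = 1` and `e = -1` give the two signs of the absolute value.
    have hm : ∀ e : ℝ, |e| = 1 → e * J τ - β τ ≤ e * J s - β s := by
      intro e he
      have hanti : AntitoneOn (fun r => e * J r - β r) (Icc s τ) := by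
        refine antitoneOn_of_deriv_nonpos (convex_Icc s τ)
          ((continuousOn_const.mul hJc).sub (hβc.mono hsub)) ?_ ?_
        · intro r hr
          rw [interior_Icc] at hr
          exact (((hJd r ⟨hr.1.le, hr.2.trans hτ.2⟩).const_mul e).sub
            (hβ r ⟨hr.1, hr.2.trans hτ.2⟩)).differentiableAt.differentiableWithinAt
        · intro r hr
          rw [interior_Icc] at hr
          have h1 := ((hJd r ⟨hr.1.le, hr.2.trans hτ.2⟩).const_mul e).sub
            (hβ r ⟨hr.1, hr.2.trans hτ.2⟩)
          have h2 : deriv (fun r => e * J r - β r) r = e * J' r - β' r := h1.deriv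
          rw [h2, sub_nonpos]
          calc e * J' r ≤ |e * J' r| := le_abs_self _
            _ = |J' r| := by rw [abs_mul, he, one_mul]
            _ ≤ β' r := hJb r ⟨hr.1, hr.2.trans hτ.2⟩
      exact hanti (left_mem_Icc.2 hτ.1.le) (right_mem_Icc.2 hτ.1.le) hτ.1.le
    have h1 := hm 1 (by simp)
    have h2 := hm (-1) (by simp)
    have h3 := le_abs_self (J s)
    have h4 := neg_abs_le (J s)
    exact abs_le.2 ⟨by linarith, by linarith⟩
  have hcontf : ContinuousOn (fun z : ℝ × (ℝ × ℝ) => cut ρ x z.2 * f z.1 z.2) (Ioi 0 ×ˢ univ) :=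
    (((contDiff_cut ρ x).continuous.comp continuous_snd).continuousOn).mul hf.continuousOn
  have hlim := tendsto_integral_kernel (h := fun τ y => cut ρ x y * f τ y) isOpen_Ioi hcontf
    (hasCompactSupport_cut (x := x) hρ)
    (fun τ y hy => by simp [image_eq_zero_of_notMem_tsupport hy]) (hs.trans hst) x
  have hlim' : Tendsto J (𝓝[<] t) (𝓝 (f t x)) := by
    simpa [cut_self, ← mul_assoc, J, locKernel] using hlim
  have hβlim : Tendsto (fun τ => |J s| + β τ - β s) (𝓝[<] t) (𝓝 (|J s| + β t - β s)) := by
    have : Tendsto β (𝓝[<] t) (𝓝 (β t)) := by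
      have h1 : ContinuousWithinAt β (Icc s t) t := hβc t (right_mem_Icc.2 hst.le)
      refine h1.tendsto.mono_left ?_
      rw [← nhdsWithin_Ioo_eq_nhdsLT hst]
      exact nhdsWithin_mono t Ioo_subset_Icc_self
    exact (this.const_add _).sub_const _
  refine le_of_tendsto_of_tendsto hlim'.abs hβlim ?_
  rw [← nhdsWithin_Ioo_eq_nhdsLT hst]
  filter_upwards [self_mem_nhdsWithin] with τ hτ using hstep τ hτ

end Representation

/-! ### The vorticity equation. -/

/-- Moving the curl onto the test function lets the vorticity at one instant be controlled by the
velocity alone. -/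
theorem integral_mul_curl {a b φ : ℝ × ℝ → ℝ} (ha : ContDiff ℝ ∞ a) (hb : ContDiff ℝ ∞ b)
    (hφ : ContDiff ℝ ∞ φ) (hc : HasCompactSupport φ) :
    ∫ x, φ x * (d₁ b x - d₂ a x) = ∫ x, (a x * d₂ φ x - b x * d₁ φ x) := by
  have h1 := integral_d₁_eq_zero (hφ.mul hb) hc.mul_right
  have h2 := integral_d₂_eq_zero (hφ.mul ha) hc.mul_right
  have i1 : Integrable (d₁ fun x => φ x * b x) :=
    (contDiff_d₁ (hφ.mul hb)).continuous.integrable_of_hasCompactSupport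
      (HasCompactSupport.d₁ hc.mul_right)
  have i2 : Integrable (d₂ fun x => φ x * a x) :=
    (contDiff_d₂ (hφ.mul ha)).continuous.integrable_of_hasCompactSupport
      (HasCompactSupport.d₂ hc.mul_right)
  have h3 : ∫ x, (d₁ (fun x => φ x * b x) x - d₂ (fun x => φ x * a x) x) = 0 := by
    rw [integral_sub i1 i2, h1, h2, sub_zero]
  have i3 : Integrable fun x => a x * d₂ φ x - b x * d₁ φ x :=
    ((ha.continuous.mul (contDiff_d₂ hφ).continuous).sub
      (hb.continuous.mul (contDiff_d₁ hφ).continuous)).integrable_of_hasCompactSupport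
      ((HasCompactSupport.d₂ hc).mul_left.sub (HasCompactSupport.d₁ hc).mul_left)
  have h4 : ∀ x, φ x * (d₁ b x - d₂ a x) = (a x * d₂ φ x - b x * d₁ φ x) +
      (d₁ (fun x => φ x * b x) x - d₂ (fun x => φ x * a x) x) := by
    intro x
    have D {h : ℝ × ℝ → ℝ} (hh : ContDiff ℝ ∞ h) : DifferentiableAt ℝ h x :=
      smooth_differentiable hh x
    rw [d₁_mul (D hφ) (D hb), d₂_mul (D hφ) (D ha)]
    ring
  have i4 : Integrable fun x => d₁ (fun x => φ x * b x) x - d₂ (fun x => φ x * a x) x := i1.sub i2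
  simp_rw [h4]
  rw [integral_add i3 i4, h3, add_zero]

theorem d₁_periodic {f : ℝ × ℝ → ℝ} (hf : ∀ x₁ x₂, f (x₁, x₂ + 1) = f (x₁, x₂)) (x₁ x₂ : ℝ) :
    d₁ f (x₁, x₂ + 1) = d₁ f (x₁, x₂) := by
  simp [d₁, hf]

theorem d₂_periodic {f : ℝ × ℝ → ℝ} (hf : ∀ x₁ x₂, f (x₁, x₂ + 1) = f (x₁, x₂)) (x₁ x₂ : ℝ) :
    d₂ f (x₁, x₂ + 1) = d₂ f (x₁, x₂) := by
  have := deriv_comp_add_const (f := fun s => f (x₁, s)) (1 : ℝ) x₂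
  simp only [hf] at this
  exact this.symm

namespace IsNSSolution

variable {u : ℝ → ℝ × ℝ → ℝ × ℝ} (hu : IsNSSolution u)
include hu

theorem smoothOn₁ : SmoothOn (Ioi 0) fun t => comp₁ (u t) :=
  contDiff_fst.comp_contDiffOn hu.smooth

theorem smoothOn₂ : SmoothOn (Ioi 0) fun t => comp₂ (u t) :=
  contDiff_snd.comp_contDiffOn hu.smooth

theorem contDiff₁ {t : ℝ} (ht : 0 < t) : ContDiff ℝ ∞ (comp₁ (u t)) :=
  hu.smoothOn₁.slice isOpen_Ioi ht

theorem contDiff₂ {t : ℝ} (ht : 0 < t) : ContDiff ℝ ∞ (comp₂ (u t)) :=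
  hu.smoothOn₂.slice isOpen_Ioi ht

theorem smoothOn_vort : SmoothOn (Ioi 0) fun t => vort (u t) :=
  (hu.smoothOn₂.d₁ isOpen_Ioi).sub (hu.smoothOn₁.d₂ isOpen_Ioi)

theorem periodic₁ {t : ℝ} (ht : 0 ≤ t) (x₁ x₂ : ℝ) :
    comp₁ (u t) (x₁, x₂ + 1) = comp₁ (u t) (x₁, x₂) := by
  simp [comp₁, (hu.buc t ht).periodic]

theorem periodic₂ {t : ℝ} (ht : 0 ≤ t) (x₁ x₂ : ℝ) :
    comp₂ (u t) (x₁, x₂ + 1) = comp₂ (u t) (x₁, x₂) := by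
  simp [comp₂, (hu.buc t ht).periodic]

theorem vort_periodic {t : ℝ} (ht : 0 ≤ t) (x₁ x₂ : ℝ) :
    vort (u t) (x₁, x₂ + 1) = vort (u t) (x₁, x₂) := by
  simp [vort, d₁_periodic (hu.periodic₂ ht), d₂_periodic (hu.periodic₁ ht)]

/-- A global solution is uniformly bounded on bounded time intervals. -/
theorem exists_bound (T : ℝ) : ∃ U : ℝ, 0 ≤ U ∧ ∀ t ∈ Icc 0 T, ∀ x, ‖u t x‖ ≤ U := by
  have hloc : ∀ t ∈ Icc 0 T, ∃ V ∈ 𝓝[Icc 0 T] t, ∃ U : ℝ, ∀ s ∈ V, ∀ x, ‖u s x‖ ≤ U := by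
    intro t ht
    obtain ⟨B, hB⟩ := (hu.buc t ht.1).bounded
    have h1 := Metric.tendstoUniformly_iff.mp (hu.continuous_buc t ht.1) 1 one_pos
    have h2 : ∀ᶠ s in 𝓝[Icc 0 T] t, ∀ x, dist (u t x) (u s x) < 1 :=
      nhdsWithin_mono t Icc_subset_Ici_self h1
    refine ⟨_, h2, B + 1, fun s hs x => ?_⟩
    have h3 := hs x
    rw [dist_eq_norm] at h3
    have h4 := norm_sub_norm_le (u s x) (u t x)
    rw [norm_sub_rev] at h4
    linarith [hB x]
  obtain ⟨U, hU⟩ := isCompact_Icc.induction_on (p := fun V => ∃ U : ℝ, ∀ s ∈ V, ∀ x, ‖u s x‖ ≤ U)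
    ⟨0, by simp⟩ (fun V W h ⟨U, hU⟩ => ⟨U, fun s hs => hU s (h hs)⟩)
    (fun V W ⟨U, hU⟩ ⟨U', hU'⟩ => ⟨max U U', fun s hs x => hs.elim
      (fun h => (hU s h x).trans (le_max_left _ _)) fun h => (hU' s h x).trans (le_max_right _ _)⟩)
    hloc
  exact ⟨max U 0, le_max_right _ _, fun t ht x => (hU t ht x).trans (le_max_left _ _)⟩

/-- The pressure is smooth, since its gradient is given by the momentum equation. -/
theorem contDiff_pressure {t : ℝ} (ht : 0 < t) : ContDiff ℝ ∞ (pressure (u t)) := by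
  have ha := hu.contDiff₁ ht
  have hb := hu.contDiff₂ ht
  have hp := hu.pressure_differentiable t ht
  have hta : ContDiff ℝ ∞ (dt (fun t => comp₁ (u t)) t) :=
    (hu.smoothOn₁.dt isOpen_Ioi).slice isOpen_Ioi ht
  have htb : ContDiff ℝ ∞ (dt (fun t => comp₂ (u t)) t) :=
    (hu.smoothOn₂.dt isOpen_Ioi).slice isOpen_Ioi ht
  have e1 : d₁ (pressure (u t)) = fun x => lap (comp₁ (u t)) x - (dt (fun t => comp₁ (u t)) t x +
      (comp₁ (u t) x * d₁ (comp₁ (u t)) x + comp₂ (u t) x * d₂ (comp₁ (u t)) x)) := by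
    funext y; have := hu.momentum₁ t ht y
    simp only [dt, comp₁, comp₂] at *; linarith
  have e2 : d₂ (pressure (u t)) = fun x => lap (comp₂ (u t)) x - (dt (fun t => comp₂ (u t)) t x +
      (comp₁ (u t) x * d₁ (comp₂ (u t)) x + comp₂ (u t) x * d₂ (comp₂ (u t)) x)) := by
    funext y; have := hu.momentum₂ t ht y
    simp only [dt, comp₁, comp₂] at *; linarith
  have s1 : ContDiff ℝ ∞ (d₁ (pressure (u t))) := by
    rw [e1]
    exact ((contDiff_d₁ (contDiff_d₁ ha)).add (contDiff_d₂ (contDiff_d₂ ha))).sub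
      (hta.add ((ha.mul (contDiff_d₁ ha)).add (hb.mul (contDiff_d₂ ha))))
  have s2 : ContDiff ℝ ∞ (d₂ (pressure (u t))) := by
    rw [e2]
    exact ((contDiff_d₁ (contDiff_d₁ hb)).add (contDiff_d₂ (contDiff_d₂ hb))).sub
      (htb.add ((ha.mul (contDiff_d₁ hb)).add (hb.mul (contDiff_d₂ hb))))
  have hfd : fderiv ℝ (pressure (u t)) = fun x =>
      d₁ (pressure (u t)) x • ContinuousLinearMap.fst ℝ ℝ ℝ +
        d₂ (pressure (u t)) x • ContinuousLinearMap.snd ℝ ℝ ℝ := by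
    funext y
    ext
    · simp [d₁_eq (hp y)]
    · simp [d₂_eq (hp y)]
  rw [contDiff_infty_iff_fderiv]
  refine ⟨hp, ?_⟩
  rw [hfd]
  exact (s1.smul contDiff_const).add (s2.smul contDiff_const)

/-- Taking the curl removes the pressure, by symmetry of its second derivatives. The only
zeroth-order term left over is `ω div u`, which vanishes. -/
theorem vorticity_equation {t : ℝ} (ht : 0 < t) (x : ℝ × ℝ) :
    dt (fun t => vort (u t)) t x = lap (vort (u t)) x -
      (comp₁ (u t) x * d₁ (vort (u t)) x + comp₂ (u t) x * d₂ (vort (u t)) x) := by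
  have hcurl : d₁ (d₂ (pressure (u t))) x = d₂ (d₁ (pressure (u t))) x :=
    d₁_d₂_comm ((hu.contDiff_pressure ht).of_le (WithTop.coe_le_coe.2 le_top))
  have hdt₀ : dt (fun t => vort (u t)) t x =
      d₁ (dt (fun t => comp₂ (u t)) t) x - d₂ (dt (fun t => comp₁ (u t)) t) x := by
    rw [← SmoothOn.dt_d₁_comm isOpen_Ioi hu.smoothOn₂ ht,
      ← SmoothOn.dt_d₂_comm isOpen_Ioi hu.smoothOn₁ ht]
    exact (((hu.smoothOn₂.d₁ isOpen_Ioi).hasDerivAt_dt isOpen_Ioi ht).sub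
      ((hu.smoothOn₁.d₂ isOpen_Ioi).hasDerivAt_dt isOpen_Ioi ht)).deriv
  rw [hdt₀]
  have hdiv := hu.divFree t ht x
  have e1 : d₁ (pressure (u t)) = fun x => lap (comp₁ (u t)) x - (dt (fun t => comp₁ (u t)) t x +
      (comp₁ (u t) x * d₁ (comp₁ (u t)) x + comp₂ (u t) x * d₂ (comp₁ (u t)) x)) := by
    funext y; have := hu.momentum₁ t ht y
    simp only [dt, comp₁, comp₂] at *; linarith
  have e2 : d₂ (pressure (u t)) = fun x => lap (comp₂ (u t)) x - (dt (fun t => comp₂ (u t)) t x +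
      (comp₁ (u t) x * d₁ (comp₂ (u t)) x + comp₂ (u t) x * d₂ (comp₂ (u t)) x)) := by
    funext y; have := hu.momentum₂ t ht y
    simp only [dt, comp₁, comp₂] at *; linarith
  rw [e1, e2] at hcurl
  have hta : ContDiff ℝ ∞ (dt (fun t => comp₁ (u t)) t) :=
    (hu.smoothOn₁.dt isOpen_Ioi).slice isOpen_Ioi ht
  have htb : ContDiff ℝ ∞ (dt (fun t => comp₂ (u t)) t) :=
    (hu.smoothOn₂.dt isOpen_Ioi).slice isOpen_Ioi ht
  have ha := hu.contDiff₁ ht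
  have hb := hu.contDiff₂ ht
  generalize dt (fun t => comp₁ (u t)) t = ta at *
  generalize dt (fun t => comp₂ (u t)) t = tb at *
  have hvort : vort (u t) = fun y => d₁ (comp₂ (u t)) y - d₂ (comp₁ (u t)) y := rfl
  rw [hvort]
  generalize comp₁ (u t) = a at *
  generalize comp₂ (u t) = b at *
  have D {h : ℝ × ℝ → ℝ} (hh : ContDiff ℝ ∞ h) : DifferentiableAt ℝ h x :=
    smooth_differentiable hh x
  have a1 := contDiff_d₁ ha
  have a2 := contDiff_d₂ ha
  have b1 := contDiff_d₁ hb
  have b2 := contDiff_d₂ hb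
  have comm {h : ℝ × ℝ → ℝ} (hh : ContDiff ℝ ∞ h) : d₂ (d₁ h) = d₁ (d₂ h) :=
    funext fun y => (d₁_d₂_comm (hh.of_le (WithTop.coe_le_coe.2 le_top))).symm
  have la : ContDiff ℝ ∞ (lap a) := (contDiff_d₁ a1).add (contDiff_d₂ a2)
  have lb : ContDiff ℝ ∞ (lap b) := (contDiff_d₁ b1).add (contDiff_d₂ b2)
  rw [d₁_sub (D lb) (D (htb.add ((ha.mul b1).add (hb.mul b2)))),
    d₂_sub (D la) (D (hta.add ((ha.mul a1).add (hb.mul a2)))),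
    d₁_add (D htb) (D ((ha.mul b1).add (hb.mul b2))),
    d₂_add (D hta) (D ((ha.mul a1).add (hb.mul a2))),
    d₁_add (D (ha.mul b1)) (D (hb.mul b2)), d₂_add (D (ha.mul a1)) (D (hb.mul a2)),
    d₁_mul (D ha) (D b1), d₁_mul (D hb) (D b2), d₂_mul (D ha) (D a1), d₂_mul (D hb) (D a2)] at hcurl
  have l1 : d₁ (lap b) x = d₁ (d₁ (d₁ b)) x + d₁ (d₂ (d₂ b)) x :=
    d₁_add (D (contDiff_d₁ b1)) (D (contDiff_d₂ b2))
  have l2 : d₂ (lap a) x = d₂ (d₁ (d₁ a)) x + d₂ (d₂ (d₂ a)) x :=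
    d₂_add (D (contDiff_d₁ a1)) (D (contDiff_d₂ a2))
  rw [l1, l2] at hcurl
  have f1 : d₁ (fun y => d₁ b y - d₂ a y) = fun y => d₁ (d₁ b) y - d₁ (d₂ a) y :=
    funext fun y => d₁_sub (smooth_differentiable b1 y) (smooth_differentiable a2 y)
  have f2 : d₂ (fun y => d₁ b y - d₂ a y) = fun y => d₂ (d₁ b) y - d₂ (d₂ a) y :=
    funext fun y => d₂_sub (smooth_differentiable b1 y) (smooth_differentiable a2 y)
  unfold lap
  rw [f1, f2, d₁_sub (D (contDiff_d₁ b1)) (D (contDiff_d₁ a2)),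
    d₂_sub (D (contDiff_d₂ b1)) (D (contDiff_d₂ a2))]
  simp only [comm hb, comm ha, comm a1, comm b2] at hcurl ⊢
  linear_combination -hcurl - (d₁ b x - d₂ a x) * hdiv

/-- In divergence form the flux `uω` contains no derivative of the vorticity, as Duhamel's
inequality requires. -/
theorem vorticity_equation_div {t : ℝ} (ht : 0 < t) (x : ℝ × ℝ) :
    dt (fun t => vort (u t)) t x = lap (vort (u t)) x -
      d₁ (fun y => comp₁ (u t) y * vort (u t) y) x -
      d₂ (fun y => comp₂ (u t) y * vort (u t) y) x := by
  have hw := hu.smoothOn_vort.differentiable isOpen_Ioi ht x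
  rw [hu.vorticity_equation ht, d₁_mul (smooth_differentiable (hu.contDiff₁ ht) x) hw,
    d₂_mul (smooth_differentiable (hu.contDiff₂ ht) x) hw]
  linear_combination vort (u t) x * hu.divFree t ht x

end IsNSSolution

/-! ### The parabolic maximum principle. -/

/-- The second derivative is nonpositive at a local maximum. -/
theorem deriv_deriv_nonpos_of_isLocalMax {f : ℝ → ℝ} {a : ℝ} (h : IsLocalMax f a)
    (hc : ContinuousAt f a) : deriv (deriv f) a ≤ 0 := by
  by_contra! hpos
  -- A point that is both a local maximum and a local minimum has `f` constant nearby, so the second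
  -- derivative would be zero.
  have hmin := isLocalMin_of_deriv_deriv_pos hpos h.deriv_eq_zero hc
  have heq : f =ᶠ[𝓝 a] fun _ => f a := by
    filter_upwards [h, hmin] with x h1 h2 using le_antisymm h1 h2
  have h2 : deriv f =ᶠ[𝓝 a] fun _ => 0 := by
    filter_upwards [heq.eventually_nhds] with x hx
    rw [EventuallyEq.deriv_eq hx]; simp
  rw [h2.deriv_eq] at hpos
  simp at hpos

/-- The parabolic maximum principle for bounded solutions on the cylinder. -/
theorem max_principle {f a₁ a₂ : ℝ → ℝ × ℝ → ℝ} (hf : SmoothOn (Ioi 0) f)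
    (heq : ∀ t, 0 < t → ∀ x, dt f t x = lap (f t) x - (a₁ t x * d₁ (f t) x + a₂ t x * d₂ (f t) x))
    {s T U B m : ℝ} (hs : 0 < s) (ha : ∀ t ∈ Icc s T, ∀ x, |a₁ t x| ≤ U)
    (hper : ∀ t ∈ Icc s T, ∀ x₁ x₂, f t (x₁, x₂ + 1) = f t (x₁, x₂))
    (hB : ∀ t ∈ Icc s T, ∀ x, f t x ≤ B) (hm : ∀ x, f s x ≤ m) {t : ℝ} (ht : t ∈ Icc s T)
    (x : ℝ × ℝ) : f t x ≤ m := by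
  have hU : 0 ≤ U := (abs_nonneg _).trans (ha t ht x)
  -- The penalty is a strict supersolution: on `1 + x₁²` the Laplacian gives `2` and the drift at
  -- most `U(1 + x₁²)`, both beaten by the rate `3 + 2U`. Its growth in `x₁` forces the maximum of
  -- `Z` to be attained.
  have key : ∀ η > 0, f t x ≤ m + η * (Real.exp ((3 + 2 * U) * t) * (1 + x.1 ^ 2)) := by
    intro η hη
    by_contra! hlt
    set Z : ℝ × (ℝ × ℝ) → ℝ := fun z =>
      f z.1 z.2 - m - η * (Real.exp ((3 + 2 * U) * z.1) * (1 + z.2.1 ^ 2)) with hZ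
    obtain ⟨q, hq⟩ : ∃ q, q = |B - m| / η := ⟨_, rfl⟩
    -- Beyond `R` the penalty exceeds `B - m`, so `Z < 0` there; the point `x` itself stays inside.
    set R : ℝ := max q |x.1| + 1 with hR
    have hR1 : 1 ≤ R := by
      have := (abs_nonneg x.1).trans (le_max_right q |x.1|); linarith
    have hZneg : ∀ z : ℝ × (ℝ × ℝ), z.1 ∈ Icc s T → R ≤ |z.2.1| → Z z < 0 := by
      intro z hz hzR
      have h1 : |B - m| < η * R := by
        have : |B - m| / η < R := by
          rw [← hq]; exact (le_max_left _ _).trans_lt (by rw [hR]; linarith)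
        rw [div_lt_iff₀ hη] at this; linarith
      have h2 : R ≤ 1 + z.2.1 ^ 2 := by
        rw [← sq_abs]; nlinarith
      have h3 : 1 ≤ Real.exp ((3 + 2 * U) * z.1) :=
        Real.one_le_exp (mul_nonneg (by linarith) (hs.le.trans hz.1))
      have h4 : η * R ≤ η * (Real.exp ((3 + 2 * U) * z.1) * (1 + z.2.1 ^ 2)) := by
        gcongr; nlinarith
      have h5 := hB z.1 hz z.2
      have h6 := le_abs_self (B - m)
      simp only [hZ]; linarith
    set K : Set (ℝ × (ℝ × ℝ)) := Icc s T ×ˢ (Icc (-R) R ×ˢ Icc 0 1) with hK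
    have hKc : IsCompact K := isCompact_Icc.prod (isCompact_Icc.prod isCompact_Icc)
    have hZc : ContinuousOn Z (Ioi 0 ×ˢ univ) := by
      refine (hf.continuousOn.sub continuousOn_const).sub ?_
      exact Continuous.continuousOn (by fun_prop)
    have hKsub : K ⊆ Ioi 0 ×ˢ univ := fun z hz => ⟨hs.trans_le hz.1.1, mem_univ _⟩
    have hperZ : ∀ τ ∈ Icc s T, ∀ y₁ y₂ : ℝ, f τ (y₁, Int.fract y₂) = f τ (y₁, y₂) := by
      intro τ hτ y₁ y₂
      have hp : Function.Periodic (fun y => f τ (y₁, y)) 1 := fun y => hper τ hτ y₁ y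
      have := hp.sub_int_mul_eq ⌊y₂⌋ (x := y₂)
      rw [← Int.self_sub_floor]
      simpa using this
    have hxK : (t, (x.1, Int.fract x.2)) ∈ K := by
      have : |x.1| ≤ R := by
        have := le_max_right q |x.1|; linarith
      exact ⟨ht, abs_le.1 this, Int.fract_nonneg _, (Int.fract_lt_one _).le⟩
    obtain ⟨z₀, hz₀, hmax⟩ := hKc.exists_isMaxOn ⟨_, hxK⟩ (hZc.mono hKsub)
    have hpos : 0 < Z z₀ := by
      have h1 := hmax hxK
      have h2 : Z (t, (x.1, Int.fract x.2)) = Z (t, x) := by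
        simp only [hZ, hperZ t ht]
      have h3 : 0 < Z (t, x) := by simp only [hZ]; linarith
      exact h3.trans_le (h2 ▸ h1)
    obtain ⟨τ, y⟩ := z₀
    obtain ⟨hτ, -, hy2⟩ := hz₀
    simp only at hτ hy2
    -- Negativity for large `|x₁|` and periodicity in `x₂` make the maximum over the compact box
    -- global in space.
    have hglob : ∀ r ∈ Icc s T, ∀ w, Z (r, w) ≤ Z (τ, y) := by
      intro r hr w
      by_cases hw : R ≤ |w.1|
      · exact (hZneg (r, w) hr hw).le.trans hpos.le
      · have hmem : (r, (w.1, Int.fract w.2)) ∈ K :=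
          ⟨hr, abs_le.1 (not_le.1 hw).le, Int.fract_nonneg _, (Int.fract_lt_one _).le⟩
        have h2 : Z (r, (w.1, Int.fract w.2)) = Z (r, w) := by
          simp only [hZ, hperZ r hr]
        exact h2 ▸ hmax hmem
    have hτ0 : 0 < τ := hs.trans_le hτ.1
    have hsτ : s < τ := by
      rcases hτ.1.lt_or_eq with h | h
      · exact h
      · exfalso
        have h1 : 0 < η * (Real.exp ((3 + 2 * U) * τ) * (1 + y.1 ^ 2)) := by positivity
        have h2 := hm y
        rw [h] at h2
        simp only [hZ] at hpos; linarith
    have hft := hf.hasDerivAt_dt isOpen_Ioi hτ0 (x := y)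
    have hsl := hf.slice isOpen_Ioi hτ0
    set E : ℝ := Real.exp ((3 + 2 * U) * τ) with hE
    have hE0 : 0 < E := Real.exp_pos _
    -- The maximum may occur at the final time `T`, so only earlier times are compared.
    have htime : 0 ≤ dt f τ y - η * (E * (3 + 2 * U) * (1 + y.1 ^ 2)) := by
      have hd : HasDerivAt (fun r => Z (r, y))
          (dt f τ y - η * (E * (3 + 2 * U) * (1 + y.1 ^ 2))) τ := by
        have he : HasDerivAt (fun r => Real.exp ((3 + 2 * U) * r)) (E * (3 + 2 * U)) τ := by
          simpa using ((hasDerivAt_id τ).const_mul (3 + 2 * U)).exp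
        exact (hft.sub_const m).sub ((he.mul_const (1 + y.1 ^ 2)).const_mul η)
      by_contra! hneg
      have hev : ∀ᶠ r in 𝓝[<] τ, Z (τ, y) < Z (r, y) := by
        have hslope := hd.tendsto_slope.mono_left (nhdsLT_le_nhdsNE τ)
        filter_upwards [hslope.eventually (gt_mem_nhds hneg), self_mem_nhdsWithin] with r hr hrτ
        rw [slope_def_field, div_neg_iff] at hr
        have : r - τ < 0 := sub_neg.2 hrτ
        rcases hr with h | h
        · linarith [h.1]
        · linarith [h.2]
      have hev2 : ∀ᶠ r in 𝓝[<] τ, r ∈ Ioo s τ := Ioo_mem_nhdsLT hsτ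
      obtain ⟨r, h1, h2⟩ := (hev.and hev2).exists
      exact absurd (hglob r ⟨h2.1.le, h2.2.le.trans hτ.2⟩ y) (not_le.2 h1)
    have hD1 : ∀ r : ℝ, HasDerivAt (fun r => Z (τ, (r, y.2)))
        (d₁ (f τ) (r, y.2) - η * (E * (2 * r))) r := by
      intro r
      have h0 := hasDerivAt_d₁ (smooth_differentiable hsl (r, y.2))
      rw [← d₁_eq (smooth_differentiable hsl (r, y.2))] at h0
      have h1 : HasDerivAt (fun r : ℝ => 1 + r ^ 2) (2 * r) r := by
        simpa using (hasDerivAt_pow 2 r).const_add 1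
      exact (h0.sub_const m).sub ((h1.const_mul E).const_mul η)
    have hD2 : ∀ r : ℝ, HasDerivAt (fun r => Z (τ, (y.1, r))) (d₂ (f τ) (y.1, r)) r := by
      intro r
      have h0 := hasDerivAt_d₂ (smooth_differentiable hsl (y.1, r))
      rw [← d₂_eq (smooth_differentiable hsl (y.1, r))] at h0
      exact (h0.sub_const m).sub_const (η * (E * (1 + y.1 ^ 2)))
    have hm1 : IsLocalMax (fun r => Z (τ, (r, y.2))) y.1 :=
      Eventually.of_forall fun r => hglob τ hτ (r, y.2)
    have hm2 : IsLocalMax (fun r => Z (τ, (y.1, r))) y.2 :=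
      Eventually.of_forall fun r => hglob τ hτ (y.1, r)
    have g1 : d₁ (f τ) y = η * (E * (2 * y.1)) := by
      have := hm1.hasDerivAt_eq_zero (hD1 y.1); linarith
    have g2 : d₂ (f τ) y = 0 := hm2.hasDerivAt_eq_zero (hD2 y.2)
    have k1 : d₁ (d₁ (f τ)) y ≤ 2 * (η * E) := by
      have h1 := deriv_deriv_nonpos_of_isLocalMax hm1 (hD1 y.1).continuousAt
      have h2 : deriv (fun r => Z (τ, (r, y.2))) =
          fun r => d₁ (f τ) (r, y.2) - η * (E * (2 * r)) := funext fun r => (hD1 r).deriv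
      rw [h2] at h1
      have h3 := hasDerivAt_d₁ (smooth_differentiable (contDiff_d₁ hsl) y)
      rw [← d₁_eq (smooth_differentiable (contDiff_d₁ hsl) y)] at h3
      have h4 := h3.sub ((((hasDerivAt_id y.1).const_mul 2).const_mul E).const_mul η)
      have h5 : deriv (fun r => d₁ (f τ) (r, y.2) - η * (E * (2 * r))) y.1 =
        d₁ (d₁ (f τ)) y - η * (E * (2 * 1)) := h4.deriv
      rw [h5] at h1; linarith
    have k2 : d₂ (d₂ (f τ)) y ≤ 0 := by
      have h1 := deriv_deriv_nonpos_of_isLocalMax hm2 (hD2 y.2).continuousAt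
      have h2 : deriv (fun r => Z (τ, (y.1, r))) = fun r => d₂ (f τ) (y.1, r) :=
        funext fun r => (hD2 r).deriv
      rw [h2] at h1
      exact h1
    have hh := heq τ hτ0 y
    rw [g1, g2, mul_zero, add_zero] at hh
    unfold lap at hh
    have hc := abs_le.1 (ha τ hτ y)
    have hc2 : -(a₁ τ y * (2 * y.1)) ≤ U * (1 + y.1 ^ 2) := by
      have h1 : |a₁ τ y * (2 * y.1)| ≤ U * (1 + y.1 ^ 2) := by
        rw [abs_mul]
        refine mul_le_mul (ha τ hτ y) ?_ (abs_nonneg _) hU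
        rw [abs_le]; constructor <;> nlinarith [sq_nonneg (y.1 - 1), sq_nonneg (y.1 + 1)]
      linarith [neg_abs_le (a₁ τ y * (2 * y.1))]
    have hηE : 0 < η * E := mul_pos hη hE0
    have h9 := mul_le_mul_of_nonneg_left hc2 hηE.le
    have h10 : 0 ≤ η * E * y.1 ^ 2 := by positivity
    have h11 : 0 ≤ η * E * (U * (1 + y.1 ^ 2)) := by positivity
    nlinarith
  refine le_of_forall_pos_le_add fun ε hε => ?_
  have hpos : 0 < Real.exp ((3 + 2 * U) * t) * (1 + x.1 ^ 2) := by positivity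
  have := key (ε / (Real.exp ((3 + 2 * U) * t) * (1 + x.1 ^ 2))) (by positivity)
  rwa [div_mul_cancel₀ _ hpos.ne'] at this

/-! ### Bounds for the vorticity, up to the initial time. -/

theorem hasDerivAt_sqrt_sub {t τ : ℝ} (h : τ < t) :
    HasDerivAt (fun τ => -(2 * √(t - τ))) (√(t - τ))⁻¹ τ := by
  have h1 := (((hasDerivAt_id τ).const_sub t).sqrt (sub_pos.2 h).ne').const_mul 2
  refine h1.neg.congr_deriv ?_
  have : 0 < √(t - τ) := Real.sqrt_pos.2 (sub_pos.2 h)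
  simp only [id]; field_simp

theorem hasDerivAt_two_sqrt {τ : ℝ} (h : 0 < τ) :
    HasDerivAt (fun τ => 2 * √τ) (√τ)⁻¹ τ := by
  have h1 := ((hasDerivAt_id τ).sqrt h.ne').const_mul 2
  refine h1.congr_deriv ?_
  have : 0 < √τ := Real.sqrt_pos.2 h
  simp only [id]; field_simp

namespace IsNSSolution

variable {u : ℝ → ℝ × ℝ → ℝ × ℝ} (hu : IsNSSolution u)
include hu

theorem smoothOn_vort_flux₁ : SmoothOn (Ioi 0) fun t y => comp₁ (u t) y * vort (u t) y :=
  hu.smoothOn₁.mul hu.smoothOn_vort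

theorem smoothOn_vort_flux₂ : SmoothOn (Ioi 0) fun t y => comp₂ (u t) y * vort (u t) y :=
  hu.smoothOn₂.mul hu.smoothOn_vort

theorem abs_integral_locKernel_vort_le {U ρ s t : ℝ} {x : ℝ × ℝ} (hs : 0 < s) (hst : s < t)
    (hU : ∀ y, ‖u s y‖ ≤ U) (hρ : 0 < ρ) :
    |∫ y, locKernel ρ t x s y * vort (u s) y| ≤ U * (2 * (√(t - s))⁻¹ + 2 * bumpC / ρ) := by
  have h := integral_mul_curl (hu.contDiff₁ hs) (hu.contDiff₂ hs) (contDiff_locKernel hst x)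
    (hasCompactSupport_locKernel hρ)
  have h2 := abs_integral_mul_d_locKernel_le (x := x) (b := U) (g₁ := fun y => -comp₂ (u s) y)
    (g₂ := comp₁ (u s)) hρ hst (fun y => by rw [abs_neg]; exact (norm_snd_le _).trans (hU y))
    (fun y => (norm_fst_le _).trans (hU y))
  unfold vort
  rw [h]
  convert h2 using 4
  ring

/-- Duhamel's inequality over a time window of length `r²`. The starting term uses only the
velocity; the terms containing the local bound `A` carry a power of `r`, which will make them
absorbable. -/
theorem abs_vort_le_of_local_bound {U T A d₀ r t₀ : ℝ} {x₀ : ℝ × ℝ}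
    (hU : ∀ t ∈ Icc 0 T, ∀ x, ‖u t x‖ ≤ U) (ht₀ : t₀ ≤ T) (h0 : 0 < d₀) (hr0 : 0 < r)
    (hs0 : 0 < t₀ - r ^ 2)
    (hbd : ∀ τ ∈ Ioo (t₀ - r ^ 2) t₀, ∀ y ∈ tsupport (cut (d₀ / 4) x₀), |vort (u τ) y| ≤ A) :
    |vort (u t₀) x₀| ≤ U * (2 * r⁻¹ + 8 * bumpC / d₀) +
      (2 * (A * (16 * bumpC / d₀ + 2 * U)) * r +
        A * (32 * bumpC / d₀ ^ 2 + 8 * bumpC * U / d₀) * r ^ 2) := by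
  have hst : t₀ - r ^ 2 < t₀ := by linarith [pow_pos hr0 2]
  have hsr : √(t₀ - (t₀ - r ^ 2)) = r := by rw [sub_sub_cancel, Real.sqrt_sq hr0.le]
  have hρ0 : 0 < d₀ / 4 := by positivity
  have hU0 : 0 ≤ U := (norm_nonneg _).trans (hU _ ⟨hs0.le, hst.le.trans ht₀⟩ 0)
  have htT : ∀ τ ∈ Ioo (t₀ - r ^ 2) t₀, τ ∈ Icc 0 T := fun τ hτ =>
    ⟨(hs0.trans hτ.1).le, hτ.2.le.trans ht₀⟩
  set P : ℝ := A * (16 * bumpC / d₀ + 2 * U) with hP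
  set Q : ℝ := A * (32 * bumpC / d₀ ^ 2 + 8 * bumpC * U / d₀) with hQ
  have hrep := abs_le_of_heat_equation (x := x₀) (t := t₀) hu.smoothOn_vort
    hu.smoothOn_vort_flux₁ hu.smoothOn_vort_flux₂ (fun s hs y => hu.vorticity_equation_div hs y)
    hρ0 hs0 hst (a := fun _ => A) (b := fun _ => U * A)
    -- A primitive of `P (t₀-τ)^(-1/2) + Q`, whose increment over the window is `2Pr + Qr²`.
    (β := fun τ => P * -(2 * √(t₀ - τ)) + Q * τ)
    (β' := fun τ => P * (√(t₀ - τ))⁻¹ + Q * 1)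
    (Continuous.continuousOn (by fun_prop))
    (fun τ hτ => ((hasDerivAt_sqrt_sub hτ.2).const_mul P).add ((hasDerivAt_id τ).const_mul Q))
    hbd
    (fun τ hτ y hy => by
      rw [abs_mul]
      exact mul_le_mul ((norm_fst_le _).trans (hU τ (htT τ hτ) y)) (hbd τ hτ y hy)
        (abs_nonneg _) hU0)
    (fun τ hτ y hy => by
      rw [abs_mul]
      exact mul_le_mul ((norm_snd_le _).trans (hU τ (htT τ hτ) y)) (hbd τ hτ y hy)
        (abs_nonneg _) hU0)
    (fun τ hτ => by
      refine le_of_eq ?_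
      rw [hP, hQ]
      generalize (√(t₀ - τ))⁻¹ = q
      field_simp
      ring)
  have hI := hu.abs_integral_locKernel_vort_le (x := x₀) hs0 hst
    (hU _ ⟨hs0.le, hst.le.trans ht₀⟩) hρ0
  rw [hsr] at hI
  simp only [sub_self, Real.sqrt_zero, hsr] at hrep
  have e : 2 * bumpC / (d₀ / 4) = 8 * bumpC / d₀ := by field_simp; ring
  rw [e] at hI
  linarith

omit hu in
-- This is the previous bound with `A = 2W/d₀` and `r = d₀/(4N)`, multiplied by `d₀`. The number `N`
-- is chosen so that the terms in `W` on the right sum to at most `W/2`, which the left side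
-- absorbs.
theorem interior_scaling {U D N W d₀ w : ℝ} (hU0 : 0 ≤ U) (h0 : 0 < d₀) (hd : d₀ ≤ D)
    (hw : 0 ≤ w) (hN : N = 64 * bumpC + 4 * U * D + 8 * bumpC * U * D) (hN1 : 64 ≤ N)
    (hW : W = d₀ * w)
    (h : w ≤ U * (2 * ((4 * N)⁻¹ * d₀)⁻¹ + 8 * bumpC / d₀) +
      (2 * (2 * W / d₀ * (16 * bumpC / d₀ + 2 * U)) * ((4 * N)⁻¹ * d₀) +
        2 * W / d₀ * (32 * bumpC / d₀ ^ 2 + 8 * bumpC * U / d₀) * ((4 * N)⁻¹ * d₀) ^ 2)) :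
    W ≤ 2 * (U * (8 * N + 8 * bumpC)) := by
  have hc := one_le_bumpC
  have hN0 : 0 < N := by linarith
  obtain ⟨η, hη⟩ : ∃ η, η = (4 * N)⁻¹ := ⟨_, rfl⟩
  have hη0 : 0 < η := by rw [hη]; positivity
  have hηN : η * N = 1 / 4 := by rw [hη]; field_simp
  have hη1 : η ≤ 1 / 256 := by nlinarith
  have hηi : η⁻¹ = 4 * N := by rw [hη, inv_inv]
  rw [← hη] at h
  have hW0 : 0 ≤ W := hW ▸ mul_nonneg h0.le hw
  have hW1 : W ≤ U * (8 * N + 8 * bumpC) + 2 * W * (2 * η * (16 * bumpC + 2 * U * d₀) +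
      η ^ 2 * (32 * bumpC + 8 * bumpC * U * d₀)) := by
    have h2 := mul_le_mul_of_nonneg_left h h0.le
    rw [← hW] at h2
    refine h2.trans_eq ?_
    rw [mul_inv, hηi]
    field_simp
    ring
  have hD0 : 0 < D := h0.trans_le hd
  have hbr : 2 * η * (16 * bumpC + 2 * U * d₀) + η ^ 2 * (32 * bumpC + 8 * bumpC * U * d₀) ≤
      1 / 4 := by
    have g1 : U * d₀ ≤ U * D := by gcongr
    have g3 : η ^ 2 ≤ η := by nlinarith
    have h1 : 32 * bumpC + 8 * bumpC * U * d₀ ≤ 32 * bumpC + 8 * bumpC * U * D := by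
      gcongr
    have h2 : 2 * η * (16 * bumpC + 2 * U * d₀) ≤ 2 * η * (16 * bumpC + 2 * U * D) := by
      gcongr
    have h3 : η ^ 2 * (32 * bumpC + 8 * bumpC * U * d₀) ≤
        η * (32 * bumpC + 8 * bumpC * U * D) := mul_le_mul g3 h1 (by positivity) hη0.le
    calc _ ≤ 2 * η * (16 * bumpC + 2 * U * D) + η * (32 * bumpC + 8 * bumpC * U * D) :=
          add_le_add h2 h3
      _ = η * N := by rw [hN]; ring
      _ = 1 / 4 := hηN
  have hfin := mul_le_mul_of_nonneg_left hbr (by positivity : 0 ≤ 2 * W)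
  linarith

/-- Interior regularity: the vorticity is controlled by the velocity for positive times. -/
theorem exists_vort_le_inv_sqrt {T : ℝ} (hT : 0 < T) :
    ∃ C : ℝ, 0 ≤ C ∧ ∀ t ∈ Ioc 0 T, ∀ x, |vort (u t) x| ≤ C * (√t)⁻¹ := by
  obtain ⟨U, hU0, hU⟩ := hu.exists_bound T
  have hc := one_le_bumpC
  obtain ⟨D, hD⟩ : ∃ D, D = √T := ⟨_, rfl⟩
  have hD0 : 0 < D := hD ▸ Real.sqrt_pos.2 hT
  obtain ⟨N, hN⟩ : ∃ N, N = 64 * bumpC + 4 * U * D + 8 * bumpC * U * D := ⟨_, rfl⟩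
  have hN1 : 64 ≤ N := by
    have h1 : 0 ≤ 4 * U * D := by positivity
    have h2 : 0 ≤ 8 * bumpC * U * D := by positivity
    linarith
  obtain ⟨C₀, hC₀⟩ : ∃ C₀, C₀ = 2 * (U * (8 * N + 8 * bumpC)) := ⟨_, rfl⟩
  have hC₀0 : 0 ≤ C₀ := by rw [hC₀]; positivity
  refine ⟨C₀ * √2, by positivity, fun t₁ ht₁ x₁ => ?_⟩
  obtain ⟨s', hs'⟩ : ∃ s', s' = t₁ / 2 := ⟨_, rfl⟩
  have hs'0 : 0 < s' := by have := ht₁.1; rw [hs']; positivity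
  have hs't : s' < t₁ := by rw [hs']; linarith [ht₁.1]
  -- A parabolic distance to the bottom and the sides of the cylinder `[t₁/2, t₁] × (square of
  -- half-side D)`. The product `d |ω|` is maximized: the weight makes the estimate close without
  -- prior control at the boundary.
  obtain ⟨d, hd⟩ : ∃ d : ℝ × (ℝ × ℝ) → ℝ, d = fun z =>
    min √(z.1 - s') (min (D - |z.2.1 - x₁.1|) (D - |z.2.2 - x₁.2|)) := ⟨_, rfl⟩
  set K : Set (ℝ × (ℝ × ℝ)) :=
    Icc s' t₁ ×ˢ (Icc (x₁.1 - D) (x₁.1 + D) ×ˢ Icc (x₁.2 - D) (x₁.2 + D)) with hK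
  have hKc : IsCompact K := isCompact_Icc.prod (isCompact_Icc.prod isCompact_Icc)
  have hdc : Continuous d := by rw [hd]; fun_prop
  have hwc : ContinuousOn (fun z : ℝ × (ℝ × ℝ) => d z * |vort (u z.1) z.2|) K :=
    hdc.continuousOn.mul ((hu.smoothOn_vort.continuousOn.mono fun z hz =>
      ⟨hs'0.trans_le hz.1.1, mem_univ _⟩).abs)
  have hx₁K : (t₁, x₁) ∈ K :=
    ⟨⟨hs't.le, le_rfl⟩, ⟨by simp only; linarith, by simp only; linarith⟩,
      ⟨by simp only; linarith, by simp only; linarith⟩⟩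
  obtain ⟨⟨t₀, x₀⟩, hz₀, hmax⟩ := hKc.exists_isMaxOn ⟨_, hx₁K⟩ hwc
  obtain ⟨d₀, hd₀⟩ : ∃ d₀, d₀ = d (t₀, x₀) := ⟨_, rfl⟩
  obtain ⟨W, hW⟩ : ∃ W, W = d₀ * |vort (u t₀) x₀| := ⟨_, rfl⟩
  have hmax' : ∀ z ∈ K, d z * |vort (u z.1) z.2| ≤ W := fun z hz => by
    rw [hW, hd₀]; exact hmax hz
  have hWC : W ≤ C₀ := by
    rcases le_or_gt d₀ 0 with h0 | h0
    · exact hW ▸ (mul_nonpos_of_nonpos_of_nonneg h0 (abs_nonneg _)).trans hC₀0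
    have ht₀ : t₀ ∈ Icc s' t₁ := hz₀.1
    rw [hd] at hd₀
    have hd1 : d₀ ≤ √(t₀ - s') := hd₀.le.trans (min_le_left _ _)
    have hd2 : d₀ ≤ D - |x₀.1 - x₁.1| :=
      hd₀.le.trans ((min_le_right _ _).trans (min_le_left _ _))
    have hd3 : d₀ ≤ D - |x₀.2 - x₁.2| :=
      hd₀.le.trans ((min_le_right _ _).trans (min_le_right _ _))
    clear hd₀
    have hd4 : d₀ ≤ D := hd2.trans (by linarith [abs_nonneg (x₀.1 - x₁.1)])
    have hd5 : d₀ ^ 2 ≤ t₀ - s' := by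
      rw [← Real.sq_sqrt (sub_nonneg.2 ht₀.1)]; gcongr
    have hr0 : 0 < (4 * N)⁻¹ * d₀ := by positivity
    have hr1 : ((4 * N)⁻¹ * d₀) ^ 2 ≤ d₀ ^ 2 / 4 := by
      have h1 : (4 * N)⁻¹ ≤ 1 / 2 := by
        rw [inv_le_comm₀ (by positivity) (by norm_num)]; linarith
      have h2 : (4 * N)⁻¹ * d₀ ≤ 1 / 2 * d₀ := by gcongr
      calc _ ≤ (1 / 2 * d₀) ^ 2 := by gcongr
        _ = _ := by ring
    have hd6 : 0 < d₀ ^ 2 := by positivity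
    refine hC₀ ▸ interior_scaling hU0 h0 hd4 (abs_nonneg _) hN hN1 hW
      (hu.abs_vort_le_of_local_bound hU (ht₀.2.trans ht₁.2) h0 hr0 (by linarith) ?_)
    -- In the window around the maximum point `d` stays above `d₀/2`, so maximality of `W` gives
    -- `|ω| ≤ 2W/d₀` there.
    intro τ hτ y hy
    obtain ⟨hy1, hy2⟩ := tsupport_cut_subset (by positivity) hy
    have q1 : |y.1 - x₁.1| ≤ |x₀.1 - x₁.1| + d₀ / 2 := by
      have : |y.1 - x₀.1| ≤ d₀ / 2 := abs_le.2 ⟨by linarith [hy1.1], by linarith [hy1.2]⟩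
      have h1 := abs_sub_le y.1 x₀.1 x₁.1
      linarith
    have q2 : |y.2 - x₁.2| ≤ |x₀.2 - x₁.2| + d₀ / 2 := by
      have : |y.2 - x₀.2| ≤ d₀ / 2 := abs_le.2 ⟨by linarith [hy2.1], by linarith [hy2.2]⟩
      have h1 := abs_sub_le y.2 x₀.2 x₁.2
      linarith
    have q3 : (d₀ / 2) ^ 2 ≤ τ - s' := by
      have h1 := hτ.1
      have h2 : (d₀ / 2) ^ 2 = d₀ ^ 2 / 4 := by ring
      linarith
    have hdz : d₀ / 2 ≤ d (τ, y) := by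
      rw [hd]
      refine le_min ?_ (le_min (by simp only; linarith) (by simp only; linarith))
      exact Real.le_sqrt_of_sq_le q3
    have hmem : (τ, y) ∈ K := by
      have r1 := abs_le.1 (q1.trans (by linarith : _ ≤ D))
      have r2 := abs_le.1 (q2.trans (by linarith : _ ≤ D))
      have r3 := sq_nonneg (d₀ / 2)
      refine ⟨⟨?_, hτ.2.le.trans ht₀.2⟩, ⟨?_, ?_⟩, ?_, ?_⟩ <;> simp only <;> linarith
    have h2 : d₀ / 2 * |vort (u τ) y| ≤ W :=
      (mul_le_mul_of_nonneg_right hdz (abs_nonneg _)).trans (hmax' _ hmem)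
    rw [le_div_iff₀ h0]; linarith
  -- At the top centre `d` is at least `√(t₁/2)`, since `D = √T`; the factor `√2` of the constant
  -- comes from here.
  have hdt : √(t₁ - s') ≤ d (t₁, x₁) := by
    rw [hd]
    refine le_min le_rfl (le_min ?_ ?_) <;>
    · simp only [sub_self, abs_zero, sub_zero, hD]
      exact Real.sqrt_le_sqrt (by linarith [ht₁.2])
  have h1 := (mul_le_mul_of_nonneg_right hdt (abs_nonneg (vort (u t₁) x₁))).trans
    ((hmax' _ hx₁K).trans hWC)
  have h2 : √(t₁ - s') * √2 = √t₁ := by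
    rw [← Real.sqrt_mul (by linarith)]; congr 1; rw [hs']; ring
  have h3 : 0 < √t₁ := Real.sqrt_pos.2 ht₁.1
  rw [← div_eq_mul_inv, le_div_iff₀ h3, ← h2]
  calc _ = √(t₁ - s') * |vort (u t₁) x₁| * √2 := by ring
    _ ≤ _ := by gcongr

/-- Split `u s = u 0 + (u s - u 0)`. The first part pairs with `ω₀` in the weak sense, against a
kernel of mass at most `1`; the second is at most `δ` and meets the gradient of the kernel. -/
theorem abs_integral_locKernel_vort_le_initial {ω₀ : ℝ × ℝ → ℝ}
    (hω : MemLp ω₀ ⊤ volume) (hweak : IsWeakVort (u 0) ω₀) {s t δ : ℝ} {x : ℝ × ℝ} (hs : 0 < s)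
    (hst : s < t) (hδ : ∀ y, ‖u s y - u 0 y‖ ≤ δ) :
    |∫ y, locKernel 1 t x s y * vort (u s) y| ≤
      (eLpNorm ω₀ ⊤ volume).toReal + δ * (2 * (√(t - s))⁻¹ + 2 * bumpC) := by
  have hΦ := contDiff_locKernel (ρ := 1) hst x
  have hΦc := hasCompactSupport_locKernel (t := t) (x := x) (τ := s) one_pos
  have h := integral_mul_curl (hu.contDiff₁ hs) (hu.contDiff₂ hs) hΦ hΦc
  have h2 := abs_integral_mul_d_locKernel_le (x := x) (b := δ)
    (g₁ := fun y => -(u s y - u 0 y).2) (g₂ := fun y => (u s y - u 0 y).1) one_pos hst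
    (fun y => by rw [abs_neg]; exact (norm_snd_le _).trans (hδ y))
    (fun y => (norm_fst_le _).trans (hδ y))
  rw [div_one] at h2
  have h3 := hweak _ hΦ hΦc
  have hM : ∀ᵐ y, ‖ω₀ y‖ ≤ (eLpNorm ω₀ ⊤ volume).toReal := by
    filter_upwards [enorm_ae_le_eLpNormEssSup ω₀ volume] with y hy
    rw [← eLpNorm_exponent_top] at hy
    rw [← toReal_enorm]
    exact ENNReal.toReal_mono hω.2.ne hy
  have h4 : |∫ y, ω₀ y * locKernel 1 t x s y| ≤ (eLpNorm ω₀ ⊤ volume).toReal := by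
    have := norm_integral_le_of_norm_le (f := fun y => ω₀ y * locKernel 1 t x s y)
      (g := fun y => (eLpNorm ω₀ ⊤ volume).toReal * kernel t x s y)
      ((integrable_kernel hst x).const_mul _) (by
        filter_upwards [hM] with y hy
        rw [norm_mul]
        exact mul_le_mul hy (abs_locKernel_le hst) (norm_nonneg _) ENNReal.toReal_nonneg)
    rwa [integral_const_mul, integral_kernel hst, mul_one] at this
  rw [h3] at h4
  have c0 : Continuous (u 0) := (hu.buc 0 le_rfl).uniformContinuous.continuous
  have cs : Continuous (u s) := (hu.buc s hs.le).uniformContinuous.continuous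
  have k1 := (contDiff_d₁ hΦ).continuous
  have k2 := (contDiff_d₂ hΦ).continuous
  have s1 := HasCompactSupport.d₁ hΦc
  have s2 := HasCompactSupport.d₂ hΦc
  have i0 : Integrable fun y => (u 0 y).1 * d₂ (locKernel 1 t x s) y -
      (u 0 y).2 * d₁ (locKernel 1 t x s) y :=
    (by fun_prop : Continuous fun y => (u 0 y).1 * d₂ (locKernel 1 t x s) y -
      (u 0 y).2 * d₁ (locKernel 1 t x s) y).integrable_of_hasCompactSupport
      (s2.mul_left.sub s1.mul_left)
  have i1 : Integrable fun y => -(u s y - u 0 y).2 * d₁ (locKernel 1 t x s) y +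
      (u s y - u 0 y).1 * d₂ (locKernel 1 t x s) y :=
    (by fun_prop : Continuous fun y => -(u s y - u 0 y).2 * d₁ (locKernel 1 t x s) y +
      (u s y - u 0 y).1 * d₂ (locKernel 1 t x s) y).integrable_of_hasCompactSupport
      (s1.mul_left.add s2.mul_left)
  have e : ∫ y, locKernel 1 t x s y * vort (u s) y =
      (∫ y, ((u 0 y).1 * d₂ (locKernel 1 t x s) y - (u 0 y).2 * d₁ (locKernel 1 t x s) y)) +
      ∫ y, (-(u s y - u 0 y).2 * d₁ (locKernel 1 t x s) y +
        (u s y - u 0 y).1 * d₂ (locKernel 1 t x s) y) := by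
    rw [← integral_add i0 i1]
    unfold vort
    rw [h]
    congr 1; funext y
    simp only [comp₁, comp₂, Prod.fst_sub, Prod.snd_sub]; ring
  rw [e]
  exact (abs_add_le _ _).trans (add_le_add h4 h2)

theorem exists_initial_gap {δ : ℝ} (hδ : 0 < δ) :
    ∃ s₀ > 0, ∀ s, 0 < s → s < s₀ → ∀ y, ‖u s y - u 0 y‖ ≤ δ := by
  have h1 := Metric.tendstoUniformly_iff.mp (hu.continuous_buc 0 le_rfl) δ hδ
  obtain ⟨r, hr, hsub⟩ := Metric.mem_nhdsWithin_iff.mp h1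
  refine ⟨r, hr, fun s hs hsr y => ?_⟩
  have : s ∈ Metric.ball (0 : ℝ) r ∩ Ici 0 := ⟨by simpa [abs_of_pos hs] using hsr, hs.le⟩
  have h2 := hsub this y
  rw [dist_comm, dist_eq_norm] at h2
  exact h2.le

/-- Duhamel's principle from the initial time, as an inequality for the vorticity. -/
theorem abs_vort_le_initial {ω₀ : ℝ × ℝ → ℝ} (hω : MemLp ω₀ ⊤ volume)
    (hweak : IsWeakVort (u 0) ω₀) {U t : ℝ} (hU : ∀ s ∈ Icc 0 1, ∀ y, ‖u s y‖ ≤ U)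
    (ht : 0 < t) (ht1 : t ≤ 1) {a β β' : ℝ → ℝ} (hβc : Continuous β)
    (hβ : ∀ τ ∈ Ioo 0 t, HasDerivAt β (β' τ) τ)
    (ha : ∀ τ ∈ Ioo 0 t, ∀ y, |vort (u τ) y| ≤ a τ)
    (hab : ∀ τ ∈ Ioo 0 t, (6 * bumpC + 2 * U + 2 * bumpC * U) * a τ * (√(t - τ))⁻¹ ≤ β' τ)
    (x : ℝ × ℝ) : |vort (u t) x| ≤ (eLpNorm ω₀ ⊤ volume).toReal + (β t - β 0) := by
  have hc := one_le_bumpC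
  have hU0 : 0 ≤ U := (norm_nonneg _).trans (hU 0 ⟨le_rfl, zero_le_one⟩ 0)
  -- The order of limits matters: `s → 0` with `δ` fixed, where `(t-s)^(-1/2)` stays bounded, and
  -- only then `δ → 0`.
  have main : ∀ δ > 0, ∃ s₀ > 0, ∀ s, 0 < s → s < s₀ → s < t →
      |vort (u t) x| ≤ (eLpNorm ω₀ ⊤ volume).toReal + δ * (2 * (√(t - s))⁻¹ + 2 * bumpC) +
        (β t - β s) := by
    intro δ hδ
    obtain ⟨s₀, hs₀, hgap⟩ := hu.exists_initial_gap hδ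
    refine ⟨s₀, hs₀, fun s hs hss₀ hst => ?_⟩
    have hsub : ∀ τ ∈ Ioo s t, τ ∈ Ioo 0 t := fun τ hτ => ⟨hs.trans hτ.1, hτ.2⟩
    have hub : ∀ τ ∈ Ioo s t, ∀ y, ‖u τ y‖ ≤ U := fun τ hτ =>
      hU τ ⟨(hs.trans hτ.1).le, hτ.2.le.trans ht1⟩
    have hrep := abs_le_of_heat_equation (x := x) (t := t) hu.smoothOn_vort
      hu.smoothOn_vort_flux₁ hu.smoothOn_vort_flux₂ (fun s hs y => hu.vorticity_equation_div hs y)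
      one_pos hs hst (a := a) (b := fun τ => U * a τ) (β := β) (β' := β') hβc.continuousOn
      (fun τ hτ => hβ τ (hsub τ hτ)) (fun τ hτ y _ => ha τ (hsub τ hτ) y)
      (fun τ hτ y _ => by
        rw [abs_mul]
        exact mul_le_mul ((norm_fst_le _).trans (hub τ hτ y)) (ha τ (hsub τ hτ) y)
          (abs_nonneg _) hU0)
      (fun τ hτ y _ => by
        rw [abs_mul]
        exact mul_le_mul ((norm_snd_le _).trans (hub τ hτ y)) (ha τ (hsub τ hτ) y)
          (abs_nonneg _) hU0)
      (fun τ hτ => by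
        refine le_trans ?_ (hab τ (hsub τ hτ))
        have ha0 : 0 ≤ a τ := (abs_nonneg _).trans (ha τ (hsub τ hτ) 0)
        have hσ : 0 < √(t - τ) := Real.sqrt_pos.2 (sub_pos.2 hτ.2)
        -- For `t ≤ 1` the nonsingular cut-off terms are dominated by the singular weight, so that a
        -- single constant `6 bumpC + 2U + 2 bumpC U` remains.
        have h1 : 1 ≤ (√(t - τ))⁻¹ := by
          rw [one_le_inv₀ hσ, Real.sqrt_le_one]
          linarith [hs.trans hτ.1]
        have h2 : 0 ≤ a τ * (2 * bumpC + U * (2 * bumpC)) * ((√(t - τ))⁻¹ - 1) :=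
          mul_nonneg (by positivity) (by linarith)
        simp only [div_one, one_pow]
        linarith)
    have h3 := hu.abs_integral_locKernel_vort_le_initial hω hweak (x := x) hs hst
      (hgap s hs hss₀)
    linarith
  have lim : ∀ δ > 0, |vort (u t) x| ≤ (eLpNorm ω₀ ⊤ volume).toReal +
      δ * (2 * (√t)⁻¹ + 2 * bumpC) + (β t - β 0) := by
    intro δ hδ
    obtain ⟨s₀, hs₀, h⟩ := main δ hδ
    have hcont : Tendsto (fun s => (eLpNorm ω₀ ⊤ volume).toReal +
        δ * (2 * (√(t - s))⁻¹ + 2 * bumpC) + (β t - β s)) (𝓝[>] 0)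
        (𝓝 ((eLpNorm ω₀ ⊤ volume).toReal + δ * (2 * (√t)⁻¹ + 2 * bumpC) + (β t - β 0))) := by
      refine Tendsto.mono_left ?_ nhdsWithin_le_nhds
      have h0 : √(t - 0) ≠ 0 := by rw [sub_zero]; exact (Real.sqrt_pos.2 ht).ne'
      have hca : ContinuousAt (fun s => (eLpNorm ω₀ ⊤ volume).toReal +
        δ * (2 * (√(t - s))⁻¹ + 2 * bumpC) + (β t - β s)) 0 := by
        have : ContinuousAt (fun s => (√(t - s))⁻¹) 0 :=
          ContinuousAt.inv₀ (by fun_prop) h0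
        have := hβc.continuousAt (x := 0)
        fun_prop
      simpa using hca.tendsto
    refine ge_of_tendsto hcont ?_
    filter_upwards [self_mem_nhdsWithin, nhdsWithin_le_nhds (gt_mem_nhds hs₀),
      nhdsWithin_le_nhds (gt_mem_nhds ht)] with s h1 h2 h3 using h s h1 h2 h3
  refine le_of_forall_pos_le_add fun ε hε => ?_
  have hpos : 0 < 2 * (√t)⁻¹ + 2 * bumpC := by positivity
  have := lim (ε / (2 * (√t)⁻¹ + 2 * bumpC)) (by positivity)
  rw [div_mul_cancel₀ _ hpos.ne'] at this
  linarith

/-- The maximum principle for the vorticity, up to the initial time. -/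
theorem abs_vort_le {ω₀ : ℝ × ℝ → ℝ} (hω : MemLp ω₀ ⊤ volume)
    (hweak : IsWeakVort (u 0) ω₀) {t : ℝ} (ht : 0 < t) (x : ℝ × ℝ) :
    |vort (u t) x| ≤ (eLpNorm ω₀ ⊤ volume).toReal := by
  set M := (eLpNorm ω₀ ⊤ volume).toReal with hM
  have hM0 : 0 ≤ M := ENNReal.toReal_nonneg
  have hc := one_le_bumpC
  obtain ⟨U, hU0, hU⟩ := hu.exists_bound 1
  obtain ⟨B, hB0, hB⟩ := hu.exists_vort_le_inv_sqrt one_pos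
  set k : ℝ := 6 * bumpC + 2 * U + 2 * bumpC * U with hk
  have hk0 : 0 ≤ k := by positivity
  -- Inserting the bound `B τ^(-1/2)` gives an integral of `τ^(-1/2) (s-τ)^(-1/2)`, bounded
  -- uniformly in `s`.
  have pass1 : ∀ s ∈ Ioc 0 1, ∀ y, |vort (u s) y| ≤ M + 4 * (k * B) := by
    intro s hs y
    have hs0 : 0 < √s := Real.sqrt_pos.2 hs.1
    have h := hu.abs_vort_le_initial hω hweak hU hs.1 hs.2 (a := fun τ => B * (√τ)⁻¹)
      (β := fun τ => k * B * (√s)⁻¹ * (2 * √τ + -(2 * √(s - τ))))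
      (β' := fun τ => k * B * (√s)⁻¹ * ((√τ)⁻¹ + (√(s - τ))⁻¹))
      (by fun_prop)
      (fun τ hτ => ((hasDerivAt_two_sqrt hτ.1).add (hasDerivAt_sqrt_sub hτ.2)).const_mul _)
      (fun τ hτ y => hB τ ⟨hτ.1, hτ.2.le.trans hs.2⟩ y)
      (fun τ hτ => by
        have p1 : 0 < √τ := Real.sqrt_pos.2 hτ.1
        have p2 : 0 < √(s - τ) := Real.sqrt_pos.2 (sub_pos.2 hτ.2)
        have p3 : √s ≤ √τ + √(s - τ) := by
          rw [Real.sqrt_le_left (by positivity), add_sq, Real.sq_sqrt hτ.1.le,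
            Real.sq_sqrt (sub_nonneg.2 hτ.2.le)]
          have : 0 < √τ * √(s - τ) := by positivity
          linarith
        -- This majorant of the Beta-type integrand has an explicit primitive.
        have p4 : (√τ)⁻¹ * (√(s - τ))⁻¹ ≤ (√s)⁻¹ * ((√τ)⁻¹ + (√(s - τ))⁻¹) := by
          rw [← mul_inv, inv_add_inv p1.ne' p2.ne', inv_mul_eq_div, div_div, inv_eq_one_div,
            div_le_div_iff₀ (by positivity) (by positivity)]
          have p5 : 0 < √τ * √(s - τ) := by positivity
          nlinarith
        calc k * (B * (√τ)⁻¹) * (√(s - τ))⁻¹ = k * B * ((√τ)⁻¹ * (√(s - τ))⁻¹) := by ring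
          _ ≤ k * B * ((√s)⁻¹ * ((√τ)⁻¹ + (√(s - τ))⁻¹)) := by gcongr
          _ = _ := by ring) y
    refine h.trans_eq ?_
    simp only [sub_self, sub_zero, Real.sqrt_zero]
    field_simp; ring
  set B₁ : ℝ := M + 4 * (k * B) with hB₁
  have hB₁0 : 0 ≤ B₁ := by positivity
  -- The bounded estimate, inserted once more, yields an error that vanishes as `s → 0`.
  have pass2 : ∀ s ∈ Ioc 0 1, ∀ y, |vort (u s) y| ≤ M + 2 * k * B₁ * √s := by
    intro s hs y
    have h := hu.abs_vort_le_initial hω hweak hU hs.1 hs.2 (a := fun _ => B₁)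
      (β := fun τ => k * B₁ * -(2 * √(s - τ))) (β' := fun τ => k * B₁ * (√(s - τ))⁻¹)
      (by fun_prop) (fun τ hτ => (hasDerivAt_sqrt_sub hτ.2).const_mul _)
      (fun τ hτ y => pass1 τ ⟨hτ.1, hτ.2.le.trans hs.2⟩ y) (fun τ hτ => le_rfl) y
    refine h.trans_eq ?_
    simp only [sub_self, sub_zero, Real.sqrt_zero]
    ring
  obtain ⟨V, hV0, hV⟩ := hu.exists_bound t
  obtain ⟨C, hC0, hC⟩ := hu.exists_vort_le_inv_sqrt ht
  -- The maximum principle on `[s, t]`, applied to `ω` and `-ω`; its requirement of boundedness is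
  -- met because `s > 0`.
  have step : ∀ s, 0 < s → s < min 1 t → |vort (u t) x| ≤ M + 2 * k * B₁ * √s := by
    intro s hs hst
    have hs1 : s ≤ 1 := (hst.trans_le (min_le_left _ _)).le
    have hst' : s ≤ t := (hst.trans_le (min_le_right _ _)).le
    have hbd : ∀ τ ∈ Icc s t, ∀ y, |vort (u τ) y| ≤ C * (√s)⁻¹ := by
      intro τ hτ y
      refine (hC τ ⟨hs.trans_le hτ.1, hτ.2⟩ y).trans ?_
      have := Real.sqrt_pos.2 hs
      gcongr
      exact hτ.1
    have h1 := max_principle hu.smoothOn_vort (fun s hs y => hu.vorticity_equation hs y) (T := t)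
      (U := V) hs
      (fun τ hτ y => (norm_fst_le _).trans (hV τ ⟨hs.le.trans hτ.1, hτ.2⟩ y))
      (fun τ hτ => hu.vort_periodic (hs.le.trans hτ.1))
      (fun τ hτ y => (le_abs_self _).trans (hbd τ hτ y))
      (fun y => (le_abs_self _).trans (pass2 s ⟨hs, hs1⟩ y)) (right_mem_Icc.2 hst') x
    have hneg : ∀ τ, 0 < τ → ∀ y, dt (fun t y => -vort (u t) y) τ y =
        lap (fun y => -vort (u τ) y) y - (comp₁ (u τ) y * d₁ (fun y => -vort (u τ) y) y +
          comp₂ (u τ) y * d₂ (fun y => -vort (u τ) y) y) := by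
      intro τ hτ y
      have e1 : d₁ (fun y => -vort (u τ) y) = fun y => -d₁ (vort (u τ)) y := funext fun y => d₁_neg
      have e2 : d₂ (fun y => -vort (u τ) y) = fun y => -d₂ (vort (u τ)) y := funext fun y => d₂_neg
      have e3 : dt (fun t y => -vort (u t) y) τ y = -dt (fun t => vort (u t)) τ y := by
        simp [dt, deriv.fun_neg]
      rw [e3, hu.vorticity_equation hτ]
      unfold lap
      rw [e1, e2, d₁_neg, d₂_neg]
      ring
    have h2 := max_principle hu.smoothOn_vort.neg hneg (T := t) (U := V) hs
      (fun τ hτ y => (norm_fst_le _).trans (hV τ ⟨hs.le.trans hτ.1, hτ.2⟩ y))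
      (fun τ hτ x₁ x₂ => by rw [hu.vort_periodic (hs.le.trans hτ.1)])
      (fun τ hτ y => (neg_le_abs _).trans (hbd τ hτ y))
      (fun y => (neg_le_abs _).trans (pass2 s ⟨hs, hs1⟩ y)) (right_mem_Icc.2 hst') x
    exact abs_le.2 ⟨by linarith, h1⟩
  have hlim : Tendsto (fun s => M + 2 * k * B₁ * √s) (𝓝[>] 0) (𝓝 M) := by
    refine Tendsto.mono_left ?_ nhdsWithin_le_nhds
    exact Continuous.tendsto' (by fun_prop) _ _ (by simp)
  refine ge_of_tendsto hlim ?_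
  filter_upwards [self_mem_nhdsWithin, nhdsWithin_le_nhds (gt_mem_nhds (lt_min one_pos ht))]
    with s h1 h2 using step s h1 h2

end IsNSSolution

/-! ### The elliptic estimate for functions of zero vertical mean. -/

/-- Integration by parts along the vertical direction only, because the primitive `Ψ` is assumed
merely continuous in `x₁`. -/
theorem integral_mul_d₂_eq {f Ψ φ : ℝ × ℝ → ℝ} (hf : Continuous f) (hΨ : Continuous Ψ)
    (hd : ∀ x, HasDerivAt (fun s => Ψ (x.1, s)) (f x) x.2) (hφ : ContDiff ℝ ∞ φ)
    (hc : HasCompactSupport φ) : ∫ x, φ x * f x = -∫ x, Ψ x * d₂ φ x := by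
  have hd₂ := (contDiff_d₂ hφ).continuous
  have hs := HasCompactSupport.d₂ hc
  have hline : ∀ {g : ℝ × ℝ → ℝ} {g' : ℝ} {x : ℝ × ℝ}, HasDerivAt (fun s => g (x.1, s)) g' x.2 →
      HasLineDerivAt ℝ g g' x (0, 1) := by
    intro g g' x h
    have h1 : HasDerivAt (fun s : ℝ => x.2 + s) 1 0 := by
      simpa using (hasDerivAt_id (0 : ℝ)).const_add x.2
    have h2 := h.comp_of_eq 0 h1 (by simp)
    have h3 : (fun r : ℝ => g (x + r • ((0 : ℝ), (1 : ℝ)))) = fun r => g (x.1, x.2 + r) := by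
      funext r; congr 1; ext <;> simp
    unfold HasLineDerivAt
    rw [h3]
    simpa [Function.comp_def] using h2
  have h := integral_bilinear_hasLineDerivAt_right_eq_neg_left_of_integrable (μ := volume)
    (f := φ) (f' := d₂ φ) (g := Ψ) (g' := f) (v := ((0 : ℝ), (1 : ℝ)))
    (B := ContinuousLinearMap.mul ℝ ℝ)
    ((hd₂.mul hΨ).integrable_of_hasCompactSupport hs.mul_right)
    ((hφ.continuous.mul hf).integrable_of_hasCompactSupport hc.mul_right)
    ((hφ.continuous.mul hΨ).integrable_of_hasCompactSupport hc.mul_right)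
    (fun x _ => hline (by
      have := hasDerivAt_d₂ (smooth_differentiable hφ x)
      rwa [← d₂_eq (smooth_differentiable hφ x)] at this))
    (fun x _ => hline (hd x))
  simpa [mul_comm] using h

/-- A vertical primitive of a bounded periodic function with zero vertical average is bounded. -/
theorem abs_vertical_primitive_le {f : ℝ × ℝ → ℝ} {A : ℝ} (hf : Continuous f)
    (hper : ∀ x₁ x₂, f (x₁, x₂ + 1) = f (x₁, x₂)) (hA : ∀ x, |f x| ≤ A)
    (hmean : ∀ x₁, vavg f x₁ = 0) (x : ℝ × ℝ) : |∫ s in (0 : ℝ)..x.2, f (x.1, s)| ≤ A := by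
  have hint : ∀ a b, IntervalIntegrable (fun s => f (x.1, s)) volume a b := fun a b =>
    (by fun_prop : Continuous fun s => f (x.1, s)).intervalIntegrable a b
  have hp : Function.Periodic (fun s => f (x.1, s)) 1 := fun s => hper x.1 s
  -- Whole periods contribute nothing, which leaves an interval of length less than one.
  have h0 : ∫ s in (Int.fract x.2)..x.2, f (x.1, s) = 0 := by
    have h1 := hp.intervalIntegral_add_zsmul_eq ⌊x.2⌋ (Int.fract x.2) hint
    have h2 : Int.fract x.2 + ⌊x.2⌋ • (1 : ℝ) = x.2 := by
      simp [Int.fract_add_floor]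
    have h3 : ∫ s in (0 : ℝ)..(0 + 1), f (x.1, s) = 0 := by
      rw [zero_add]; exact hmean x.1
    rw [h2] at h1
    rw [h1, hp.intervalIntegral_add_eq (Int.fract x.2) 0, h3, smul_zero]
  rw [← intervalIntegral.integral_add_adjacent_intervals (hint 0 (Int.fract x.2)) (hint _ x.2), h0,
    add_zero]
  have h4 := intervalIntegral.norm_integral_le_of_norm_le_const (C := A) (a := 0)
    (b := Int.fract x.2) (f := fun s => f (x.1, s)) fun s _ => hA (x.1, s)
  rw [sub_zero, abs_of_nonneg (Int.fract_nonneg _)] at h4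
  have hA0 : 0 ≤ A := (abs_nonneg _).trans (hA 0)
  exact h4.trans (mul_le_of_le_one_right hA0 (Int.fract_lt_one _).le)

/-- A bounded solution of `Δf = div F` on the cylinder with zero vertical average is controlled by
the supremum of `F`. -/
theorem abs_le_of_laplace_eq_div {f F₁ F₂ : ℝ × ℝ → ℝ} {A N : ℝ} (hf : ContDiff ℝ ∞ f)
    (hF₁ : ContDiff ℝ ∞ F₁) (hF₂ : ContDiff ℝ ∞ F₂)
    (hper : ∀ x₁ x₂, f (x₁, x₂ + 1) = f (x₁, x₂)) (hA : ∀ x, |f x| ≤ A)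
    (hmean : ∀ x₁, vavg f x₁ = 0) (heq : ∀ x, lap f x = d₁ F₁ x + d₂ F₂ x)
    (hN₁ : ∀ x, |F₁ x| ≤ N) (hN₂ : ∀ x, |F₂ x| ≤ N) (x : ℝ × ℝ) : |f x| ≤ 68 * N := by
  have hc := one_le_bumpC
  have hN0 : 0 ≤ N := (abs_nonneg _).trans (hN₁ 0)
  -- A time-independent `f` solves `∂ₜf = Δf - div F`, so Duhamel applies over `[1, 17]`. Writing `f
  -- = ∂₂Ψ` with `|Ψ| ≤ A` gives the starting term the heat-kernel gain `2/√16 = 1/2`.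
  have improve : ∀ A, (∀ x, |f x| ≤ A) → ∀ x, |f x| ≤ 3 / 4 * A + 17 * N := by
    intro A hA x
    have hA0 : 0 ≤ A := (abs_nonneg _).trans (hA 0)
    -- At this scale the cut-off errors total at most `33A/132 = A/4`, and the forcing contributes
    -- at most `16N + 16N/132 ≤ 17N`.
    obtain ⟨ρ, hρ⟩ : ∃ ρ, ρ = 264 * bumpC := ⟨_, rfl⟩
    have hρ1 : 1 ≤ ρ := by rw [hρ]; linarith
    have hρ0 : 0 < ρ := by linarith
    have hcρ : bumpC / ρ = 1 / 264 := by rw [hρ]; field_simp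
    have hcρ2 : bumpC / ρ ^ 2 ≤ 1 / 264 := by
      rw [← hcρ]; gcongr; nlinarith
    obtain ⟨P, hP⟩ : ∃ P, P = A * (4 * bumpC / ρ) + 2 * N := ⟨_, rfl⟩
    obtain ⟨Q, hQ⟩ : ∃ Q, Q = A * (2 * bumpC / ρ ^ 2) + N * (2 * bumpC / ρ) := ⟨_, rfl⟩
    have hrep := abs_le_of_heat_equation (x := x) (t := 17) (f := fun _ => f)
      (F₁ := fun _ => F₁) (F₂ := fun _ => F₂) (SmoothOn.of_space hf)
      (SmoothOn.of_space hF₁) (SmoothOn.of_space hF₂) (fun s _ y => by rw [heq y]; simp [dt])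
      hρ0 one_pos (by norm_num : (1 : ℝ) < 17) (a := fun _ => A) (b := fun _ => N)
      (β := fun τ => P * -(2 * √(17 - τ)) + Q * τ)
      (β' := fun τ => P * (√(17 - τ))⁻¹ + Q * 1)
      (Continuous.continuousOn (by fun_prop))
      (fun τ hτ => ((hasDerivAt_sqrt_sub hτ.2).const_mul P).add ((hasDerivAt_id τ).const_mul Q))
      (fun τ _ y _ => hA y) (fun τ _ y _ => hN₁ y) (fun τ _ y _ => hN₂ y)
      (fun τ _ => le_of_eq (by rw [hP, hQ]; ring))
    have h16 : √(17 - 1) = (4 : ℝ) := by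
      rw [show (17 - 1 : ℝ) = 4 ^ 2 by norm_num, Real.sqrt_sq (by norm_num)]
    set Ψ : ℝ × ℝ → ℝ := fun x => ∫ s in (0 : ℝ)..x.2, f (x.1, s) with hΨ
    have hΨc : Continuous Ψ :=
      intervalIntegral.continuous_parametric_intervalIntegral_of_continuous
        (f := fun (x : ℝ × ℝ) s => f (x.1, s)) (by have := hf.continuous; fun_prop) continuous_snd
    have hΨd : ∀ x : ℝ × ℝ, HasDerivAt (fun s => Ψ (x.1, s)) (f x) x.2 := fun x => by
      have hcx : Continuous fun s => f (x.1, s) := by have := hf.continuous; fun_prop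
      exact intervalIntegral.integral_hasDerivAt_right (hcx.intervalIntegrable _ _)
        (hcx.stronglyMeasurableAtFilter _ _) hcx.continuousAt
    have hI := integral_mul_d₂_eq hf.continuous hΨc hΨd
      (contDiff_locKernel (ρ := ρ) (by norm_num : (1 : ℝ) < 17) x)
      (hasCompactSupport_locKernel hρ0)
    have hI2 := abs_integral_mul_d_locKernel_le (ρ := ρ) (x := x) (b := A) (g₁ := fun _ => 0)
      (g₂ := Ψ) hρ0 (by norm_num : (1 : ℝ) < 17) (fun y => by simpa using hA0)
      (abs_vertical_primitive_le hf.continuous hper hA hmean)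
    simp only [zero_mul, zero_add] at hI2
    rw [← abs_neg, ← hI, h16] at hI2
    simp only [sub_self, Real.sqrt_zero, h16] at hrep
    have h5 : 2 * bumpC / ρ = 1 / 132 := by rw [mul_div_assoc, hcρ]; norm_num
    have h6 : 4 * bumpC / ρ = 1 / 66 := by rw [mul_div_assoc, hcρ]; norm_num
    have h7 : 2 * bumpC / ρ ^ 2 ≤ 1 / 132 := by rw [mul_div_assoc]; linarith
    rw [h5] at hI2 hQ
    rw [h6] at hP
    have h8 : A * (2 * bumpC / ρ ^ 2) ≤ A * (1 / 132) := by gcongr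
    linarith
  -- Applied to the supremum itself, the improvement reads `S ≤ 3S/4 + 17N`.
  have hbdd : BddAbove (range fun x => |f x|) := ⟨A, by rintro _ ⟨x, rfl⟩; exact hA x⟩
  have h1 := improve (⨆ x, |f x|) (fun x => le_ciSup hbdd x)
  have h2 := ciSup_le h1
  have h3 := le_ciSup hbdd x
  linarith

/-! ### Vertical averages and the oscillating part. -/

/-- The average is the value at `0` of the convolution of the indicator of `(0,1]` with `y ↦ f(t,
x₁, -y)`, truncated by `bump`, which is `1` wherever the indicator sees it. Smooth dependence of
convolutions on parameters then applies. -/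
theorem SmoothOn.vavg {I : Set ℝ} (hI : IsOpen I) {f : ℝ → ℝ × ℝ → ℝ} (hf : SmoothOn I f) :
    SmoothOn I fun t x => vavg (f t) x.1 := by
  set g : ℝ × (ℝ × ℝ) → ℝ → ℝ := fun p y => f p.1 (p.2.1, -y) * bump y with hg
  have hgs : ContDiffOn ℝ ((⊤ : ℕ∞) : WithTop ℕ∞) ↿g ((I ×ˢ univ) ×ˢ univ) := by
    have h1 : ContDiffOn ℝ ∞ (fun q : (ℝ × (ℝ × ℝ)) × ℝ => f q.1.1 (q.1.2.1, -q.2))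
        ((I ×ˢ univ) ×ˢ univ) :=
      ContDiffOn.comp (g := fun z : ℝ × (ℝ × ℝ) => f z.1 z.2)
        (f := fun q : (ℝ × (ℝ × ℝ)) × ℝ => (q.1.1, (q.1.2.1, -q.2))) hf (by fun_prop)
        fun q hq => ⟨hq.1.1, mem_univ _⟩
    exact h1.mul (bump_contDiff.comp contDiff_snd).contDiffOn
  have hloc : LocallyIntegrable ((Ioc (0 : ℝ) 1).indicator fun _ => (1 : ℝ)) volume := by
    apply Integrable.locallyIntegrable
    rw [integrable_indicator_iff measurableSet_Ioc]
    exact integrableOn_const (by simp)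
  have hconv := contDiffOn_convolution_right_with_param (ContinuousLinearMap.mul ℝ ℝ)
    (μ := (volume : Measure ℝ)) (hI.prod isOpen_univ) (isCompact_Icc (a := (-2 : ℝ)) (b := 2))
    (fun p y _ hy => by
      have : 2 ≤ |y| := by
        by_contra! h
        exact hy (abs_le.1 h.le)
      simp [hg, bump_eq_zero this]) hloc hgs
  have hcomp : ContDiffOn ℝ ∞ (fun z : ℝ × (ℝ × ℝ) => (z, (0 : ℝ))) (I ×ˢ univ) := by fun_prop
  have h2 := hconv.comp hcomp fun z hz => ⟨hz, mem_univ _⟩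
  refine ContDiffOn.congr h2 fun z _ => ?_
  simp only [Function.comp_apply, convolution, StripNS.vavg]
  rw [intervalIntegral.integral_of_le zero_le_one, ← integral_indicator measurableSet_Ioc]
  congr 1
  funext s
  by_cases hs : s ∈ Ioc (0 : ℝ) 1
  · have hb : bump (0 - s) = 1 := bump_eq_one (by
      rw [zero_sub, abs_neg, abs_of_pos hs.1]; exact hs.2)
    simp only [indicator_of_mem hs, hg, hb]
    simp
  · simp [indicator_of_notMem hs]

theorem hasDerivAt_vavg {h : ℝ × ℝ → ℝ} (hh : ContDiff ℝ ∞ h) (x₁ : ℝ) :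
    HasDerivAt (vavg h) (vavg (d₁ h) x₁) x₁ := by
  have h1 := (contDiff_d₁ hh).continuous
  have h2 := hh.continuous
  have key := hasDerivAt_setIntegral_of_isCompact (μ := (volume : Measure ℝ))
    (isCompact_Icc (a := (0 : ℝ)) (b := 1)) isOpen_univ
    (F := fun s y => h (s, y)) (F' := fun s y => d₁ h (s, y))
    (Continuous.continuousOn (by fun_prop)) (Continuous.continuousOn (by fun_prop))
    (fun s _ y _ => by
      have := hasDerivAt_d₁ (smooth_differentiable hh (s, y))
      rwa [← d₁_eq (smooth_differentiable hh (s, y))] at this) (mem_univ x₁)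
  unfold vavg
  simpa only [integral_Icc_eq_integral_Ioc, ← intervalIntegral.integral_of_le zero_le_one] using key

theorem vavg_d₂ {h : ℝ × ℝ → ℝ} (hh : ContDiff ℝ ∞ h)
    (hper : ∀ x₁ x₂, h (x₁, x₂ + 1) = h (x₁, x₂)) (x₁ : ℝ) : vavg (d₂ h) x₁ = 0 := by
  have h1 := (contDiff_d₂ hh).continuous
  unfold vavg
  rw [intervalIntegral.integral_eq_sub_of_hasDerivAt (f := fun s => h (x₁, s))]
  · have := hper x₁ 0
    rw [zero_add] at this
    simp [this]
  · intro s _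
    have := hasDerivAt_d₂ (smooth_differentiable hh (x₁, s))
    rwa [← d₂_eq (smooth_differentiable hh (x₁, s))] at this
  · exact (by fun_prop : Continuous fun s => d₂ h (x₁, s)).intervalIntegrable _ _

theorem abs_vavg_le {h : ℝ × ℝ → ℝ} {B x₁ : ℝ} (hB : ∀ x, |h x| ≤ B) : |vavg h x₁| ≤ B := by
  have := intervalIntegral.norm_integral_le_of_norm_le_const (C := B) (a := 0) (b := 1)
    (f := fun s => h (x₁, s)) fun s _ => hB (x₁, s)
  simpa [vavg] using this

theorem vavg_sub {h k : ℝ × ℝ → ℝ} (hh : Continuous h) (hk : Continuous k) (x₁ : ℝ) :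
    vavg (fun x => h x - k x) x₁ = vavg h x₁ - vavg k x₁ := by
  unfold vavg
  exact intervalIntegral.integral_sub
    ((by fun_prop : Continuous fun s => h (x₁, s)).intervalIntegrable _ _)
    ((by fun_prop : Continuous fun s => k (x₁, s)).intervalIntegrable _ _)

/-- The vertical component of the oscillating part. -/
def osc₂ (v : ℝ × ℝ → ℝ × ℝ) (x : ℝ × ℝ) : ℝ := comp₂ v x - vavg (comp₂ v) x.1

theorem osc_fst (v : ℝ × ℝ → ℝ × ℝ) (x : ℝ × ℝ) : (osc v x).1 = comp₁ v x := by
  simp [osc, comp₁]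

theorem osc_snd (v : ℝ × ℝ → ℝ × ℝ) (x : ℝ × ℝ) : (osc v x).2 = osc₂ v x := by
  simp [osc, osc₂, comp₂]

namespace IsNSSolution

variable {u : ℝ → ℝ × ℝ → ℝ × ℝ} (hu : IsNSSolution u)
include hu

theorem smoothOn_osc₂ : SmoothOn (Ioi 0) fun t => osc₂ (u t) :=
  hu.smoothOn₂.sub (hu.smoothOn₂.vavg isOpen_Ioi)

theorem contDiff_mean {t : ℝ} (ht : 0 < t) :
    ContDiff ℝ ∞ fun x : ℝ × ℝ => vavg (comp₂ (u t)) x.1 :=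
  (hu.smoothOn₂.vavg isOpen_Ioi).slice isOpen_Ioi ht

theorem vavg_osc₂ {t : ℝ} (ht : 0 ≤ t) (x₁ : ℝ) : vavg (osc₂ (u t)) x₁ = 0 := by
  have hc : Continuous (u t) := (hu.buc t ht).uniformContinuous.continuous
  have h2 : Continuous fun s => comp₂ (u t) (x₁, s) := by unfold comp₂; fun_prop
  unfold osc₂ vavg
  rw [intervalIntegral.integral_sub (h2.intervalIntegrable _ _) (by simp)]
  simp

/-- The derivative of the mean vertical velocity is the mean vorticity. -/
theorem d₁_mean {t : ℝ} (ht : 0 < t) (x : ℝ × ℝ) :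
    d₁ (fun x => vavg (comp₂ (u t)) x.1) x = vavg (vort (u t)) x.1 := by
  have h1 : d₁ (fun x => vavg (comp₂ (u t)) x.1) x = vavg (d₁ (comp₂ (u t))) x.1 :=
    (hasDerivAt_vavg (hu.contDiff₂ ht) x.1).deriv
  have h2 := vavg_sub (contDiff_d₁ (hu.contDiff₂ ht)).continuous
    (contDiff_d₂ (hu.contDiff₁ ht)).continuous x.1
  rw [vavg_d₂ (hu.contDiff₁ ht) (hu.periodic₁ ht.le), sub_zero] at h2
  rw [h1, ← h2]
  rfl

omit hu in
theorem d₂_mean (t : ℝ) (x : ℝ × ℝ) : d₂ (fun x => vavg (comp₂ (u t)) x.1) x = 0 := by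
  simp [d₂]

theorem d₂_osc₂ {t : ℝ} (ht : 0 < t) (x : ℝ × ℝ) : d₂ (osc₂ (u t)) x = d₂ (comp₂ (u t)) x := by
  have := d₂_sub (smooth_differentiable (hu.contDiff₂ ht) x)
    (smooth_differentiable (hu.contDiff_mean ht) x)
  rw [d₂_mean, sub_zero] at this
  exact this

theorem d₁_osc₂ {t : ℝ} (ht : 0 < t) (x : ℝ × ℝ) :
    d₁ (osc₂ (u t)) x = d₁ (comp₂ (u t)) x - vavg (vort (u t)) x.1 := by
  have := d₁_sub (smooth_differentiable (hu.contDiff₂ ht) x)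
    (smooth_differentiable (hu.contDiff_mean ht) x)
  rw [hu.d₁_mean ht] at this
  exact this

/-- Incompressibility gives `Δu₁ = -∂₂ω` and `Δû₂ = ∂₁(ω - ⟨ω⟩)`, with fluxes bounded by `M` and
`2M`. The elliptic constant `68`, doubled for the second component, serves for both. -/
theorem abs_osc_le {M t : ℝ} (ht : 0 < t) (hmean : ∀ x₁, vavg (comp₁ (u t)) x₁ = 0)
    (hM : ∀ x, |vort (u t) x| ≤ M) (x : ℝ × ℝ) :
    |comp₁ (u t) x| ≤ 136 * M ∧ |osc₂ (u t) x| ≤ 136 * M := by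
  have hM0 : 0 ≤ M := (abs_nonneg _).trans (hM 0)
  obtain ⟨B, hB⟩ := (hu.buc t ht.le).bounded
  have ha := hu.contDiff₁ ht
  have hb := hu.contDiff₂ ht
  have hm := hu.contDiff_mean ht
  have hw : ContDiff ℝ ∞ (vort (u t)) := hu.smoothOn_vort.slice isOpen_Ioi ht
  have hv : vort (u t) = fun y => d₁ (comp₂ (u t)) y - d₂ (comp₁ (u t)) y := rfl
  have hdiv : d₁ (comp₁ (u t)) = fun y => -d₂ (comp₂ (u t)) y :=
    funext fun y => by linarith [hu.divFree t ht y]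
  have hdiv' : d₂ (comp₂ (u t)) = fun y => -d₁ (comp₁ (u t)) y :=
    funext fun y => by linarith [hu.divFree t ht y]
  have comm {h : ℝ × ℝ → ℝ} (hh : ContDiff ℝ ∞ h) (y : ℝ × ℝ) : d₂ (d₁ h) y = d₁ (d₂ h) y :=
    (d₁_d₂_comm (hh.of_le (WithTop.coe_le_coe.2 le_top))).symm
  constructor
  · have h := abs_le_of_laplace_eq_div (f := comp₁ (u t)) (F₁ := fun _ => 0)
      (F₂ := fun y => -vort (u t) y) (A := B) (N := M) ha contDiff_const hw.neg
      (hu.periodic₁ ht.le) (fun y => (norm_fst_le _).trans (hB y)) hmean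
      (fun y => by
        have D {h : ℝ × ℝ → ℝ} (hh : ContDiff ℝ ∞ h) : DifferentiableAt ℝ h y :=
          smooth_differentiable hh y
        have e0 : d₁ (fun _ : ℝ × ℝ => (0 : ℝ)) y = 0 := by simp [d₁]
        rw [e0, d₂_neg, hv, d₂_sub (D (contDiff_d₁ hb)) (D (contDiff_d₂ ha)), comm hb]
        unfold lap
        rw [hdiv, d₁_neg]
        ring)
      (fun y => by simpa using hM0) (fun y => by rw [abs_neg]; exact hM y) x
    linarith
  · have h := abs_le_of_laplace_eq_div (f := osc₂ (u t))
      (F₁ := fun y => vort (u t) y - d₁ (fun x => vavg (comp₂ (u t)) x.1) y)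
      (F₂ := fun _ => 0) (A := 2 * B) (N := 2 * M) (hb.sub hm) (hw.sub (contDiff_d₁ hm))
      contDiff_const
      (fun x₁ x₂ => by simp only [osc₂, hu.periodic₂ ht.le])
      (fun y => by
        have h1 : ∀ z, |comp₂ (u t) z| ≤ B := fun z => (norm_snd_le _).trans (hB z)
        have h2 := abs_vavg_le (x₁ := y.1) h1
        unfold osc₂
        linarith [abs_sub (comp₂ (u t) y) (vavg (comp₂ (u t)) y.1), h1 y])
      (hu.vavg_osc₂ ht.le)
      (fun y => by
        have D {h : ℝ × ℝ → ℝ} (hh : ContDiff ℝ ∞ h) : DifferentiableAt ℝ h y :=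
          smooth_differentiable hh y
        have e0 : d₂ (fun _ : ℝ × ℝ => (0 : ℝ)) y = 0 := by simp [d₂]
        have e1 : d₁ (osc₂ (u t)) = fun z => d₁ (comp₂ (u t)) z -
            d₁ (fun x => vavg (comp₂ (u t)) x.1) z :=
          funext fun z => d₁_sub (smooth_differentiable hb z) (smooth_differentiable hm z)
        have e2 : d₂ (osc₂ (u t)) = d₂ (comp₂ (u t)) := funext fun z => hu.d₂_osc₂ ht z
        unfold lap
        rw [e0, e1, e2, d₁_sub (D (contDiff_d₁ hb)) (D (contDiff_d₁ hm)),
          d₁_sub (D hw) (D (contDiff_d₁ hm)), hv,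
          d₁_sub (D (contDiff_d₁ hb)) (D (contDiff_d₂ ha)), hdiv', d₂_neg, comm ha]
        ring)
      (fun y => by
        rw [hu.d₁_mean ht]
        have := abs_vavg_le (x₁ := y.1) hM
        linarith [abs_sub (vort (u t) y) (vavg (vort (u t)) y.1), hM y])
      (fun y => by simpa using hM0) x
    linarith

/-- Uniform convergence `u s → u 0` carries the bound to the initial time, where the vorticity
argument is not available. -/
theorem abs_osc_zero_le {B : ℝ}
    (hB : ∀ t, 0 < t → ∀ x, |comp₁ (u t) x| ≤ B ∧ |osc₂ (u t) x| ≤ B) (x : ℝ × ℝ) :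
    |comp₁ (u 0) x| ≤ B ∧ |osc₂ (u 0) x| ≤ B := by
  have key : ∀ δ > 0, |comp₁ (u 0) x| ≤ B + 2 * δ ∧ |osc₂ (u 0) x| ≤ B + 2 * δ := by
    intro δ hδ
    obtain ⟨s₀, hs₀, h⟩ := hu.exists_initial_gap hδ
    have hs : 0 < s₀ / 2 := by positivity
    have hg := h (s₀ / 2) hs (by linarith)
    have c0 : Continuous (comp₂ (u 0)) :=
      continuous_snd.comp (hu.buc 0 le_rfl).uniformContinuous.continuous
    have cs : Continuous (comp₂ (u (s₀ / 2))) :=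
      continuous_snd.comp (hu.buc _ hs.le).uniformContinuous.continuous
    have g1 : ∀ y, |comp₁ (u (s₀ / 2)) y - comp₁ (u 0) y| ≤ δ := fun y =>
      (norm_fst_le (u (s₀ / 2) y - u 0 y)).trans (hg y)
    have g2 : ∀ y, |comp₂ (u (s₀ / 2)) y - comp₂ (u 0) y| ≤ δ := fun y =>
      (norm_snd_le (u (s₀ / 2) y - u 0 y)).trans (hg y)
    have g3 := abs_vavg_le (x₁ := x.1) g2
    rw [vavg_sub cs c0] at g3
    obtain ⟨b1, b2⟩ := hB _ hs x
    have g1x := abs_le.1 (g1 x)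
    have g2x := abs_le.1 (g2 x)
    rw [abs_le] at g3 b1 b2
    unfold osc₂ at b2 ⊢
    constructor <;> rw [abs_le] <;> constructor <;> linarith
  constructor <;> refine le_of_forall_pos_le_add fun ε hε => ?_
  · have := (key (ε / 2) (by positivity)).1; linarith
  · have := (key (ε / 2) (by positivity)).2; linarith

end IsNSSolution

/-! ### Integrability of `∂₂K` and the nonlocal pressure flux. -/

section

open scoped ENNReal

/-- The absolute value of the kernel `∂₂K`. -/
def pKernel (z : ℝ × ℝ) : ℝ := |Real.sin (2 * Real.pi * z.2)| /
  (2 * Real.cosh (2 * Real.pi * z.1) - 2 * Real.cos (2 * Real.pi * z.2))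

theorem measurable_pKernel : Measurable pKernel := by
  unfold pKernel
  fun_prop

/-- The half-angle formulas turn the left-out quantity into `4 sinh²(πz₁) + 4 sin²(πz₂)`, and `|sinh
y| ≥ |y|`. -/
theorem cosh_sub_cos_ge (z : ℝ × ℝ) : (2 * Real.pi * z.1) ^ 2 + 4 * Real.sin (Real.pi * z.2) ^ 2 ≤
    2 * Real.cosh (2 * Real.pi * z.1) - 2 * Real.cos (2 * Real.pi * z.2) := by
  have h1 : 1 + (2 * Real.pi * z.1) ^ 2 / 2 ≤ Real.cosh (2 * Real.pi * z.1) := by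
    have h := Real.self_le_sinh_iff.2 (abs_nonneg (Real.pi * z.1))
    rw [← Real.abs_sinh] at h
    have h' := sq_le_sq.2 h
    rw [mul_assoc, Real.cosh_two_mul, Real.cosh_sq]
    linarith
  have h2 : Real.cos (2 * Real.pi * z.2) = 1 - 2 * Real.sin (Real.pi * z.2) ^ 2 := by
    rw [mul_assoc, Real.cos_two_mul, Real.cos_sq']; ring
  rw [h2]; linarith

/-- For `z.1 ≠ 0` the argument of the logarithm is positive; the excluded line is null for the
integrals below. -/
theorem abs_d₂_K {z : ℝ × ℝ} (hz : z.1 ≠ 0) : |d₂ K z| = pKernel z := by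
  have hpi := Real.pi_pos
  have h0 : 0 < (2 * Real.pi * z.1) ^ 2 + 4 * Real.sin (Real.pi * z.2) ^ 2 := by positivity
  have hden : 0 < 2 * Real.cosh (2 * Real.pi * z.1) - 2 * Real.cos (2 * Real.pi * z.2) :=
    h0.trans_le (cosh_sub_cos_ge z)
  have h1 : HasDerivAt (fun s : ℝ => 2 * Real.pi * s) (2 * Real.pi) z.2 := by
    simpa using (hasDerivAt_id z.2).const_mul (2 * Real.pi)
  have h2 := ((h1.cos.const_mul 2).const_sub (2 * Real.cosh (2 * Real.pi * z.1)))
  have h3 := (h2.log hden.ne').const_mul (1 / (4 * Real.pi))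
  have h4 : d₂ K z = Real.sin (2 * Real.pi * z.2) /
      (2 * Real.cosh (2 * Real.pi * z.1) - 2 * Real.cos (2 * Real.pi * z.2)) := by
    have : d₂ K z = _ := h3.deriv
    rw [this]; field_simp; ring
  rw [h4, abs_div, abs_of_pos hden]
  rfl

/-- With `s = |sin πr|` the kernel is dominated by the Cauchy density `s / (2(s² + π²z₁²))`, whose
mass `1/2` does not depend on `r`. -/
theorem lintegral_pKernel_le (r : ℝ) : ∫⁻ z₁, ENNReal.ofReal (pKernel (z₁, r)) ≤
    ENNReal.ofReal (1 / 2) := by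
  have hpi := Real.pi_pos
  have hsin : |Real.sin (2 * Real.pi * r)| ≤ 2 * |Real.sin (Real.pi * r)| := by
    rw [mul_assoc, Real.sin_two_mul, abs_mul, abs_mul, abs_two]
    exact mul_le_of_le_one_right (by positivity) (Real.abs_cos_le_one _)
  by_cases hs : Real.sin (Real.pi * r) = 0
  · have : |Real.sin (2 * Real.pi * r)| = 0 := by
      rw [hs, abs_zero, mul_zero] at hsin
      exact le_antisymm hsin (abs_nonneg _)
    simp [pKernel, this]
  obtain ⟨s, hsdef⟩ : ∃ s, s = |Real.sin (Real.pi * r)| := ⟨_, rfl⟩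
  have hs0 : 0 < s := hsdef ▸ abs_pos.2 hs
  have hle : ∀ z₁ : ℝ, pKernel (z₁, r) ≤ (2 * s)⁻¹ * (1 + (Real.pi / s * z₁) ^ 2)⁻¹ := by
    intro z₁
    have h1 := cosh_sub_cos_ge (z₁, r)
    simp only at h1
    rw [← sq_abs (Real.sin (Real.pi * r)), ← hsdef] at h1
    have h2 : 0 < (2 * Real.pi * z₁) ^ 2 + 4 * s ^ 2 := by positivity
    unfold pKernel
    simp only
    calc _ ≤ 2 * s / ((2 * Real.pi * z₁) ^ 2 + 4 * s ^ 2) := by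
          rw [← hsdef] at hsin
          gcongr
      _ = _ := by field_simp; ring
  have hint : Integrable fun z₁ : ℝ => (2 * s)⁻¹ * (1 + (Real.pi / s * z₁) ^ 2)⁻¹ :=
    (integrable_inv_one_add_sq.comp_mul_left' (by positivity : Real.pi / s ≠ 0)).const_mul _
  calc _ ≤ ∫⁻ z₁, ENNReal.ofReal ((2 * s)⁻¹ * (1 + (Real.pi / s * z₁) ^ 2)⁻¹) :=
        lintegral_mono fun z₁ => ENNReal.ofReal_le_ofReal (hle z₁)
    _ = ENNReal.ofReal (∫ z₁, (2 * s)⁻¹ * (1 + (Real.pi / s * z₁) ^ 2)⁻¹) :=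
        (ofReal_integral_eq_lintegral_ofReal hint
          (Eventually.of_forall fun z₁ => by positivity)).symm
    _ = ENNReal.ofReal (1 / 2) := by
        congr 1
        have h := Measure.integral_comp_mul_left (fun y : ℝ => (1 + y ^ 2)⁻¹) (Real.pi / s)
        rw [integral_const_mul, h, integral_univ_inv_one_add_sq,
          abs_of_pos (by positivity), smul_eq_mul]
        field_simp

theorem lintegral_cell_pKernel_le (x : ℝ × ℝ) :
    ∫⁻ y in cell, ENNReal.ofReal (pKernel (x - y)) ≤ ENNReal.ofReal (1 / 2) := by
  have hm : Measurable fun y => ENNReal.ofReal (pKernel (x - y)) :=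
    (measurable_pKernel.comp (by fun_prop)).ennreal_ofReal
  unfold cell
  rw [Measure.volume_eq_prod, setLIntegral_prod_symm _ hm.aemeasurable]
  calc _ ≤ ∫⁻ _ in Ioc (0 : ℝ) 1, ENNReal.ofReal (1 / 2) := by
        refine lintegral_mono fun y₂ => ?_
        simp only [Measure.restrict_univ]
        have := lintegral_sub_left_eq_self (μ := (volume : Measure ℝ))
          (fun z₁ => ENNReal.ofReal (pKernel (z₁, x.2 - y₂))) x.1
        exact this.trans_le (lintegral_pKernel_le _)
    _ = _ := by simp

/-- A form of Young's inequality for the convolution with `∂₂K` over the cylinder. -/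
theorem lintegral_pKernel_conv_le {w : ℝ → ℝ≥0∞} {φ : ℝ × ℝ → ℝ≥0∞} (hw : Measurable w)
    (hφ : Measurable φ) {Q : ℝ≥0∞}
    (hQ : ∀ z₁, ∫⁻ x₁, w x₁ * ∫⁻ y₂ in Ioc (0 : ℝ) 1, φ (x₁ - z₁, y₂) ≤ Q) :
    ∫⁻ x₁, w x₁ * ∫⁻ x₂ in Icc (0 : ℝ) 1, ∫⁻ y in cell,
      ENNReal.ofReal (pKernel ((x₁, x₂) - y)) * φ y ≤ Q := by
  have hk : Measurable fun z => ENNReal.ofReal (pKernel z) := measurable_pKernel.ennreal_ofReal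
  set k : ℝ × ℝ → ℝ≥0∞ := fun z => ENNReal.ofReal (pKernel z) with hkdef
  -- All differences `x₂ - y₂` lie in `[-1, 1]`. Integrating the kernel over that range gives a
  -- horizontal kernel of mass at most `2 · 1/2 = 1`, and the problem becomes one-dimensional.
  set κ : ℝ → ℝ≥0∞ := fun z₁ => ∫⁻ r in Icc (-1 : ℝ) 1, k (z₁, r) with hκ
  have hκm : Measurable κ := Measurable.lintegral_prod_right hk
  have hκ1 : ∫⁻ z₁, κ z₁ ≤ 1 := by
    rw [hκ, lintegral_lintegral_swap (f := fun z₁ r => k (z₁, r)) hk.aemeasurable]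
    calc _ ≤ ∫⁻ _ in Icc (-1 : ℝ) 1, ENNReal.ofReal (1 / 2) :=
          lintegral_mono fun r => lintegral_pKernel_le r
      _ = 1 := by
          rw [setLIntegral_const, Real.volume_Icc, ← ENNReal.ofReal_mul (by norm_num)]
          norm_num
  have hshift : ∀ z₁, ∀ y₂ ∈ Ioc (0 : ℝ) 1, ∫⁻ x₂ in Icc (0 : ℝ) 1, k (z₁, x₂ - y₂) ≤ κ z₁ := by
    intro z₁ y₂ hy₂
    have htr := lintegral_sub_right_eq_self (μ := (volume : Measure ℝ))
      ((Icc (-1 : ℝ) 1).indicator fun r => k (z₁, r)) y₂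
    simp only [hκ]
    rw [← lintegral_indicator measurableSet_Icc, ← lintegral_indicator measurableSet_Icc, ← htr]
    refine lintegral_mono fun x₂ => ?_
    by_cases hx : x₂ ∈ Icc (0 : ℝ) 1
    · have : x₂ - y₂ ∈ Icc (-1 : ℝ) 1 := ⟨by linarith [hx.1, hy₂.2], by linarith [hx.2, hy₂.1]⟩
      rw [indicator_of_mem hx, indicator_of_mem this]
    · rw [indicator_of_notMem hx]; exact zero_le
  have hinner : ∀ x₁, ∫⁻ x₂ in Icc (0 : ℝ) 1, ∫⁻ y in cell, k ((x₁, x₂) - y) * φ y ≤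
      ∫⁻ z₁, κ z₁ * ∫⁻ y₂ in Ioc (0 : ℝ) 1, φ (x₁ - z₁, y₂) := by
    intro x₁
    calc ∫⁻ x₂ in Icc (0 : ℝ) 1, ∫⁻ y in cell, k ((x₁, x₂) - y) * φ y
        = ∫⁻ x₂ in Icc (0 : ℝ) 1, ∫⁻ y₂ in Ioc (0 : ℝ) 1, ∫⁻ z₁,
            k (z₁, x₂ - y₂) * φ (x₁ - z₁, y₂) := by
          refine lintegral_congr fun x₂ => ?_
          have hm : Measurable fun y => k ((x₁, x₂) - y) * φ y :=
            (hk.comp (by fun_prop)).mul hφ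
          unfold cell
          rw [Measure.volume_eq_prod, setLIntegral_prod_symm _ hm.aemeasurable]
          refine lintegral_congr fun y₂ => ?_
          rw [Measure.restrict_univ]
          have := lintegral_sub_left_eq_self (μ := (volume : Measure ℝ))
            (fun y₁ => k ((x₁, x₂) - (y₁, y₂)) * φ (y₁, y₂)) x₁
          rw [← this]
          simp
      _ = ∫⁻ y₂ in Ioc (0 : ℝ) 1, ∫⁻ x₂ in Icc (0 : ℝ) 1, ∫⁻ z₁,
            k (z₁, x₂ - y₂) * φ (x₁ - z₁, y₂) := by
          refine lintegral_lintegral_swap (Measurable.aemeasurable ?_)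
          refine Measurable.lintegral_prod_right'
            (f := fun p : (ℝ × ℝ) × ℝ => k (p.2, p.1.1 - p.1.2) * φ (x₁ - p.2, p.1.2)) ?_
          exact (hk.comp (by fun_prop)).mul (hφ.comp (by fun_prop))
      _ = ∫⁻ y₂ in Ioc (0 : ℝ) 1, ∫⁻ z₁, ∫⁻ x₂ in Icc (0 : ℝ) 1,
            k (z₁, x₂ - y₂) * φ (x₁ - z₁, y₂) := by
          refine lintegral_congr fun y₂ => lintegral_lintegral_swap (Measurable.aemeasurable ?_)
          exact (hk.comp (by fun_prop)).mul (hφ.comp (by fun_prop))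
      _ ≤ ∫⁻ y₂ in Ioc (0 : ℝ) 1, ∫⁻ z₁, κ z₁ * φ (x₁ - z₁, y₂) := by
          refine setLIntegral_mono_ae' measurableSet_Ioc (Eventually.of_forall fun y₂ hy₂ => ?_)
          refine lintegral_mono fun z₁ => ?_
          have hm : Measurable fun x₂ => k (z₁, x₂ - y₂) := hk.comp (by fun_prop)
          simp only
          rw [lintegral_mul_const _ hm]
          gcongr
          exact hshift z₁ y₂ hy₂
      _ = ∫⁻ z₁, ∫⁻ y₂ in Ioc (0 : ℝ) 1, κ z₁ * φ (x₁ - z₁, y₂) := by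
          refine lintegral_lintegral_swap (Measurable.aemeasurable ?_)
          exact (hκm.comp measurable_snd).mul (hφ.comp (by fun_prop))
      _ = _ := by
          refine lintegral_congr fun z₁ => ?_
          have hm : Measurable fun y₂ => φ (x₁ - z₁, y₂) := hφ.comp (by fun_prop)
          rw [lintegral_const_mul _ hm]
  have hΦm : Measurable fun p : ℝ × ℝ => ∫⁻ y₂ in Ioc (0 : ℝ) 1, φ (p.1 - p.2, y₂) :=
    Measurable.lintegral_prod_right'
      (f := fun q : (ℝ × ℝ) × ℝ => φ (q.1.1 - q.1.2, q.2)) (hφ.comp (by fun_prop))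
  calc _ ≤ ∫⁻ x₁, w x₁ * ∫⁻ z₁, κ z₁ * ∫⁻ y₂ in Ioc (0 : ℝ) 1, φ (x₁ - z₁, y₂) := by
        exact lintegral_mono fun x₁ => mul_le_mul_right (hinner x₁) _
    _ = ∫⁻ x₁, ∫⁻ z₁, κ z₁ * (w x₁ * ∫⁻ y₂ in Ioc (0 : ℝ) 1, φ (x₁ - z₁, y₂)) := by
        refine lintegral_congr fun x₁ => ?_
        rw [← lintegral_const_mul]
        · refine lintegral_congr fun z₁ => ?_
          ring
        · exact hκm.mul (hΦm.comp (measurable_const.prodMk measurable_id))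
    _ = ∫⁻ z₁, ∫⁻ x₁, κ z₁ * (w x₁ * ∫⁻ y₂ in Ioc (0 : ℝ) 1, φ (x₁ - z₁, y₂)) := by
        refine lintegral_lintegral_swap (Measurable.aemeasurable ?_)
        exact (hκm.comp measurable_snd).mul ((hw.comp measurable_fst).mul hΦm)
    _ ≤ ∫⁻ z₁, κ z₁ * Q := by
        refine lintegral_mono fun z₁ => ?_
        simp only
        rw [lintegral_const_mul]
        · gcongr
          exact hQ z₁
        · exact hw.mul (hΦm.comp (measurable_id.prodMk measurable_const))
    _ ≤ 1 * Q := by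
        rw [lintegral_mul_const _ hκm]; gcongr
    _ = Q := one_mul Q

/-- The nonlocal part of the pressure flux is controlled by the local energy. -/
theorem integral_nonlocal_flux_le {a g q : ℝ × ℝ → ℝ} (ha : Continuous a) (hq : Continuous q)
    {M Q α β : ℝ} (hg : ∀ x, |g x| ≤ M)
    (hqdef : ∀ x, q x = ∫ y in cell, d₂ K (x - y) * (g y * a y))
    (hQ : ∀ z, ∫ x₁ in Icc (α - z) (β - z), vavg (fun x => a x ^ 2) x₁ ≤ Q) :
    ∫ x in Icc α β ×ˢ Icc 0 1, |a x| * |q x| ≤ 3 / 4 * (M * Q) := by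
  have hM0 : 0 ≤ M := (abs_nonneg _).trans (hg 0)
  set k : ℝ × ℝ → ℝ≥0∞ := fun z => ENNReal.ofReal (pKernel z) with hk
  have hkm : Measurable k := measurable_pKernel.ennreal_ofReal
  set φ : ℝ × ℝ → ℝ≥0∞ := fun y => ENNReal.ofReal (1 / 2 * a y ^ 2) with hφ
  have hφm : Measurable φ :=
    (by fun_prop : Continuous fun y => 1 / 2 * a y ^ 2).measurable.ennreal_ofReal
  -- The bound `|a x| |a y| ≤ (a x² + a y²)/2` inside the convolution separates a local term, with
  -- kernel mass `1/2`, from a convolution of `φ = a²/2`. Together they give `3/4 = 1/2 · 1/2 +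
  -- 1/2`.
  have hpt : ∀ x, ENNReal.ofReal (|a x| * |q x|) ≤
      ENNReal.ofReal M * (φ x * ENNReal.ofReal (1 / 2) + ∫⁻ y in cell, k (x - y) * φ y) := by
    intro x
    have hae : ∀ᵐ y : ℝ × ℝ, (x - y).1 ≠ 0 := by
      have h1 : ∀ᵐ s : ℝ, s ≠ x.1 := Measure.ae_ne volume x.1
      have h2 := (Measure.quasiMeasurePreserving_fst (μ := (volume : Measure ℝ))
        (ν := (volume : Measure ℝ))).ae h1
      filter_upwards [h2] with y hy h
      exact hy (by simpa [sub_eq_zero, eq_comm] using h)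
    have h1 : ENNReal.ofReal |q x| ≤
        ∫⁻ y in cell, ENNReal.ofReal M * (k (x - y) * ENNReal.ofReal |a y|) := by
      rw [hqdef, ← Real.enorm_eq_ofReal_abs]
      refine (enorm_integral_le_lintegral_enorm _).trans ?_
      refine lintegral_mono_ae (ae_restrict_of_ae ?_)
      filter_upwards [hae] with y hy
      rw [enorm_mul, enorm_mul, Real.enorm_eq_ofReal_abs, Real.enorm_eq_ofReal_abs,
        Real.enorm_eq_ofReal_abs, abs_d₂_K hy]
      calc _ = ENNReal.ofReal |g y| * (k (x - y) * ENNReal.ofReal |a y|) := by rw [hk]; ring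
        _ ≤ _ := by gcongr; exact hg y
    have hm1 : Measurable fun y => k (x - y) := hkm.comp (by fun_prop)
    calc ENNReal.ofReal (|a x| * |q x|) = ENNReal.ofReal |a x| * ENNReal.ofReal |q x| :=
          ENNReal.ofReal_mul (abs_nonneg _)
      _ ≤ ENNReal.ofReal |a x| *
          ∫⁻ y in cell, ENNReal.ofReal M * (k (x - y) * ENNReal.ofReal |a y|) := by gcongr
      _ = ∫⁻ y in cell, ENNReal.ofReal M * (k (x - y) *
          (ENNReal.ofReal |a x| * ENNReal.ofReal |a y|)) := by
          rw [← lintegral_const_mul]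
          · refine lintegral_congr fun y => ?_
            ring
          · exact (hm1.mul ha.abs.measurable.ennreal_ofReal).const_mul _
      _ ≤ ∫⁻ y in cell, ENNReal.ofReal M * (k (x - y) * (φ x + φ y)) := by
          refine lintegral_mono fun y => ?_
          gcongr
          rw [← ENNReal.ofReal_mul (abs_nonneg _), hφ,
            ← ENNReal.ofReal_add (by positivity) (by positivity)]
          apply ENNReal.ofReal_le_ofReal
          rw [← sq_abs (a x), ← sq_abs (a y)]
          nlinarith [sq_nonneg (|a x| - |a y|)]
      _ = ENNReal.ofReal M * ((φ x * ∫⁻ y in cell, k (x - y)) +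
          ∫⁻ y in cell, k (x - y) * φ y) := by
          rw [lintegral_const_mul]
          · congr 1
            rw [← lintegral_const_mul _ hm1, ← lintegral_add_left (hm1.const_mul _)]
            refine lintegral_congr fun y => ?_
            ring
          · exact hm1.mul (hφm.const_add _)
      _ ≤ _ := by
          gcongr
          exact lintegral_cell_pKernel_le x
  have hQ' : ∀ z, ∫⁻ x₁, (Icc α β).indicator 1 x₁ * ∫⁻ y₂ in Ioc (0 : ℝ) 1, φ (x₁ - z, y₂) ≤
      ENNReal.ofReal (1 / 2 * Q) := by
    intro z
    have hin : ∀ s, ∫⁻ y₂ in Ioc (0 : ℝ) 1, φ (s, y₂) =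
        ENNReal.ofReal (1 / 2 * vavg (fun x => a x ^ 2) s) := by
      intro s
      have hc : Continuous fun y₂ => 1 / 2 * a (s, y₂) ^ 2 := by fun_prop
      rw [hφ, ← ofReal_integral_eq_lintegral_ofReal
        (hc.integrableOn_Ioc (a := (0 : ℝ)) (b := 1))
        (Eventually.of_forall fun y => by positivity), integral_const_mul, vavg,
        intervalIntegral.integral_of_le zero_le_one]
    have hvc : Continuous fun s => 1 / 2 * vavg (fun x => a x ^ 2) s := by
      unfold vavg
      refine continuous_const.mul ?_
      exact intervalIntegral.continuous_parametric_intervalIntegral_of_continuous'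
        (by fun_prop : Continuous (Function.uncurry fun s y => a (s, y) ^ 2)) _ _
    have hv0 : ∀ s, 0 ≤ 1 / 2 * vavg (fun x => a x ^ 2) s := fun s =>
      mul_nonneg (by norm_num)
        (intervalIntegral.integral_nonneg zero_le_one fun _ _ => sq_nonneg _)
    simp only [hin]
    calc ∫⁻ x₁, (Icc α β).indicator 1 x₁ *
          ENNReal.ofReal (1 / 2 * vavg (fun x => a x ^ 2) (x₁ - z))
        = ∫⁻ s, (Icc (α - z) (β - z)).indicator
            (fun s => ENNReal.ofReal (1 / 2 * vavg (fun x => a x ^ 2) s)) s := by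
          rw [← lintegral_sub_right_eq_self (μ := (volume : Measure ℝ))
            ((Icc (α - z) (β - z)).indicator
              fun s => ENNReal.ofReal (1 / 2 * vavg (fun x => a x ^ 2) s)) z]
          refine lintegral_congr fun x₁ => ?_
          by_cases hx : x₁ ∈ Icc α β
          · have : x₁ - z ∈ Icc (α - z) (β - z) := ⟨by linarith [hx.1], by linarith [hx.2]⟩
            simp [indicator_of_mem hx, indicator_of_mem this]
          · have : x₁ - z ∉ Icc (α - z) (β - z) := fun h =>
              hx ⟨by linarith [h.1], by linarith [h.2]⟩
            simp [indicator_of_notMem hx, indicator_of_notMem this]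
      _ = ENNReal.ofReal (∫ s in Icc (α - z) (β - z), 1 / 2 * vavg (fun x => a x ^ 2) s) := by
          rw [lintegral_indicator measurableSet_Icc, ofReal_integral_eq_lintegral_ofReal
            hvc.integrableOn_Icc (Eventually.of_forall hv0)]
      _ ≤ _ := by
          apply ENNReal.ofReal_le_ofReal
          rw [integral_const_mul]
          have := hQ z
          linarith
  have hQ0 : 0 ≤ Q := by
    refine le_trans ?_ (hQ 0)
    exact integral_nonneg fun s =>
      intervalIntegral.integral_nonneg zero_le_one fun _ _ => sq_nonneg _
  have hw : Measurable ((Icc α β).indicator (1 : ℝ → ℝ≥0∞)) :=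
    measurable_one.indicator measurableSet_Icc
  have hconv := lintegral_pKernel_conv_le hw hφm hQ'
  have hcm : Measurable fun x => ∫⁻ y in cell, k (x - y) * φ y :=
    Measurable.lintegral_prod_right' (f := fun p : (ℝ × ℝ) × (ℝ × ℝ) => k (p.1 - p.2) * φ p.2)
      ((hkm.comp (by fun_prop)).mul (hφm.comp measurable_snd))
  have hind : ∀ F : ℝ × ℝ → ℝ≥0∞, Measurable F → ∫⁻ x in Icc α β ×ˢ Icc (0 : ℝ) 1, F x =
      ∫⁻ x₁, (Icc α β).indicator 1 x₁ * ∫⁻ x₂ in Icc (0 : ℝ) 1, F (x₁, x₂) := by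
    intro F hF
    rw [Measure.volume_eq_prod, setLIntegral_prod _ hF.aemeasurable,
      ← lintegral_indicator measurableSet_Icc]
    refine lintegral_congr fun x₁ => ?_
    by_cases hx : x₁ ∈ Icc α β
    · simp [indicator_of_mem hx]
    · simp [indicator_of_notMem hx]
  have hφB : ∫⁻ x in Icc α β ×ˢ Icc (0 : ℝ) 1, φ x ≤ ENNReal.ofReal (1 / 2 * Q) := by
    rw [hind φ hφm]
    refine le_trans (le_of_eq ?_) (hQ' 0)
    refine lintegral_congr fun x₁ => ?_
    rw [sub_zero, setLIntegral_congr Ioc_ae_eq_Icc]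
  have hcB : Continuous fun x => |a x| * |q x| := by fun_prop
  have hcompact : IsCompact (Icc α β ×ˢ Icc (0 : ℝ) 1) := isCompact_Icc.prod isCompact_Icc
  have hfin : ENNReal.ofReal (∫ x in Icc α β ×ˢ Icc (0 : ℝ) 1, |a x| * |q x|) ≤
      ENNReal.ofReal (3 / 4 * (M * Q)) := by
    rw [ofReal_integral_eq_lintegral_ofReal (hcB.continuousOn.integrableOn_compact hcompact)
      (Eventually.of_forall fun x => by positivity)]
    calc _ ≤ ∫⁻ x in Icc α β ×ˢ Icc (0 : ℝ) 1, ENNReal.ofReal M *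
          (φ x * ENNReal.ofReal (1 / 2) + ∫⁻ y in cell, k (x - y) * φ y) := lintegral_mono hpt
      _ = ENNReal.ofReal M * ((∫⁻ x in Icc α β ×ˢ Icc (0 : ℝ) 1, φ x) * ENNReal.ofReal (1 / 2) +
          ∫⁻ x in Icc α β ×ˢ Icc (0 : ℝ) 1, ∫⁻ y in cell, k (x - y) * φ y) := by
          have hm : Measurable fun x =>
              φ x * ENNReal.ofReal (1 / 2) + ∫⁻ y in cell, k (x - y) * φ y :=
            (hφm.mul_const _).add hcm
          rw [lintegral_const_mul _ hm, lintegral_add_left (hφm.mul_const _), lintegral_mul_const _ hφm]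
      _ ≤ ENNReal.ofReal M * (ENNReal.ofReal (1 / 2 * Q) * ENNReal.ofReal (1 / 2) +
          ENNReal.ofReal (1 / 2 * Q)) := by
          gcongr
          rw [hind _ hcm]
          exact hconv
      _ = _ := by
          rw [← ENNReal.ofReal_mul (by positivity), ← ENNReal.ofReal_add (by positivity)
            (by positivity), ← ENNReal.ofReal_mul hM0]
          congr 1; ring
  exact (ENNReal.ofReal_le_ofReal_iff (by positivity)).1 hfin

end

/-! ### Wirtinger's inequality and the local energy identity. -/

/-- Wirtinger's inequality for periodic functions with zero mean. -/
theorem wirtinger {f f' : ℝ → ℝ} (hd : ∀ x, HasDerivAt f (f' x) x) (hc : Continuous f')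
    (hper : f 1 = f 0) (hmean : ∫ x in (0 : ℝ)..1, f x = 0) :
    4 * Real.pi ^ 2 * ∫ x in (0 : ℝ)..1, f x ^ 2 ≤ ∫ x in (0 : ℝ)..1, f' x ^ 2 := by
  have hcf : Continuous f := continuous_iff_continuousAt.2 fun x => (hd x).continuousAt
  have hsum : ∀ {g : ℝ → ℝ}, Continuous g →
      HasSum (fun n : ℤ => ‖fourierCoeffOn zero_lt_one (fun x => (g x : ℂ)) n‖ ^ 2)
        (∫ x in (0 : ℝ)..1, g x ^ 2) := by
    intro g hg
    have hg' : Continuous fun x => (g x : ℂ) := by fun_prop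
    have hL2 : MemLp (fun x => (g x : ℂ)) 2 (volume.restrict (Ioc (0 : ℝ) 1)) := by
      obtain ⟨C, hC⟩ := isCompact_Icc.exists_bound_of_continuousOn
        (hg'.continuousOn (s := Icc (0 : ℝ) 1))
      refine MemLp.of_bound hg'.aestronglyMeasurable C ?_
      filter_upwards [ae_restrict_mem measurableSet_Ioc] with x hx
      exact hC x ⟨hx.1.le, hx.2⟩
    have h := hasSum_sq_fourierCoeffOn zero_lt_one hL2
    simpa using h
  -- Parseval reduces the claim to single Fourier coefficients: the zeroth one vanishes by the mean
  -- condition, the others gain `(2πn)²` because periodicity removes the boundary term.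
  refine hasSum_le (fun n => ?_) ((hsum hcf).mul_left (4 * Real.pi ^ 2)) (hsum hc)
  rcases eq_or_ne n 0 with rfl | hn
  · have h0 : fourierCoeffOn zero_lt_one (fun x => (f x : ℂ)) 0 = 0 := by
      rw [fourierCoeffOn_eq_integral]
      simp [intervalIntegral.integral_ofReal, hmean]
    rw [h0]
    simp
  · have h := fourierCoeffOn_of_hasDerivAt zero_lt_one hn (f := fun x => (f x : ℂ))
      (f' := fun x => (f' x : ℂ)) (fun x _ => (hd x).ofReal_comp)
      ((by fun_prop : Continuous fun x => (f' x : ℂ)).intervalIntegrable _ _)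
    rw [h, hper]
    have h1 : (1 : ℝ) ≤ (n : ℝ) ^ 2 := by
      have : (1 : ℤ) ≤ n ^ 2 := Int.one_le_abs (pow_ne_zero 2 hn) |>.trans (by rw [abs_sq])
      exact_mod_cast this
    have hn' : (n : ℝ) ≠ 0 := Int.cast_ne_zero.2 hn
    obtain ⟨c, hcdef⟩ : ∃ c, c = fourierCoeffOn zero_lt_one (fun x => (f' x : ℂ)) n := ⟨_, rfl⟩
    rw [← hcdef]
    have h2 : ‖1 / (-2 * (Real.pi : ℂ) * Complex.I * n) *
        (fourier (-n) (((0 : ℝ) : AddCircle (1 - 0 : ℝ))) * ((f 0 : ℂ) - f 0) -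
          (((1 : ℝ) : ℂ) - ((0 : ℝ) : ℂ)) * c)‖ ^ 2 = ‖c‖ ^ 2 / (4 * Real.pi ^ 2 * (n : ℝ) ^ 2) := by
      simp only [sub_self, mul_zero, Complex.ofReal_one, Complex.ofReal_zero, sub_zero, zero_sub,
        one_mul, norm_mul, norm_neg, norm_div, norm_one, Complex.norm_I, mul_one, Complex.norm_ofNat,
        Complex.norm_real, Real.norm_eq_abs, mul_pow, div_pow, one_pow, sq_abs, Complex.norm_intCast]
      ring
    rw [h2]
    have hpi := Real.pi_pos
    rw [← mul_div_assoc, mul_div_mul_left _ _ (by positivity)]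
    exact div_le_self (sq_nonneg _) h1

theorem setIntegral_box {F : ℝ × ℝ → ℝ} (hF : Continuous F) (α β : ℝ) :
    ∫ x in Icc α β ×ˢ Icc (0 : ℝ) 1, F x = ∫ x₁ in Icc α β, vavg F x₁ := by
  rw [Measure.volume_eq_prod, setIntegral_prod]
  · simp only [vavg, integral_Icc_eq_integral_Ioc, intervalIntegral.integral_of_le zero_le_one]
  · exact hF.continuousOn.integrableOn_compact (isCompact_Icc.prod isCompact_Icc)

theorem continuous_vavg {F : ℝ × ℝ → ℝ} (hF : Continuous F) : Continuous (vavg F) := by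
  unfold vavg
  exact intervalIntegral.continuous_parametric_intervalIntegral_of_continuous'
    (by simpa [Function.uncurry_def] using hF) _ _

theorem vavg_mul_left (c : ℝ → ℝ) (h : ℝ × ℝ → ℝ) (x₁ : ℝ) :
    vavg (fun x => c x.1 * h x) x₁ = c x₁ * vavg h x₁ :=
  intervalIntegral.integral_const_mul (c x₁) fun s => h (x₁, s)

theorem setIntegral_box_mul_eq_zero {c : ℝ → ℝ} {h : ℝ × ℝ → ℝ} (hc : Continuous c)
    (hh : Continuous h) (hmean : ∀ x₁, vavg h x₁ = 0) (α β : ℝ) :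
    ∫ x in Icc α β ×ˢ Icc (0 : ℝ) 1, c x.1 * h x = 0 := by
  rw [setIntegral_box (by fun_prop)]
  simp [vavg_mul_left, hmean]

/-- Wirtinger's inequality in the vertical variable, with a horizontal weight. -/
theorem setIntegral_box_wirtinger {ψ : ℝ → ℝ} {h : ℝ × ℝ → ℝ} (hψ : Continuous ψ)
    (hψ0 : ∀ s, 0 ≤ ψ s) (hh : ContDiff ℝ ∞ h) (hper : ∀ x₁ x₂, h (x₁, x₂ + 1) = h (x₁, x₂))
    (hmean : ∀ x₁, vavg h x₁ = 0) (α β : ℝ) :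
    4 * Real.pi ^ 2 * ∫ x in Icc α β ×ˢ Icc (0 : ℝ) 1, ψ x.1 * h x ^ 2 ≤
      ∫ x in Icc α β ×ˢ Icc (0 : ℝ) 1, ψ x.1 * d₂ h x ^ 2 := by
  have h0 := hh.continuous
  have h2 := (contDiff_d₂ hh).continuous
  rw [setIntegral_box (by fun_prop), setIntegral_box (by fun_prop), ← integral_const_mul]
  have v0 : Continuous (vavg fun x => h x ^ 2) := continuous_vavg (by fun_prop)
  have v2 : Continuous (vavg fun x => d₂ h x ^ 2) := continuous_vavg (by fun_prop)
  simp only [fun x₁ => vavg_mul_left ψ (fun x => h x ^ 2) x₁,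
    fun x₁ => vavg_mul_left ψ (fun x => d₂ h x ^ 2) x₁]
  refine setIntegral_mono (by fun_prop : Continuous _).integrableOn_Icc
    (by fun_prop : Continuous _).integrableOn_Icc fun x₁ => ?_
  have hw := wirtinger (f := fun s => h (x₁, s)) (f' := fun s => d₂ h (x₁, s))
    (fun s => by
      have := hasDerivAt_d₂ (smooth_differentiable hh (x₁, s))
      rwa [← d₂_eq (smooth_differentiable hh (x₁, s))] at this) (by fun_prop)
    (by simpa using hper x₁ 0) (hmean x₁)
  have := mul_le_mul_of_nonneg_left hw (hψ0 x₁)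
  simp only [vavg]
  linarith

/-- The divergence theorem on a box with vertical period one. -/
theorem setIntegral_box_div_eq_zero {X Y : ℝ × ℝ → ℝ} (hX : ContDiff ℝ ∞ X) (hY : ContDiff ℝ ∞ Y)
    {α β : ℝ} (hαβ : α ≤ β) (hα : ∀ s, X (α, s) = 0) (hβ : ∀ s, X (β, s) = 0)
    (hper : ∀ x₁ x₂, Y (x₁, x₂ + 1) = Y (x₁, x₂)) :
    ∫ x in Icc α β ×ˢ Icc (0 : ℝ) 1, (d₁ X x + d₂ Y x) = 0 := by
  have h1 := (contDiff_d₁ hX).continuous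
  have h2 := (contDiff_d₂ hY).continuous
  have hdX := smooth_differentiable hX
  have hdY := smooth_differentiable hY
  have hcomp : IsCompact (Icc ((α, 0) : ℝ × ℝ) (β, 1)) := isCompact_Icc
  have hi : IntegrableOn (fun x => fderiv ℝ X x (1, 0) + fderiv ℝ Y x (0, 1))
      (Icc ((α, 0) : ℝ × ℝ) (β, 1)) := by
    simp only [← fun x => d₁_eq (hdX x), ← fun x => d₂_eq (hdY x)]
    exact (by fun_prop : Continuous fun x => d₁ X x + d₂ Y x).continuousOn.integrableOn_compact
      hcomp
  have key := integral_divergence_prod_Icc_of_hasFDerivAt_off_countable_of_le X Y (fderiv ℝ X)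
    (fderiv ℝ Y) ((α, 0) : ℝ × ℝ) (β, 1) ⟨hαβ, zero_le_one⟩ ∅ countable_empty
    hX.continuous.continuousOn hY.continuous.continuousOn (fun x _ => (hdX x).hasFDerivAt)
    (fun x _ => (hdY x).hasFDerivAt) hi
  have hY1 : ∀ x, Y (x, 1) = Y (x, 0) := fun x => by simpa using hper x 0
  simp only [hα, hβ, hY1, ← fun x => d₁_eq (hdX x), ← fun x => d₂_eq (hdY x), sub_self,
    intervalIntegral.integral_zero, add_zero] at key
  rwa [Icc_prod_Icc]

theorem hasDerivAt_slice₁ {f : ℝ × ℝ → ℝ} (hf : ContDiff ℝ ∞ f) (x : ℝ × ℝ) :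
    HasDerivAt (fun s => f (s, x.2)) (d₁ f x) x.1 := by
  rw [d₁_eq (smooth_differentiable hf x)]
  exact hasDerivAt_d₁ (smooth_differentiable hf x)

theorem hasDerivAt_slice₂ {f : ℝ × ℝ → ℝ} (hf : ContDiff ℝ ∞ f) (x : ℝ × ℝ) :
    HasDerivAt (fun s => f (x.1, s)) (d₂ f x) x.2 := by
  rw [d₂_eq (smooth_differentiable hf x)]
  exact hasDerivAt_d₂ (smooth_differentiable hf x)

/-- The local energy balance, with a horizontal cutoff. -/
theorem energy_flux_div {a h b p : ℝ × ℝ → ℝ} {ψ : ℝ → ℝ} (ha : ContDiff ℝ ∞ a)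
    (hh : ContDiff ℝ ∞ h) (hb : ContDiff ℝ ∞ b) (hp : ContDiff ℝ ∞ p) (hψ : ContDiff ℝ ∞ ψ)
    (hdiv : ∀ x, d₁ a x + d₂ b x = 0) (hbh : ∀ x, d₂ h x = d₂ b x) (x : ℝ × ℝ) :
    d₁ (fun x => ψ x.1 * (a x * d₁ a x + h x * d₁ h x - a x * p x -
        a x * ((a x ^ 2 + h x ^ 2) / 2)) - deriv ψ x.1 * ((a x ^ 2 + h x ^ 2) / 2)) x +
      d₂ (fun x => ψ x.1 * (a x * d₂ a x + h x * d₂ h x - h x * p x -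
        b x * ((a x ^ 2 + h x ^ 2) / 2))) x =
    ψ x.1 * (a x * (lap a x - d₁ p x - a x * d₁ a x - b x * d₂ a x) +
        h x * (lap h x - d₂ p x - a x * d₁ h x - b x * d₂ h x)) +
      ψ x.1 * (d₁ a x ^ 2 + d₂ a x ^ 2 + d₁ h x ^ 2 + d₂ h x ^ 2) -
      deriv (deriv ψ) x.1 * ((a x ^ 2 + h x ^ 2) / 2) -
      deriv ψ x.1 * (a x * (p x + (a x ^ 2 + h x ^ 2) / 2)) := by
  have hψ' : ContDiff ℝ ∞ (deriv ψ) := (contDiff_infty_iff_deriv.1 hψ).2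
  have k0 := (hψ.differentiable (by simp) x.1).hasDerivAt
  have k1 := (hψ'.differentiable (by simp) x.1).hasDerivAt
  have a1 := hasDerivAt_slice₁ ha x
  have a2 := hasDerivAt_slice₂ ha x
  have h1 := hasDerivAt_slice₁ hh x
  have h2 := hasDerivAt_slice₂ hh x
  have b2 := hasDerivAt_slice₂ hb x
  have p1 := hasDerivAt_slice₁ hp x
  have p2 := hasDerivAt_slice₂ hp x
  have a11 := hasDerivAt_slice₁ (contDiff_d₁ ha) x
  have a22 := hasDerivAt_slice₂ (contDiff_d₂ ha) x
  have h11 := hasDerivAt_slice₁ (contDiff_d₁ hh) x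
  have h22 := hasDerivAt_slice₂ (contDiff_d₂ hh) x
  have e1 := ((a1.fun_pow 2).fun_add (h1.fun_pow 2)).div_const 2
  have e2 := ((a2.fun_pow 2).fun_add (h2.fun_pow 2)).div_const 2
  have X := (k0.fun_mul ((((a1.fun_mul a11).fun_add (h1.fun_mul h11)).fun_sub
    (a1.fun_mul p1)).fun_sub (a1.fun_mul e1))).fun_sub (k1.fun_mul e1)
  have Y := ((((a2.fun_mul a22).fun_add (h2.fun_mul h22)).fun_sub
    (h2.fun_mul p2)).fun_sub (b2.fun_mul e2)).const_mul (ψ x.1)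
  refine (congrArg₂ (· + ·) X.deriv Y.deriv).trans ?_
  unfold lap
  norm_num only
  -- Incompressibility puts transport and pressure work in divergence form; `∂₂h = ∂₂b` lets the
  -- pressure work be tested with `h` in place of `b`.
  linear_combination (-(ψ x.1 * ((a x ^ 2 + h x ^ 2) / 2)) - ψ x.1 * p x) * hdiv x -
    ψ x.1 * p x * hbh x

/-! ### The localized energy and its balance. -/

/-- The pointwise energy density of the oscillating part. -/
def oscDensity (v : ℝ × ℝ → ℝ × ℝ) (x : ℝ × ℝ) : ℝ := (comp₁ v x ^ 2 + osc₂ v x ^ 2) / 2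

theorem oscDensity_nonneg (v : ℝ × ℝ → ℝ × ℝ) (x : ℝ × ℝ) : 0 ≤ oscDensity v x := by
  unfold oscDensity; positivity

theorem vavg_oscDensity (v : ℝ × ℝ → ℝ × ℝ) (x₁ : ℝ) :
    vavg (oscDensity v) x₁ = oscEnergy v x₁ := by
  simp only [vavg, oscEnergy, osc_fst, osc_snd, ← intervalIntegral.integral_const_mul]
  congr 1; funext s; unfold oscDensity; ring

theorem oscEnergy_nonneg (v : ℝ × ℝ → ℝ × ℝ) (x₁ : ℝ) : 0 ≤ oscEnergy v x₁ := by
  rw [← vavg_oscDensity]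
  exact intervalIntegral.integral_nonneg zero_le_one fun _ _ => oscDensity_nonneg _ _

theorem oscEnergy_le {v : ℝ × ℝ → ℝ × ℝ} {B : ℝ}
    (hB : ∀ x, |comp₁ v x| ≤ B ∧ |osc₂ v x| ≤ B) (x₁ : ℝ) : oscEnergy v x₁ ≤ B ^ 2 := by
  rw [← vavg_oscDensity]
  refine (le_abs_self _).trans (abs_vavg_le fun x => ?_)
  rw [abs_of_nonneg (oscDensity_nonneg _ _), oscDensity]
  have h1 := sq_le_sq' (abs_le.1 (hB x).1).1 (abs_le.1 (hB x).1).2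
  have h2 := sq_le_sq' (abs_le.1 (hB x).2).1 (abs_le.1 (hB x).2).2
  linarith

/-- The energy of the oscillating part, localized at the scale `ℓ` around `a`. -/
def locEnergy (ℓ a : ℝ) (v : ℝ × ℝ → ℝ × ℝ) : ℝ :=
  ∫ x in Icc (a - 2 * ℓ) (a + 2 * ℓ) ×ˢ Icc (0 : ℝ) 1, bumpAt ℓ a x.1 * oscDensity v x

section LocEnergy

variable {ℓ a : ℝ} {v : ℝ × ℝ → ℝ × ℝ}

theorem locEnergy_eq (hc : Continuous (oscDensity v)) :
    locEnergy ℓ a v = ∫ s in Icc (a - 2 * ℓ) (a + 2 * ℓ), bumpAt ℓ a s * oscEnergy v s := by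
  have := (contDiff_bumpAt ℓ a).continuous
  rw [locEnergy, setIntegral_box (by fun_prop)]
  simp only [fun x₁ => vavg_mul_left (bumpAt ℓ a) (oscDensity v) x₁, vavg_oscDensity]

theorem continuous_oscEnergy (hc : Continuous (oscDensity v)) : Continuous (oscEnergy v) := by
  simp only [← funext (vavg_oscDensity v)]
  exact continuous_vavg hc

theorem locEnergy_nonneg : 0 ≤ locEnergy ℓ a v :=
  integral_nonneg fun _ => mul_nonneg bumpAt_nonneg (oscDensity_nonneg _ _)

theorem locEnergy_le (hℓ : 0 < ℓ) (hc : Continuous (oscDensity v)) {B : ℝ}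
    (hB : ∀ x, |comp₁ v x| ≤ B ∧ |osc₂ v x| ≤ B) : locEnergy ℓ a v ≤ 4 * ℓ * B ^ 2 := by
  rw [locEnergy_eq hc]
  have h := norm_setIntegral_le_of_norm_le_const (μ := (volume : Measure ℝ))
    (s := Icc (a - 2 * ℓ) (a + 2 * ℓ)) (f := fun s => bumpAt ℓ a s * oscEnergy v s) (C := B ^ 2)
    (by simp) fun s _ => by
      rw [Real.norm_of_nonneg (mul_nonneg bumpAt_nonneg (oscEnergy_nonneg _ _))]
      exact (mul_le_of_le_one_left (oscEnergy_nonneg _ _) bumpAt_le_one).trans (oscEnergy_le hB s)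
  refine (le_abs_self _).trans (h.trans (le_of_eq ?_))
  rw [Real.volume_real_Icc_of_le (by linarith)]
  ring

theorem integral_le_locEnergy (hℓ : 0 < ℓ) (hc : Continuous (oscDensity v)) {α β : ℝ}
    (hαβ : α ≤ β) (hα : a - ℓ ≤ α) (hβ : β ≤ a + ℓ) :
    ∫ s in α..β, oscEnergy v s ≤ locEnergy ℓ a v := by
  have he := continuous_oscEnergy hc
  have hψ := (contDiff_bumpAt ℓ a).continuous
  rw [locEnergy_eq hc, intervalIntegral.integral_of_le hαβ, ← integral_Icc_eq_integral_Ioc]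
  calc ∫ s in Icc α β, oscEnergy v s = ∫ s in Icc α β, bumpAt ℓ a s * oscEnergy v s := by
        refine setIntegral_congr_fun measurableSet_Icc fun s hs => ?_
        have : bumpAt ℓ a s = 1 :=
          bumpAt_eq_one hℓ (abs_le.2 ⟨by linarith [hs.1], by linarith [hs.2]⟩)
        simp only [this, one_mul]
    _ ≤ _ := by
        refine setIntegral_mono_set (by fun_prop : Continuous _).integrableOn_Icc
          (Eventually.of_forall fun s => mul_nonneg bumpAt_nonneg (oscEnergy_nonneg _ _))
          (LE.le.eventuallyLE (Icc_subset_Icc (by linarith) (by linarith)))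

/-- The support of one cut-off is covered by the plateaus of the three cut-offs centred at `a - 2ℓ`,
`a` and `a + 2ℓ`. -/
theorem integral_oscEnergy_le_of_locEnergy_le (hℓ : 0 < ℓ) (hc : Continuous (oscDensity v)) {S : ℝ}
    (hS : ∀ a, locEnergy ℓ a v ≤ S) (a : ℝ) :
    ∫ s in Icc (a - 2 * ℓ) (a + 2 * ℓ), oscEnergy v s ≤ 3 * S := by
  have hi : ∀ α β, IntervalIntegrable (oscEnergy v) volume α β :=
    fun α β => (continuous_oscEnergy hc).intervalIntegrable α β
  rw [integral_Icc_eq_integral_Ioc, ← intervalIntegral.integral_of_le (by linarith),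
    ← intervalIntegral.integral_add_adjacent_intervals (hi _ (a - ℓ)) (hi _ _),
    ← intervalIntegral.integral_add_adjacent_intervals (hi (a - ℓ) (a + ℓ)) (hi _ _)]
  have h1 := integral_le_locEnergy (a := a - 2 * ℓ) hℓ hc (α := a - 2 * ℓ) (β := a - ℓ)
    (by linarith) (by linarith) (by linarith)
  have h2 := integral_le_locEnergy (a := a) hℓ hc (α := a - ℓ) (β := a + ℓ)
    (by linarith) (by linarith) (by linarith)
  have h3 := integral_le_locEnergy (a := a + 2 * ℓ) hℓ hc (α := a + ℓ) (β := a + 2 * ℓ)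
    (by linarith) (by linarith) (by linarith)
  linarith [hS (a - 2 * ℓ), hS a, hS (a + 2 * ℓ)]

end LocEnergy

theorem d₂_K_periodic (x₁ x₂ : ℝ) : d₂ K (x₁, x₂ + 1) = d₂ K (x₁, x₂) := by
  refine d₂_periodic (fun x₁ x₂ => ?_) x₁ x₂
  simp only [K, mul_add, mul_one, Real.cos_add_two_pi]

namespace IsNSSolution

variable {u : ℝ → ℝ × ℝ → ℝ × ℝ} (hu : IsNSSolution u)
include hu

theorem pressure_periodic {t : ℝ} (ht : 0 ≤ t) (x₁ x₂ : ℝ) :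
    pressure (u t) (x₁, x₂ + 1) = pressure (u t) (x₁, x₂) := by
  have h : ∀ y : ℝ × ℝ, d₂ K ((x₁, x₂ + 1) - y) = d₂ K ((x₁, x₂) - y) := fun y => by
    have := d₂_K_periodic (x₁ - y.1) (x₂ - y.2)
    rwa [← add_sub_right_comm] at this
  simp only [pressure, (hu.buc t ht).periodic, h]

theorem osc₂_periodic {t : ℝ} (ht : 0 ≤ t) (x₁ x₂ : ℝ) :
    osc₂ (u t) (x₁, x₂ + 1) = osc₂ (u t) (x₁, x₂) := by
  simp only [osc₂, hu.periodic₂ ht]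

/-- The evolution equation of the vertical component of the oscillating part. -/
theorem dt_osc₂ {t : ℝ} (ht : 0 < t) : ∃ c : ℝ → ℝ, Continuous c ∧ ∀ x,
    dt (fun t => osc₂ (u t)) t x = (lap (osc₂ (u t)) x - d₂ (pressure (u t)) x -
      comp₁ (u t) x * d₁ (osc₂ (u t)) x - comp₂ (u t) x * d₂ (osc₂ (u t)) x) -
      comp₁ (u t) x * vavg (vort (u t)) x.1 + c x.1 := by
  have hm := hu.contDiff_mean ht
  have hb := hu.contDiff₂ ht
  have hmt := hu.smoothOn₂.vavg isOpen_Ioi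
  have hmt' : Continuous (dt (fun t x => vavg (comp₂ (u t)) x.1) t) :=
    ((hmt.dt isOpen_Ioi).slice isOpen_Ioi ht).continuous
  have hm2 := (contDiff_d₁ (contDiff_d₁ hm)).continuous
  -- Here `c = ∂₁²m - ∂ₜm`. Its form is irrelevant: a function of `x₁` alone is orthogonal to the
  -- zero-mean `û₂`, so no equation for `m` is needed.
  refine ⟨fun s => d₁ (d₁ fun x => vavg (comp₂ (u t)) x.1) (s, 0) -
    dt (fun t x => vavg (comp₂ (u t)) x.1) t (s, 0), by fun_prop, fun x => ?_⟩
  have e0 : dt (fun t => osc₂ (u t)) t x = dt (fun t => comp₂ (u t)) t x -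
      dt (fun t x => vavg (comp₂ (u t)) x.1) t x :=
    ((hu.smoothOn₂.hasDerivAt_dt isOpen_Ioi ht).sub (hmt.hasDerivAt_dt isOpen_Ioi ht)).deriv
  have e1 : d₁ (osc₂ (u t)) = fun z => d₁ (comp₂ (u t)) z -
      d₁ (fun x => vavg (comp₂ (u t)) x.1) z :=
    funext fun z => d₁_sub (smooth_differentiable hb z) (smooth_differentiable hm z)
  have e2 : d₂ (osc₂ (u t)) = d₂ (comp₂ (u t)) := funext fun z => hu.d₂_osc₂ ht z
  have e3 : d₁ (d₁ (osc₂ (u t))) x = d₁ (d₁ (comp₂ (u t))) x -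
      d₁ (d₁ fun x => vavg (comp₂ (u t)) x.1) x := by
    rw [e1]
    exact d₁_sub (smooth_differentiable (contDiff_d₁ hb) x)
      (smooth_differentiable (contDiff_d₁ hm) x)
  have e4 : d₁ (d₁ fun x => vavg (comp₂ (u t)) x.1) (x.1, 0) =
      d₁ (d₁ fun x => vavg (comp₂ (u t)) x.1) x := rfl
  have e5 : dt (fun t x => vavg (comp₂ (u t)) x.1) t (x.1, 0) =
      dt (fun t x => vavg (comp₂ (u t)) x.1) t x := rfl
  have e6 := hu.d₁_osc₂ ht x
  have hmom := hu.momentum₂ t ht x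
  have e7 : dt (fun t => comp₂ (u t)) t x = deriv (fun s => (u s x).2) t := rfl
  simp only [e4, e5]
  rw [e0, e7, e6, e2]
  unfold lap at hmom ⊢
  rw [e3, e2]
  simp only [← show comp₁ (u t) x = (u t x).1 from rfl,
    ← show comp₂ (u t) x = (u t x).2 from rfl] at hmom
  linear_combination hmom

/-- The balance of the local energy of the oscillating part. -/
theorem hasDerivAt_locEnergy {ℓ t : ℝ} (hℓ : 0 < ℓ) (ht : 0 < t) (a : ℝ) :
    HasDerivAt (fun t => locEnergy ℓ a (u t))
      (∫ x in Icc (a - 2 * ℓ) (a + 2 * ℓ) ×ˢ Icc (0 : ℝ) 1,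
        (deriv (deriv (bumpAt ℓ a)) x.1 * oscDensity (u t) x +
          deriv (bumpAt ℓ a) x.1 * (comp₁ (u t) x * (pressure (u t) x + oscDensity (u t) x)) -
          bumpAt ℓ a x.1 * (d₁ (comp₁ (u t)) x ^ 2 + d₂ (comp₁ (u t)) x ^ 2 +
            d₁ (osc₂ (u t)) x ^ 2 + d₂ (osc₂ (u t)) x ^ 2) -
          bumpAt ℓ a x.1 * (vavg (vort (u t)) x.1 * (comp₁ (u t) x * osc₂ (u t) x)))) t := by
  have hA := hu.contDiff₁ ht
  have hb := hu.contDiff₂ ht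
  have hH := hu.smoothOn_osc₂.slice isOpen_Ioi ht
  have hp := hu.contDiff_pressure ht
  have hψ := contDiff_bumpAt ℓ a
  have hψ' : ContDiff ℝ ∞ (deriv (bumpAt ℓ a)) := (contDiff_infty_iff_deriv.1 hψ).2
  have hψ'' : ContDiff ℝ ∞ (deriv (deriv (bumpAt ℓ a))) := (contDiff_infty_iff_deriv.1 hψ').2
  have hw : ContDiff ℝ ∞ (vort (u t)) := hu.smoothOn_vort.slice isOpen_Ioi ht
  have hcomp : IsCompact (Icc (a - 2 * ℓ) (a + 2 * ℓ) ×ˢ Icc (0 : ℝ) 1) :=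
    isCompact_Icc.prod isCompact_Icc
  have hsm : SmoothOn (Ioi 0) fun t x => bumpAt ℓ a x.1 * oscDensity (u t) x := by
    refine SmoothOn.mul (SmoothOn.of_space (hψ.comp contDiff_fst)) ?_
    have h2 := ((hu.smoothOn₁.mul hu.smoothOn₁).add (hu.smoothOn_osc₂.mul hu.smoothOn_osc₂)).mul
      (SmoothOn.of_space (contDiff_const (c := (1 / 2 : ℝ))))
    refine h2.congr fun t _ x => ?_
    unfold oscDensity; ring
  obtain ⟨c, hc, hdt⟩ := hu.dt_osc₂ ht
  refine (show HasDerivAt (fun t => locEnergy ℓ a (u t)) _ t from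
    hsm.hasDerivAt_setIntegral isOpen_Ioi hcomp ht).congr_deriv ?_
  symm
  have hmom : ∀ x, dt (fun t => comp₁ (u t)) t x = lap (comp₁ (u t)) x - d₁ (pressure (u t)) x -
      comp₁ (u t) x * d₁ (comp₁ (u t)) x - comp₂ (u t) x * d₂ (comp₁ (u t)) x := fun x => by
    have := hu.momentum₁ t ht x
    simp only [dt, comp₁, comp₂] at *; linarith
  have hdens : ∀ x, dt (fun t x => bumpAt ℓ a x.1 * oscDensity (u t) x) t x = bumpAt ℓ a x.1 *
      (comp₁ (u t) x * dt (fun t => comp₁ (u t)) t x +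
        osc₂ (u t) x * dt (fun t => osc₂ (u t)) t x) := fun x => by
    have h1 := hu.smoothOn₁.hasDerivAt_dt isOpen_Ioi ht (x := x)
    have h2 := hu.smoothOn_osc₂.hasDerivAt_dt isOpen_Ioi ht (x := x)
    refine ((((h1.fun_pow 2).fun_add (h2.fun_pow 2)).div_const 2).const_mul _).deriv.trans ?_
    norm_num only
    ring
  set X : ℝ × ℝ → ℝ := fun x => bumpAt ℓ a x.1 * (comp₁ (u t) x * d₁ (comp₁ (u t)) x +
    osc₂ (u t) x * d₁ (osc₂ (u t)) x - comp₁ (u t) x * pressure (u t) x -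
    comp₁ (u t) x * ((comp₁ (u t) x ^ 2 + osc₂ (u t) x ^ 2) / 2)) -
    deriv (bumpAt ℓ a) x.1 * ((comp₁ (u t) x ^ 2 + osc₂ (u t) x ^ 2) / 2) with hX
  set Y : ℝ × ℝ → ℝ := fun x => bumpAt ℓ a x.1 * (comp₁ (u t) x * d₂ (comp₁ (u t)) x +
    osc₂ (u t) x * d₂ (osc₂ (u t)) x - osc₂ (u t) x * pressure (u t) x -
    comp₂ (u t) x * ((comp₁ (u t) x ^ 2 + osc₂ (u t) x ^ 2) / 2)) with hY
  have hA1 := contDiff_d₁ hA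
  have hA2 := contDiff_d₂ hA
  have hH1 := contDiff_d₁ hH
  have hH2 := contDiff_d₂ hH
  have hXs : ContDiff ℝ ∞ X := by
    have k0 : ContDiff ℝ ∞ fun x : ℝ × ℝ => bumpAt ℓ a x.1 := hψ.comp contDiff_fst
    have k1 : ContDiff ℝ ∞ fun x : ℝ × ℝ => deriv (bumpAt ℓ a) x.1 := hψ'.comp contDiff_fst
    fun_prop
  have hYs : ContDiff ℝ ∞ Y := by
    have k0 : ContDiff ℝ ∞ fun x : ℝ × ℝ => bumpAt ℓ a x.1 := hψ.comp contDiff_fst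
    fun_prop
  -- At the ends of the box the cut-off attains its minimum `0`, so its derivative vanishes too and
  -- the horizontal flux `X` is zero there.
  have hz : ∀ s, 2 * ℓ ≤ |s - a| → bumpAt ℓ a s = 0 ∧ deriv (bumpAt ℓ a) s = 0 := fun s hs => by
    have h0 := bumpAt_eq_zero hℓ hs
    refine ⟨h0, IsLocalMin.deriv_eq_zero (Eventually.of_forall fun r => ?_)⟩
    rw [h0]; exact bumpAt_nonneg
  have hdiv := setIntegral_box_div_eq_zero hXs hYs (α := a - 2 * ℓ) (β := a + 2 * ℓ) (by linarith)
    (fun s => by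
      obtain ⟨h1, h2⟩ := hz (a - 2 * ℓ) (by rw [sub_sub_cancel_left, abs_neg]; exact le_abs_self _)
      simp [hX, h1, h2])
    (fun s => by
      obtain ⟨h1, h2⟩ := hz (a + 2 * ℓ) (by rw [add_sub_cancel_left]; exact le_abs_self _)
      simp [hX, h1, h2])
    (fun x₁ x₂ => by
      simp only [hY, hu.periodic₁ ht.le, hu.periodic₂ ht.le, hu.osc₂_periodic ht.le,
        hu.pressure_periodic ht.le, d₂_periodic (hu.periodic₁ ht.le),
        d₂_periodic (hu.osc₂_periodic ht.le)])
  have hzero := setIntegral_box_mul_eq_zero (c := fun s => bumpAt ℓ a s * c s)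
    (hψ.continuous.mul hc) hH.continuous (hu.vavg_osc₂ ht.le) (a - 2 * ℓ) (a + 2 * ℓ)
  have hflux := energy_flux_div hA hH hb hp hψ (hu.divFree t ht) (hu.d₂_osc₂ ht)
  have hint : ∀ F : ℝ × ℝ → ℝ, Continuous F →
      IntegrableOn F (Icc (a - 2 * ℓ) (a + 2 * ℓ) ×ˢ Icc (0 : ℝ) 1) :=
    fun F hF => hF.continuousOn.integrableOn_compact hcomp
  have hdX := (contDiff_d₁ hXs).continuous
  have hdY := (contDiff_d₂ hYs).continuous
  have hHc := hH.continuous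
  have hψc := hψ.continuous
  have hWc : Continuous (vavg (vort (u t))) := continuous_vavg hw.continuous
  have hdensc : Continuous (dt (fun t x => bumpAt ℓ a x.1 * oscDensity (u t) x) t) :=
    ((hsm.dt isOpen_Ioi).slice isOpen_Ioi ht).continuous
  have hpt : ∀ x, deriv (deriv (bumpAt ℓ a)) x.1 * oscDensity (u t) x +
          deriv (bumpAt ℓ a) x.1 * (comp₁ (u t) x * (pressure (u t) x + oscDensity (u t) x)) -
          bumpAt ℓ a x.1 * (d₁ (comp₁ (u t)) x ^ 2 + d₂ (comp₁ (u t)) x ^ 2 +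
            d₁ (osc₂ (u t)) x ^ 2 + d₂ (osc₂ (u t)) x ^ 2) -
          bumpAt ℓ a x.1 * (vavg (vort (u t)) x.1 * (comp₁ (u t) x * osc₂ (u t) x)) =
      dt (fun t x => bumpAt ℓ a x.1 * oscDensity (u t) x) t x - (d₁ X x + d₂ Y x) -
        bumpAt ℓ a x.1 * c x.1 * osc₂ (u t) x := fun x => by
    rw [hdens, hmom, hdt, hflux x]
    unfold oscDensity
    ring
  refine (integral_congr_ae (Eventually.of_forall hpt)).trans ?_
  have i1 := hint _ hdensc
  have i2 := hint (fun x => d₁ X x + d₂ Y x) (by fun_prop)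
  have i3 := hint (fun x => bumpAt ℓ a x.1 * c x.1 * osc₂ (u t) x) (by fun_prop)
  have i4 := hint (fun x => dt (fun t x => bumpAt ℓ a x.1 * oscDensity (u t) x) t x -
    (d₁ X x + d₂ Y x)) (by fun_prop)
  rw [integral_sub i4 i3, integral_sub i1 i2, hdiv, hzero, sub_zero, sub_zero]

end IsNSSolution

/-! ### The differential inequality for the local energy. -/

/-- The localization scale. -/
def locScale : ℝ := 50000 * bumpC

theorem one_le_locScale : 1 ≤ locScale := by
  have := one_le_bumpC
  unfold locScale; linarith

theorem locScale_pos : 0 < locScale := one_pos.trans_le one_le_locScale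

namespace IsNSSolution

variable {u : ℝ → ℝ × ℝ → ℝ × ℝ} (hu : IsNSSolution u)
include hu

theorem continuous_oscDensity {t : ℝ} (ht : 0 < t) : Continuous (oscDensity (u t)) := by
  have h1 := (hu.contDiff₁ ht).continuous
  have h2 := (hu.smoothOn_osc₂.slice isOpen_Ioi ht).continuous
  unfold oscDensity
  fun_prop

/-- The differential inequality satisfied by the local energy. -/
theorem exists_hasDerivAt_locEnergy_le {M S t : ℝ} (ht : 0 < t)
    (hmean : ∀ x₁, vavg (comp₁ (u t)) x₁ = 0) (hM : ∀ x, |vort (u t) x| ≤ M) (hM40 : M ≤ 40)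
    (hS : ∀ a, locEnergy locScale a (u t) ≤ S) (a : ℝ) :
    ∃ D, HasDerivAt (fun t => locEnergy locScale a (u t)) D t ∧
      D ≤ -(8 * Real.pi ^ 2 - M) * locEnergy locScale a (u t) + S := by
  obtain ⟨ℓ, hℓdef⟩ : ∃ ℓ, ℓ = locScale := ⟨_, rfl⟩
  have hℓ1 : 1 ≤ ℓ := hℓdef ▸ one_le_locScale
  have hℓ : 0 < ℓ := one_pos.trans_le hℓ1
  have hc1 := one_le_bumpC
  have hcℓ : bumpC / ℓ = 1 / 50000 := by rw [hℓdef, locScale]; field_simp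
  have hcℓ2 : bumpC / ℓ ^ 2 ≤ 1 / 50000 := by
    rw [← hcℓ]; gcongr; nlinarith
  rw [← hℓdef] at hS ⊢
  refine ⟨_, hu.hasDerivAt_locEnergy hℓ ht a, ?_⟩
  have hM0 : 0 ≤ M := (abs_nonneg _).trans (hM 0)
  have hA := hu.contDiff₁ ht
  have hH := hu.smoothOn_osc₂.slice isOpen_Ioi ht
  have hp := hu.contDiff_pressure ht
  have hψ := contDiff_bumpAt ℓ a
  have hψ' : ContDiff ℝ ∞ (deriv (bumpAt ℓ a)) := (contDiff_infty_iff_deriv.1 hψ).2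
  have hψ'' : ContDiff ℝ ∞ (deriv (deriv (bumpAt ℓ a))) := (contDiff_infty_iff_deriv.1 hψ').2
  have hw : ContDiff ℝ ∞ (vort (u t)) := hu.smoothOn_vort.slice isOpen_Ioi ht
  have hW : ∀ s, |vavg (vort (u t)) s| ≤ M := fun s => abs_vavg_le hM
  have hosc := hu.abs_osc_le ht hmean hM
  have hden := hu.continuous_oscDensity ht
  obtain ⟨q, hqdef⟩ : ∃ q : ℝ × ℝ → ℝ, ∀ x, q x =
      ∫ y in cell, d₂ K (x - y) * (vort (u t) y * comp₁ (u t) y) := ⟨_, fun _ => rfl⟩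
  have hpq : ∀ x, pressure (u t) x = -comp₁ (u t) x ^ 2 - 2 * q x := fun x => by
    rw [hqdef]; rfl
  have hAc := hA.continuous
  have hHc := hH.continuous
  have hpc := hp.continuous
  have hqc : Continuous q := by
    have : q = fun x => -(pressure (u t) x + comp₁ (u t) x ^ 2) / 2 := by
      funext x; rw [hpq]; ring
    rw [this]; fun_prop
  have hcomp : IsCompact (Icc (a - 2 * ℓ) (a + 2 * ℓ) ×ˢ Icc (0 : ℝ) 1) :=
    isCompact_Icc.prod isCompact_Icc
  have hint : ∀ F : ℝ × ℝ → ℝ, Continuous F →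
      IntegrableOn F (Icc (a - 2 * ℓ) (a + 2 * ℓ) ×ˢ Icc (0 : ℝ) 1) :=
    fun F hF => hF.continuousOn.integrableOn_compact hcomp
  have hS3 := integral_oscEnergy_le_of_locEnergy_le hℓ hden hS
  have hflux := integral_nonlocal_flux_le (α := a - 2 * ℓ) (β := a + 2 * ℓ) (Q := 6 * S) hAc hqc hM
    hqdef fun z => by
      have h1 : ∀ s, vavg (fun x => comp₁ (u t) x ^ 2) s ≤ 2 * oscEnergy (u t) s := fun s => by
        rw [← vavg_oscDensity, vavg, vavg, ← intervalIntegral.integral_const_mul]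
        refine intervalIntegral.integral_mono_on zero_le_one
          ((by fun_prop : Continuous fun r => comp₁ (u t) (s, r) ^ 2).intervalIntegrable _ _)
          ((by fun_prop : Continuous fun r => 2 * oscDensity (u t) (s, r)).intervalIntegrable _ _)
          fun r _ => ?_
        unfold oscDensity
        linarith [sq_nonneg (osc₂ (u t) (s, r))]
      have h2 := hS3 (a - z)
      rw [show a - z - 2 * ℓ = a - 2 * ℓ - z by ring,
        show a - z + 2 * ℓ = a + 2 * ℓ - z by ring] at h2
      have hv : Continuous (vavg fun x => comp₁ (u t) x ^ 2) := continuous_vavg (by fun_prop)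
      have he := continuous_oscEnergy hden
      calc _ ≤ ∫ s in Icc (a - 2 * ℓ - z) (a + 2 * ℓ - z), 2 * oscEnergy (u t) s :=
            setIntegral_mono hv.integrableOn_Icc
              (by fun_prop : Continuous fun s => 2 * oscEnergy (u t) s).integrableOn_Icc h1
        _ ≤ 6 * S := by rw [integral_const_mul]; linarith
  have hε3 : ∫ x in Icc (a - 2 * ℓ) (a + 2 * ℓ) ×ˢ Icc (0 : ℝ) 1, oscDensity (u t) x ≤ 3 * S := by
    rw [setIntegral_box hden]
    simpa only [vavg_oscDensity] using hS3 a
  have hS0 : 0 ≤ S := locEnergy_nonneg.trans (hS a)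
  -- Added together, the two Wirtinger inequalities give dissipation at least `4π² · 2E = 8π² E`.
  have wA := setIntegral_box_wirtinger hψ.continuous (fun s => bumpAt_nonneg) hA
    (hu.periodic₁ ht.le) hmean (a - 2 * ℓ) (a + 2 * ℓ)
  have wH := setIntegral_box_wirtinger hψ.continuous (fun s => bumpAt_nonneg) hH
    (hu.osc₂_periodic ht.le) (hu.vavg_osc₂ ht.le) (a - 2 * ℓ) (a + 2 * ℓ)
  have hA1 := (contDiff_d₁ hA).continuous
  have hA2 := (contDiff_d₂ hA).continuous
  have hH1 := (contDiff_d₁ hH).continuous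
  have hH2 := (contDiff_d₂ hH).continuous
  have hψc := hψ.continuous
  have hψ'c := hψ'.continuous
  have hψ''c := hψ''.continuous
  have hWc : Continuous (vavg (vort (u t))) := continuous_vavg hw.continuous
  have i1 := hint (fun x => bumpAt ℓ a x.1 * comp₁ (u t) x ^ 2) (by fun_prop)
  have i2 := hint (fun x => bumpAt ℓ a x.1 * osc₂ (u t) x ^ 2) (by fun_prop)
  have hE : ∫ x in Icc (a - 2 * ℓ) (a + 2 * ℓ) ×ˢ Icc (0 : ℝ) 1, bumpAt ℓ a x.1 * comp₁ (u t) x ^ 2 +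
      bumpAt ℓ a x.1 * osc₂ (u t) x ^ 2 = 2 * locEnergy ℓ a (u t) := by
    rw [locEnergy, ← integral_const_mul]
    congr 1; funext x; unfold oscDensity; ring
  rw [integral_add i1 i2] at hE
  obtain ⟨k, hk⟩ : ∃ k : ℝ, k = 1 / 50000 * (1 + 408 * M) := ⟨_, rfl⟩
  have hpt : ∀ x, deriv (deriv (bumpAt ℓ a)) x.1 * oscDensity (u t) x +
          deriv (bumpAt ℓ a) x.1 * (comp₁ (u t) x * (pressure (u t) x + oscDensity (u t) x)) -
          bumpAt ℓ a x.1 * (d₁ (comp₁ (u t)) x ^ 2 + d₂ (comp₁ (u t)) x ^ 2 +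
            d₁ (osc₂ (u t)) x ^ 2 + d₂ (osc₂ (u t)) x ^ 2) -
          bumpAt ℓ a x.1 * (vavg (vort (u t)) x.1 * (comp₁ (u t) x * osc₂ (u t) x)) ≤
      k * oscDensity (u t) x + 1 / 25000 * (|comp₁ (u t) x| * |q x|) +
        M * (bumpAt ℓ a x.1 * oscDensity (u t) x) - bumpAt ℓ a x.1 * d₂ (comp₁ (u t)) x ^ 2 -
        bumpAt ℓ a x.1 * d₂ (osc₂ (u t)) x ^ 2 := fun x => by
    have hψ0 : 0 ≤ bumpAt ℓ a x.1 := bumpAt_nonneg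
    have hε0 := oscDensity_nonneg (u t) x
    have b1 : deriv (deriv (bumpAt ℓ a)) x.1 * oscDensity (u t) x ≤
        1 / 50000 * oscDensity (u t) x := by
      gcongr
      exact (le_abs_self _).trans ((abs_deriv_deriv_bumpAt_le hℓ).trans hcℓ2)
    have b2 : deriv (bumpAt ℓ a) x.1 *
        (comp₁ (u t) x * (pressure (u t) x + oscDensity (u t) x)) ≤
        1 / 50000 * (408 * M * oscDensity (u t) x + 2 * (|comp₁ (u t) x| * |q x|)) := by
      refine (le_abs_self _).trans ?_
      rw [abs_mul]
      refine mul_le_mul ((abs_deriv_bumpAt_le hℓ).trans_eq hcℓ) ?_ (abs_nonneg _) (by norm_num)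
      rw [abs_mul, hpq]
      -- The local part of `p + e` is at most `3e`; with `|u₁| ≤ 136 M` this produces `408 M`.
      have c1 : |-comp₁ (u t) x ^ 2 - 2 * q x + oscDensity (u t) x| ≤
          3 * oscDensity (u t) x + 2 * |q x| := by
        have := abs_le.1 (le_refl |q x|)
        have s1 := sq_nonneg (comp₁ (u t) x)
        have s2 := sq_nonneg (osc₂ (u t) x)
        unfold oscDensity
        rw [abs_le]; constructor <;> linarith
      calc _ ≤ |comp₁ (u t) x| * (3 * oscDensity (u t) x + 2 * |q x|) := by gcongr
        _ = |comp₁ (u t) x| * (3 * oscDensity (u t) x) + 2 * (|comp₁ (u t) x| * |q x|) := by ring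
        _ ≤ 136 * M * (3 * oscDensity (u t) x) + 2 * (|comp₁ (u t) x| * |q x|) := by
          gcongr; exact (hosc x).1
        _ = _ := by ring
    have b3 : -(bumpAt ℓ a x.1 * (vavg (vort (u t)) x.1 * (comp₁ (u t) x * osc₂ (u t) x))) ≤
        M * (bumpAt ℓ a x.1 * oscDensity (u t) x) := by
      have c2 : |comp₁ (u t) x * osc₂ (u t) x| ≤ oscDensity (u t) x := by
        unfold oscDensity
        rw [abs_le]; constructor <;>
          linarith [sq_nonneg (comp₁ (u t) x + osc₂ (u t) x),
            sq_nonneg (comp₁ (u t) x - osc₂ (u t) x)]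
      have c3 : |vavg (vort (u t)) x.1 * (comp₁ (u t) x * osc₂ (u t) x)| ≤
          M * oscDensity (u t) x := by
        rw [abs_mul]; gcongr; exact hW _
      have c4 := mul_le_mul_of_nonneg_left (neg_le_of_abs_le c3) hψ0
      linarith
    -- The horizontal part of the dissipation is discarded.
    have b4 : 0 ≤ bumpAt ℓ a x.1 * (d₁ (comp₁ (u t)) x ^ 2 + d₁ (osc₂ (u t)) x ^ 2) := by
      positivity
    rw [hk]
    linarith
  refine (setIntegral_mono (hint _ (by fun_prop)) (hint _ (by fun_prop)) hpt).trans ?_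
  rw [integral_sub (hint _ (by fun_prop)) (hint _ (by fun_prop)),
    integral_sub (hint _ (by fun_prop)) (hint _ (by fun_prop)),
    integral_add (hint _ (by fun_prop)) (hint _ (by fun_prop)),
    integral_add (hint _ (by fun_prop)) (hint _ (by fun_prop)), integral_const_mul,
    integral_const_mul, integral_const_mul, ← locEnergy]
  have hE' := congrArg (4 * Real.pi ^ 2 * ·) hE
  simp only [mul_add] at hE'
  have hk0 : 0 ≤ k := by rw [hk]; positivity
  have f1 := mul_le_mul_of_nonneg_left hε3 hk0
  -- This fixes the factor `50000` in `locScale`: with `M ≤ 40` the flux terms total just under `S`.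
  have f2 : k * (3 * S) + 1 / 25000 * (3 / 4 * (M * (6 * S))) ≤ S := by
    have f3 : M * S ≤ 40 * S := by gcongr
    rw [hk]
    linarith
  linarith

end IsNSSolution

/-! ### Absorption of the forcing and exponential decay. -/

/-- A differential inequality with decay: `G` stays below its initial bound plus half of the
forcing. -/
theorem le_add_of_deriv_le {E : ℝ → ℝ} {s T ν N G₀ : ℝ} (hG₀ : 0 ≤ G₀) (hN : 0 ≤ N)
    (hd : ∀ τ ∈ Icc s T, ∃ D, HasDerivAt E D τ ∧
      D ≤ -(ν + 4) * E τ + N * Real.exp (-ν * τ))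
    (h0 : Real.exp (ν * s) * E s ≤ G₀) {τ : ℝ} (hτ : τ ∈ Icc s T) :
    Real.exp (ν * τ) * E τ ≤ G₀ + N / 2 := by
  -- The excess of `e^{νr} E` over `N/2` decays at least like `e^{-4r}`: the derivative of `F` is at
  -- most `-N e^{4r}`.
  obtain ⟨F, hF⟩ : ∃ F : ℝ → ℝ, ∀ r, F r = Real.exp (4 * r) * (Real.exp (ν * r) * E r - N / 2) :=
    ⟨_, fun _ => rfl⟩
  have hFd : ∀ r ∈ Icc s T, ∃ D, HasDerivAt F D r ∧ D ≤ 0 := by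
    intro r hr
    obtain ⟨D, hD, hle⟩ := hd r hr
    have e : ∀ c : ℝ, HasDerivAt (fun r => Real.exp (c * r)) (Real.exp (c * r) * c) r := fun c => by
      simpa using ((hasDerivAt_id r).const_mul c).exp
    have h := (e 4).fun_mul (((e ν).fun_mul hD).sub_const (N / 2))
    rw [← funext hF] at h
    refine ⟨_, h, ?_⟩
    have h1 : Real.exp (ν * r) * D ≤
        -(ν + 4) * (Real.exp (ν * r) * E r) + N := by
      have := mul_le_mul_of_nonneg_left hle (Real.exp_pos (ν * r)).le
      have h2 : Real.exp (ν * r) * Real.exp (-ν * r) = 1 := by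
        rw [← Real.exp_add]; simp
      calc _ ≤ _ := this
        _ = -(ν + 4) * (Real.exp (ν * r) * E r) +
          N * (Real.exp (ν * r) * Real.exp (-ν * r)) := by ring
        _ = _ := by rw [h2, mul_one]
    have h3 : Real.exp (4 * r) * 4 * (Real.exp (ν * r) * E r - N / 2) +
        Real.exp (4 * r) * (Real.exp (ν * r) * ν * E r + Real.exp (ν * r) * D) =
        Real.exp (4 * r) * ((ν + 4) * (Real.exp (ν * r) * E r) - 2 * N +
          Real.exp (ν * r) * D) := by ring
    rw [h3]
    exact mul_nonpos_of_nonneg_of_nonpos (Real.exp_pos _).le (by linarith)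
  choose! F' hF' hF0 using hFd
  have hanti : AntitoneOn F (Icc s T) := by
    refine antitoneOn_of_deriv_nonpos (convex_Icc s T)
      (fun r hr => (hF' r hr).continuousAt.continuousWithinAt)
      (fun r hr => (hF' r (interior_subset hr)).differentiableAt.differentiableWithinAt)
      fun r hr => ?_
    rw [(hF' r (interior_subset hr)).deriv]
    exact hF0 r (interior_subset hr)
  have h1 := hanti ⟨le_rfl, hτ.1.trans hτ.2⟩ hτ hτ.1
  rw [hF, hF] at h1
  have h2 : Real.exp (4 * s) ≤ Real.exp (4 * τ) := Real.exp_le_exp.2 (by linarith [hτ.1])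
  have h3 : Real.exp (4 * s) * (Real.exp (ν * s) * E s - N / 2) ≤ Real.exp (4 * τ) * G₀ :=
    calc _ ≤ Real.exp (4 * s) * G₀ := by gcongr; linarith
      _ ≤ _ := by gcongr
  have h4 := le_of_mul_le_mul_left (h1.trans h3) (Real.exp_pos _)
  linarith

/-- A bounded family that can be improved by halving is controlled by twice the base value. -/
theorem le_two_mul_of_improve {ι : Type*} {f : ι → ℝ} {A G : ℝ} (hA : ∀ i, f i ≤ A)
    (h : ∀ N, (∀ i, f i ≤ N) → ∀ i, f i ≤ G + N / 2) (i : ι) : f i ≤ 2 * G := by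
  have : Nonempty ι := ⟨i⟩
  have hbdd : BddAbove (range f) := ⟨A, by rintro _ ⟨j, rfl⟩; exact hA j⟩
  have h1 := ciSup_le (h (⨆ j, f j) fun j => le_ciSup hbdd j)
  have h2 := le_ciSup hbdd i
  linarith

namespace IsNSSolution

variable {u : ℝ → ℝ × ℝ → ℝ × ℝ} (hu : IsNSSolution u)
include hu

/-- Let `N` bound the weighted energies over all centres and all times in `[s, t]`. The forcing is
then `N e^{-νr}` and the damping `8π² - M = ν + 4π²` exceeds `ν + 4`, so the bound improves to `G₀ +
N/2`. A crude finite bound, available from `abs_osc_le`, starts the absorption. -/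
theorem locEnergy_decay {M s t : ℝ}
    (hmean : ∀ t, 0 ≤ t → ∀ x₁, vavg (comp₁ (u t)) x₁ = 0)
    (hM : ∀ t, 0 < t → ∀ x, |vort (u t) x| ≤ M) (hMpi : M < 4 * Real.pi ^ 2) (hs : 0 < s)
    (hst : s ≤ t) (a : ℝ) :
    Real.exp ((4 * Real.pi ^ 2 - M) * t) * locEnergy locScale a (u t) ≤
      2 * (Real.exp ((4 * Real.pi ^ 2 - M) * s) * (4 * locScale * (136 * M) ^ 2)) := by
  obtain ⟨ν, hν⟩ : ∃ ν, ν = 4 * Real.pi ^ 2 - M := ⟨_, rfl⟩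
  have hν0 : 0 < ν := by linarith
  rw [← hν]
  have hpi3 := Real.pi_gt_three
  have hpi : Real.pi ^ 2 ≤ 10 := by nlinarith [Real.pi_lt_d2, Real.pi_pos]
  have hpi1 : 1 ≤ Real.pi ^ 2 := by nlinarith
  have hℓ := locScale_pos
  obtain ⟨E₀, hE₀⟩ : ∃ E₀, E₀ = 4 * locScale * (136 * M) ^ 2 := ⟨_, rfl⟩
  have hE₀0 : 0 ≤ E₀ := by rw [hE₀]; positivity
  have hbd : ∀ τ, 0 < τ → ∀ a, locEnergy locScale a (u τ) ≤ E₀ := fun τ hτ a => by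
    rw [hE₀]
    exact locEnergy_le hℓ (hu.continuous_oscDensity hτ)
      (hu.abs_osc_le hτ (hmean τ hτ.le) (hM τ hτ))
  rw [← hE₀]
  refine le_two_mul_of_improve (ι := Icc s t × ℝ)
    (f := fun i => Real.exp (ν * i.1) * locEnergy locScale i.2 (u i.1))
    (A := Real.exp (ν * t) * E₀) ?_ ?_ (⟨t, hst, le_rfl⟩, a)
  · rintro ⟨⟨τ, hτ⟩, b⟩
    have := hbd τ (hs.trans_le hτ.1) b
    have h0 : 0 ≤ locEnergy locScale b (u τ) := locEnergy_nonneg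
    have hτ2 := hτ.2
    simp only
    gcongr
  · rintro N hN ⟨⟨τ, hτ⟩, b⟩
    have hN0 : 0 ≤ N := le_trans (mul_nonneg (Real.exp_pos _).le locEnergy_nonneg)
      (hN (⟨τ, hτ⟩, b))
    refine le_add_of_deriv_le (E := fun τ => locEnergy locScale b (u τ)) (s := s) (T := t)
      (by positivity) hN0 (fun r hr => ?_)
      (mul_le_mul_of_nonneg_left (hbd s hs b) (Real.exp_pos _).le) hτ
    have hr0 : 0 < r := hs.trans_le hr.1
    obtain ⟨D, hD, hle⟩ := hu.exists_hasDerivAt_locEnergy_le (S := N * Real.exp (-ν * r)) hr0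
      (hmean r hr0.le) (hM r hr0) (by linarith)
      (fun a' => by
        have h1 := hN (⟨r, hr⟩, a')
        simp only at h1
        rw [neg_mul, Real.exp_neg, ← div_eq_mul_inv, le_div_iff₀ (Real.exp_pos _), mul_comm]
        exact h1) b
    refine ⟨D, hD, hle.trans ?_⟩
    have h0 : 0 ≤ locEnergy locScale b (u r) := locEnergy_nonneg
    gcongr
    linarith

end IsNSSolution

end StripNS

end

theorem proposition6p2 :
    ∀ ε : ℝ, 0 < ε → ∃ C₉ : ℝ, 0 < C₉ ∧
      ∀ (u : ℝ → ℝ × ℝ → ℝ × ℝ) (ω₀ : ℝ × ℝ → ℝ),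
        StripNS.IsNSSolution u →
        (∀ t : ℝ, 0 ≤ t → ∀ x₁ : ℝ, StripNS.vavg (StripNS.comp₁ (u t)) x₁ = 0) →
        MeasureTheory.MemLp ω₀ ⊤ MeasureTheory.volume →
        StripNS.IsWeakVort (u 0) ω₀ →
        StripNS.kappa ω₀ < 1 →
        ∀ t : ℝ, 0 ≤ t → ∀ a : ℝ,
          ∫ x₁ in (a - 1)..(a + 1), StripNS.oscEnergy (u t) x₁ ≤
            C₉ * StripNS.kappa ω₀ ^ 2 / (1 - StripNS.kappa ω₀) *
              Real.exp (-(8 * Real.pi ^ 2 * (1 - ε) * (1 - StripNS.kappa ω₀)) * t / 2) := by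
  intro ε hε
  have hpi := Real.pi_pos
  have hpi10 : Real.pi ^ 2 ≤ 10 := by nlinarith [Real.pi_lt_d2]
  have hℓ1 := StripNS.one_le_locScale
  have hℓ := StripNS.locScale_pos
  -- Here `24 = 2 · 3 · 4`: absorption, the bound for `e^{νs}` at the starting time, and the length
  -- `4ℓ` of the box. Since `M = 4π²κ`, `C κ²` equals `24 ℓ (136 M)²`.
  obtain ⟨C, hC⟩ : ∃ C, C = 24 * StripNS.locScale * (136 * (4 * Real.pi ^ 2)) ^ 2 := ⟨_, rfl⟩
  have hC0 : 0 < C := by rw [hC]; positivity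
  refine ⟨C, hC0, fun u ω₀ hu hmean hω hweak hκ1 t ht a => ?_⟩
  obtain ⟨M, hMdef⟩ : ∃ M, M = (eLpNorm ω₀ ⊤ volume).toReal := ⟨_, rfl⟩
  obtain ⟨κ, hκdef⟩ : ∃ κ, κ = StripNS.kappa ω₀ := ⟨_, rfl⟩
  have hMκ : M = 4 * Real.pi ^ 2 * κ := by
    rw [hκdef, StripNS.kappa, ← hMdef]; field_simp
  have hM0 : 0 ≤ M := hMdef ▸ ENNReal.toReal_nonneg
  have hκ0 : 0 ≤ κ := by rw [hκdef, StripNS.kappa]; positivity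
  rw [← hκdef] at hκ1 ⊢
  have hκ1' : 0 < 1 - κ := by linarith
  have hν : 4 * Real.pi ^ 2 - M = 4 * Real.pi ^ 2 * (1 - κ) := by rw [hMκ]; ring
  have hν0 : 0 < 4 * Real.pi ^ 2 - M := by rw [hν]; positivity
  have hM : ∀ t, 0 < t → ∀ x, |StripNS.vort (u t) x| ≤ M := fun t ht x => by
    rw [hMdef]; exact hu.abs_vort_le hω hweak ht x
  have hmain : ∫ x₁ in (a - 1)..(a + 1), StripNS.oscEnergy (u t) x₁ ≤
      C * κ ^ 2 * Real.exp (-((4 * Real.pi ^ 2 - M) * t)) := by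
    have hCM : C * κ ^ 2 = 24 * StripNS.locScale * (136 * M) ^ 2 := by rw [hC, hMκ]; ring
    rw [hCM]
    rcases ht.eq_or_lt with rfl | ht
    · have hB := hu.abs_osc_zero_le (B := 136 * M) fun t ht =>
        hu.abs_osc_le ht (hmean t ht.le) (hM t ht)
      have h := intervalIntegral.norm_integral_le_of_norm_le_const (a := a - 1) (b := a + 1)
        (f := StripNS.oscEnergy (u 0)) (C := (136 * M) ^ 2) fun s _ => by
          rw [Real.norm_of_nonneg (StripNS.oscEnergy_nonneg _ _)]
          exact StripNS.oscEnergy_le hB s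
      rw [show a + 1 - (a - 1) = 2 by ring, abs_two] at h
      refine (le_abs_self _).trans (h.trans ?_)
      rw [mul_zero, neg_zero, Real.exp_zero, mul_one, mul_comm]
      gcongr
      linarith
    -- The energy inequality holds only at positive times. Starting at `s ≤ 1/40` costs at most
    -- `e^{νs} ≤ e ≤ 3`, as `ν ≤ 4π² ≤ 40`.
    · obtain ⟨s, hs⟩ : ∃ s, s = min t (1 / 40) := ⟨_, rfl⟩
      have hs0 : 0 < s := by rw [hs]; exact lt_min ht (by norm_num)
      have hst : s ≤ t := hs ▸ min_le_left _ _
      have hs40 : s ≤ 1 / 40 := hs ▸ min_le_right _ _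
      have hdec := hu.locEnergy_decay hmean hM (by linarith) hs0 hst a
      have hexp : Real.exp ((4 * Real.pi ^ 2 - M) * s) ≤ 3 := by
        have h1 : (4 * Real.pi ^ 2 - M) * s ≤ 1 :=
          calc _ ≤ 40 * (1 / 40 : ℝ) := by gcongr; linarith
            _ = 1 := by norm_num
        exact (Real.exp_le_exp.2 h1).trans (by linarith [Real.exp_one_lt_d9])
      have hloc := StripNS.integral_le_locEnergy (a := a) hℓ (hu.continuous_oscDensity ht)
        (α := a - 1) (β := a + 1) (by linarith) (by linarith) (by linarith)
      refine hloc.trans ?_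
      rw [Real.exp_neg, ← div_eq_mul_inv, le_div_iff₀ (Real.exp_pos _), mul_comm]
      refine hdec.trans ?_
      calc _ ≤ 2 * (3 * (4 * StripNS.locScale * (136 * M) ^ 2)) := by gcongr
        _ = _ := by ring
  refine hmain.trans ?_
  -- The estimate just obtained, with rate `4π²(1-κ)` and no singular factor, is weakened to the
  -- stated form.
  have h1 : C * κ ^ 2 ≤ C * κ ^ 2 / (1 - κ) := by
    rw [le_div_iff₀ hκ1']
    exact mul_le_of_le_one_right (by positivity) (by linarith)
  have h2 : -((4 * Real.pi ^ 2 - M) * t) ≤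
      -(8 * Real.pi ^ 2 * (1 - ε) * (1 - κ)) * t / 2 := by
    rw [hν]
    have : 0 ≤ 4 * Real.pi ^ 2 * ε * (1 - κ) * t := by positivity
    linarith
  gcongr
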